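/- **Setting.** Let $d\ge 3$, $T\ge 1$, $p,q\in[1,\infty]$, $1/p+1/p^*=1$, $1/\infty=0$. Let $\mathcal X\subseteq\mathbb R^d$ be compact and convex with $r\mathbb B_p\subseteq\mathcal X\subseteq R\mathbb B_p$, $r>0$, where $\mathbb B_p$ is the open unit $\ell_p$-ball, and suppose $R\le\kappa\max_{x\in\mathcal X}\|x\|_p$. Let $f_1,\dots,f_T:\mathbb R^d\to\mathbb R$ be convex with $|f_t(x)-f_t(y)|\le G\|x-y\|_q$ for $x,y\in\mathcal X$, where $G>0$. Let $\psi:\operatorname{int}\mathcal X\to\mathbb R$ be differentiable, bounded above, and $\lambda$-strongly convex with respect to $\|\cdot\|_p$, $\lambda>0$. Put $B_\psi(x;y)=\psi(x)-\psi(y)-\langle\nabla\psi(y),x-y\rangle$ and $F_\psi=\sup_{\operatorname{int}\mathcal X}\psi-\inf_{\operatorname{int}\mathcal X}\psi$. Let $u_1,\dots,u_{T+1}\in\mathcal X$ be arbitrary comparators and $\mathcal P_{T,p}=\sum_{t=1}^T\|u_{t+1}-u_t\|_p$. Put $$\xi=\xi_{p,q}(d)=d^{1+\frac{2}{\min\{q,2\}}-\frac2p},\qquad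 \upsilon=d^{1+\frac1q-\frac1p-\frac1{\max\{q,p\}}},\qquad \zeta=\begin{cases}q\,d^{1/q}/(d+1),&q<\log d,\\ e\log(d)/(d+1),&q\ge\log d.\end{cases}$$ **Algorithm (PBMD).** The inputs are $\mu>0$, $\alpha\in(0,1)$ with $\mu d^{1-1/p}=\alpha r$, $\gamma>0$, $N\ge1$, step sizes $\eta_{(1)},\dots,\eta_{(N)}$, and a point $y_1\in\mathcal X_\alpha:=(1-\alpha)\mathcal X$. Set $y_{(k),1}=y_1$ and $\omega_{(k),1}=\frac{N+1}{N}\frac1{k(k+1)}$ for $k=1,\dots,N$. In each round $t=1,\dots,T$ let $y_t=\sum_k\omega_{(k),t}y_{(k),t}$, draw $s_t$ uniformly from the unit $\ell_1$-sphere, independently over rounds, play $x_t^\pm=y_t\pm\mu s_t$, and form $$g_t=\tfrac{d}{2\mu}\bigl(f_t(x_t^+)-f_t(x_t^-)\bigr)\operatorname{sign}(s_t),\qquad \varphi_t(y)=\langle g_t,y-y_t\rangle ,$$ where $\operatorname{sign}$ acts componentwise and $\operatorname{sign}(0)=1$. Then update $$\omega_{(k),t+1}=\frac{\omega_{(k),t}e^{-\gamma\varphi_t(y_{(k),t})}}{\sum_{j}\omega_{(j),t}e^{-\gamma\varphi_t(y_{(j),t})}},\qquad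 y_{(k),t+1}=\operatorname*{argmin}_{y\in\mathcal X_\alpha}\ \langle g_t,y\rangle+\tfrac1{\eta_{(k)}}B_\psi(y;y_{(k),t}).$$ **Parameters.** Put $v_1=(1-\alpha)u_1$ and $D=F_\psi+B_\psi(v_1;y_1)$. Let $G_\psi$ be a number such that, almost surely, $\|\nabla\psi(y_{(k),t})\|_{p^*}\le G_\psi$ for all $t\le T$ and $k\le N$, where the algorithm is run with $$N=\Bigl\lceil\tfrac12\log_2\Bigl(1+\tfrac{2RG_\psi T}{D}\Bigr)\Bigr\rceil+1,\qquad \eta_{(k)}=2^{k-1}\sqrt{\frac{D}{6(1+\sqrt2)^2G^2\xi T/\lambda}},$$ $$\frac{c_1}{RG\sqrt{\xi T}}\le\gamma\le\frac{c_2}{RG\sqrt{\xi T}},\qquad 0<\mu\le c_3\,\frac{\sqrt{D\,\xi}}{\sqrt{\lambda T}\,(1+\upsilon+\zeta)R/r}.$$ **Theorem.** For all $\kappa,c_1,c_2,c_3>0$ there is a constant $C>0$, depending only on $\kappa,c_1,c_2,c_3$, such that in every situation as above the dynamic regret is integrable and $$\mathbb E\left[\sum_{t=1}^T\frac{f_t(x_t^+)+f_t(x_t^-)}2-f_t(u_t)\right]\le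 C\,G\sqrt{\bigl(F_\psi+B_\psi(v_1;y_1)+G_\psi\mathcal P_{T,p}\bigr)\,\xi_{p,q}(d)\,T/\lambda},$$ where the expectation is over $s_1,\dots,s_T$. The parameters do not depend on the path variation $\mathcal P_{T,p}$. -/

import Mathlib

open MeasureTheory ProbabilityTheory
open scoped ENNReal

noncomputable section

/-- The `ℓ_p`-norm of a vector of `ℝ^d`, for `p ∈ [1, ∞]`. -/
def ellNorm {d : ℕ} (p : ℝ≥0∞) (x : Fin d → ℝ) : ℝ :=
  ‖(WithLp.toLp p x : PiLp p (fun _ : Fin d => ℝ))‖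

/-- The open `ℓ_p`-ball of radius `r` centered at the origin. -/
def ellBall (d : ℕ) (p : ℝ≥0∞) (r : ℝ) : Set (Fin d → ℝ) :=
  {x | ellNorm p x < r}

/-- The real number `1 / p`, with `1 / ∞ = 0`. -/
def recip (p : ℝ≥0∞) : ℝ := (p⁻¹).toReal

/-- The uniform distribution on the unit `ℓ_1`-sphere of `ℝ^d`: the law of `x / ‖x‖_1` for `x`
uniform in the unit `ℓ_1`-ball. All facets of the cross-polytope are congruent and equally far from
the origin, so this cone measure is the normalized surface measure of the sphere. -/
def unifL1Sphere (d : ℕ) : Measure (Fin d → ℝ) :=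
  (ProbabilityTheory.cond volume (ellBall d 1 1)).map (fun x => (ellNorm 1 x)⁻¹ • x)

/-- The component-wise sign, equal to `1` at `0`. -/
def signVec {d : ℕ} (x : Fin d → ℝ) : Fin d → ℝ :=
  fun i => if x i < 0 then -1 else 1

/-- The gradient of `ψ` at `y`. -/
def gradVec {d : ℕ} (ψ : (Fin d → ℝ) → ℝ) (y : Fin d → ℝ) : Fin d → ℝ :=
  fun i => fderiv ℝ ψ y (Pi.single i 1)

/-- The Bregman divergence `B_ψ(x; y)`. -/
def bregman {d : ℕ} (ψ : (Fin d → ℝ) → ℝ) (x y : Fin d → ℝ) : ℝ :=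
  ψ x - ψ y - gradVec ψ y ⬝ᵥ (x - y)

/-- `λ`-strong convexity of `ψ` on `S` with respect to the `ℓ_p`-norm. -/
def StronglyConvexLp {d : ℕ} (p : ℝ≥0∞) [Fact (1 ≤ p)] (S : Set (Fin d → ℝ)) (lam : ℝ)
    (ψ : (Fin d → ℝ) → ℝ) : Prop :=
  StrongConvexOn {x : PiLp p (fun _ : Fin d => ℝ) | WithLp.ofLp x ∈ S} lam
    (fun x => ψ (WithLp.ofLp x))

/-- `F_ψ = sup ψ - inf ψ` over the interior of `X`, which is the domain of `ψ`. -/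
def oscConst {d : ℕ} (ψ : (Fin d → ℝ) → ℝ) (X : Set (Fin d → ℝ)) : ℝ :=
  sSup (ψ '' interior X) - sInf (ψ '' interior X)

/-- `ξ_{p,q}(d) = d ^ (1 + 2 / min {q, 2} - 2 / p)`. -/
def xiConst (p q : ℝ≥0∞) (d : ℕ) : ℝ :=
  (d : ℝ) ^ (1 + 2 * recip (min q 2) - 2 * recip p)

/-- `υ_{p,q}(d) = d ^ (1 + 1 / q - 1 / p - 1 / max {q, p})`. -/
def upsilonConst (p q : ℝ≥0∞) (d : ℕ) : ℝ :=
  (d : ℝ) ^ (1 + recip q - recip p - recip (max q p))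

/-- `ζ_q(d) = q d^{1/q} / (d + 1)` if `q < log d`, and `e log d / (d + 1)` if `q ≥ log d`. -/
def zetaConst (q : ℝ≥0∞) (d : ℕ) : ℝ :=
  if q < ENNReal.ofReal (Real.log d) then q.toReal * (d : ℝ) ^ recip q / (d + 1)
  else Real.exp 1 * Real.log d / (d + 1)

/-- The path variation `∑_t ‖u_{t+1} - u_t‖_p` over `T` steps (rounds are numbered from `0`). -/
def pathVariation {d : ℕ} (p : ℝ≥0∞) (T : ℕ) (u : ℕ → Fin d → ℝ) : ℝ :=
  ∑ t ∈ Finset.range T, ellNorm p (u (t + 1) - u t)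

/-- The smallest step size of the grid; `D` stands for `F_ψ + B_ψ(v_1; y_1)` and `ξ` for
`ξ_{p,q}(d)`. -/
def etaBase (D G ξ lam : ℝ) (T : ℕ) : ℝ :=
  Real.sqrt (D / (6 * (1 + Real.sqrt 2) ^ 2 * G ^ 2 * ξ * T / lam))

/-- The number of candidate step sizes; `D` stands for `F_ψ + B_ψ(v_1; y_1)`. -/
def numLearners (D R Gψ : ℝ) (T : ℕ) : ℕ :=
  ⌈(1 / 2 : ℝ) * Real.logb 2 (1 + 2 * R * Gψ * T / D)⌉₊ + 1

/-- A minimizer of `h` over `S` (some point satisfying this, if there is one). -/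
def argminOn {d : ℕ} (S : Set (Fin d → ℝ)) (h : (Fin d → ℝ) → ℝ) : Fin d → ℝ :=
  Classical.epsilon (fun x => x ∈ S ∧ IsMinOn h S x)

/-- The shrunk set `X_α = (1 - α) X`. -/
def shrunk {d : ℕ} (X : Set (Fin d → ℝ)) (α : ℝ) : Set (Fin d → ℝ) :=
  (fun x => (1 - α) • x) '' X

namespace PBMD

/-- Inputs of parameter-free bandit mirror descent with `N` base learners: feasible set, mirror map,
smoothing, shrinkage and weight update parameters, candidate step sizes, and the starting point
of the base learners. -/
structure Input (d N : ℕ) where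
  X : Set (Fin d → ℝ)
  ψ : (Fin d → ℝ) → ℝ
  μ : ℝ
  α : ℝ
  γ : ℝ
  η : Fin N → ℝ
  y₁ : Fin d → ℝ

/-- The state at the beginning of a round: weights and iterates of the base learners. -/
structure State (d N : ℕ) where
  w : Fin N → ℝ
  y : Fin N → Fin d → ℝ

/-- The combined decision `y_t = ∑_k ω_{(k),t} y_{(k),t}` of the meta learner. -/
def State.combined {d N : ℕ} (S : State d N) : Fin d → ℝ :=
  ∑ k, S.w k • S.y k

/-- Initial state; the base learner with index `k` (from `0`) has weight
`(N + 1) / N * 1 / ((k + 1) (k + 2))`. -/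
def init {d N : ℕ} (I : Input d N) : State d N where
  w := fun k => ((N : ℝ) + 1) / N * (1 / (((k : ℝ) + 1) * ((k : ℝ) + 2)))
  y := fun _ => I.y₁

/-- The two-point `ℓ_1`-sphere gradient estimator at `y` for the loss `f` and the sample `s`. -/
def estimator {d : ℕ} (μ : ℝ) (f : (Fin d → ℝ) → ℝ) (y s : Fin d → ℝ) : Fin d → ℝ :=
  ((d : ℝ) / (2 * μ) * (f (y + μ • s) - f (y - μ • s))) • signVec s

/-- One round, with loss `f` and sample `s`. The surrogate is `φ y = ⟨g, y - y_t⟩`,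
whose gradient is `g`. -/
def step {d N : ℕ} (I : Input d N) (f : (Fin d → ℝ) → ℝ) (s : Fin d → ℝ) (S : State d N) :
    State d N :=
  let g := estimator I.μ f S.combined s
  let φ : (Fin d → ℝ) → ℝ := fun y => g ⬝ᵥ (y - S.combined)
  { w := fun k => S.w k * Real.exp (-I.γ * φ (S.y k)) /
      ∑ j, S.w j * Real.exp (-I.γ * φ (S.y j))
    y := fun k => argminOn (shrunk I.X I.α)
      (fun y => g ⬝ᵥ y + 1 / I.η k * bregman I.ψ y (S.y k)) }

/-- The state at the beginning of round `t` (rounds are numbered from `0`) when the losses are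
`f 0, f 1, …` and the samples are `s 0, s 1, …`. -/
def state {d N : ℕ} (I : Input d N) (f : ℕ → (Fin d → ℝ) → ℝ) (s : ℕ → Fin d → ℝ) :
    ℕ → State d N
  | 0 => init I
  | t + 1 => step I (f t) (s t) (state I f s t)

/-- The dynamic regret over `T` rounds with respect to the comparators `u`. -/
def regret {d N : ℕ} (I : Input d N) (f : ℕ → (Fin d → ℝ) → ℝ) (u s : ℕ → Fin d → ℝ) (T : ℕ) : ℝ :=
  ∑ t ∈ Finset.range T,
    ((f t ((state I f s t).combined + I.μ • s t) + f t ((state I f s t).combined - I.μ • s t)) / 2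
      - f t (u t))

end PBMD

end

/-!
The regret bound combines a pathwise analysis of the algorithm, which treats the estimates `g_t` as
arbitrary vectors, with two estimates for the first and second moments of the gradient estimator.

*Pathwise part.* Write `v_t = (1 - α) u_t`. For each base learner `k`, the linearized regret
`∑ ⟨g_t, y_t - v_t⟩` is the regret of the weights against learner `k` plus the dynamic regret of
learner `k`. The former is bounded by exponential weights (`expWeights_regret_le`); since the surrogate
losses have weighted mean zero, only a second-order term `γ R² ∑ ‖g_t‖²` and `log (1 / ω_k) / γ`
appear. The latter is bounded by mirror descent with moving comparators
(`mirror_dynamic_regret_le`): the Bregman divergences telescope up to the oscillation of `ψ` and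
`Gψ` times the path variation. Together this is `PBMD.linear_regret_le`.

*Moments of the estimator.* The sampling law is a cone measure, so polar coordinates for the
`ℓ_1`-norm are available (`lintegral_polar`).
The conditional mean satisfies the subgradient inequality of the loss up to `2 G μ`
(`integral_estimator_dotProduct_le`). The reason is the divergence theorem on the `ℓ_1`-ball, whose
outer normal is the sign vector. For a convex function only an inequality is needed, and that follows
from monotonicity of difference quotients and a Lipschitz cutoff function, without derivatives.
The conditional second moment in the dual norm is at most `224 G² ξ`
(`integral_ellNorm_estimator_sq_le`). The norm of the estimator is a multiple of an odd Lipschitz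
function on the sphere, which has mean zero, so a Poincaré inequality on the `ℓ_1`-sphere with
constant of order `1 / d²` is enough. It is inherited from the product of Laplace distributions, of
which the uniform law on the sphere is the image under `x ↦ x / ‖x‖₁`: the one-dimensional Poincaré
inequality is a Hardy inequality, and the Efron–Stein inequality tensorizes it.

*Conclusion.* The decision `y_t` is a measurable function of the earlier samples, hence independent
of the current one, and the two moment bounds apply conditionally (`PBMD.expected_regret_le`).
Exploration and shrinkage cost a multiple of `μ`, which the bound on `μ` absorbs. The grid of step
sizes contains one within a factor two of the optimum, whatever the path variation is. The price
`log (1 / ω_k)` of that learner is at most `2 ^ (k + 1)` and is absorbed as well, because the radius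
`R` is controlled by `√(D / λ)` (`radius_sq_le_oscConst`): a strongly convex function oscillates at
least quadratically in the diameter.
-/

/-! ### The `ℓ_p`-norms -/

section Norms

variable {d : ℕ} {p q : ℝ≥0∞}

theorem ellNorm_nonneg [Fact (1 ≤ p)] (x : Fin d → ℝ) : 0 ≤ ellNorm p x := norm_nonneg _

theorem ellNorm_zero [Fact (1 ≤ p)] : ellNorm p (0 : Fin d → ℝ) = 0 := by
  simp [ellNorm]

theorem ellNorm_add_le [Fact (1 ≤ p)] (x y : Fin d → ℝ) :
    ellNorm p (x + y) ≤ ellNorm p x + ellNorm p y := by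
  simpa [ellNorm] using norm_add_le (WithLp.toLp p x : PiLp p (fun _ : Fin d => ℝ)) (WithLp.toLp p y)

theorem ellNorm_smul [Fact (1 ≤ p)] (c : ℝ) (x : Fin d → ℝ) :
    ellNorm p (c • x) = |c| * ellNorm p x := by
  simpa [ellNorm] using norm_smul c (WithLp.toLp p x : PiLp p (fun _ : Fin d => ℝ))

theorem ellNorm_neg [Fact (1 ≤ p)] (x : Fin d → ℝ) : ellNorm p (-x) = ellNorm p x := by
  simp [ellNorm]

theorem ellNorm_sub_comm [Fact (1 ≤ p)] (x y : Fin d → ℝ) :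
    ellNorm p (x - y) = ellNorm p (y - x) := by
  rw [← ellNorm_neg, neg_sub]

theorem ellNorm_sub_le [Fact (1 ≤ p)] (x y : Fin d → ℝ) :
    ellNorm p (x - y) ≤ ellNorm p x + ellNorm p y := by
  rw [sub_eq_add_neg, ← ellNorm_neg y]
  exact ellNorm_add_le x (-y)

theorem ellNorm_eq_zero [Fact (1 ≤ p)] {x : Fin d → ℝ} : ellNorm p x = 0 ↔ x = 0 := by
  simp [ellNorm]

theorem ellNorm_pos [Fact (1 ≤ p)] {x : Fin d → ℝ} (hx : x ≠ 0) : 0 < ellNorm p x :=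
  (ellNorm_nonneg x).lt_of_ne' (mt ellNorm_eq_zero.1 hx)

theorem continuous_ellNorm [Fact (1 ≤ p)] : Continuous (ellNorm p : (Fin d → ℝ) → ℝ) :=
  continuous_norm.comp (PiLp.continuous_toLp p _)

theorem ellNorm_single [Fact (1 ≤ p)] (i : Fin d) (a : ℝ) : ellNorm p (Pi.single i a) = |a| := by
  simp [ellNorm]

theorem abs_apply_le_ellNorm [Fact (1 ≤ p)] (x : Fin d → ℝ) (i : Fin d) :
    |x i| ≤ ellNorm p x := by
  simpa [ellNorm] using PiLp.norm_apply_le (WithLp.toLp p x : PiLp p (fun _ : Fin d => ℝ)) i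

theorem ellNorm_top (x : Fin d → ℝ) : ellNorm ∞ x = ⨆ i, |x i| := by
  simp [ellNorm, PiLp.norm_eq_ciSup]

theorem ellNorm_top_le {x : Fin d → ℝ} {c : ℝ} (hc : 0 ≤ c) (h : ∀ i, |x i| ≤ c) :
    ellNorm ∞ x ≤ c := by
  rw [ellNorm_top]
  exact Real.iSup_le h hc

theorem ellNorm_eq_sum (hp : 0 < p.toReal) (x : Fin d → ℝ) :
    ellNorm p x = (∑ i, |x i| ^ p.toReal) ^ (1 / p.toReal) := by
  simp [ellNorm, PiLp.norm_eq_sum hp]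

theorem ellNorm_one (x : Fin d → ℝ) : ellNorm 1 x = ∑ i, |x i| := by
  simp [ellNorm, PiLp.norm_eq_of_L1]

theorem ellNorm_two_sq (x : Fin d → ℝ) : ellNorm 2 x ^ 2 = ∑ i, x i ^ 2 := by
  simp [ellNorm, PiLp.norm_sq_eq_of_L2]

theorem toReal_pos_of_one_le [hp : Fact (1 ≤ p)] (h : p ≠ ∞) : 0 < p.toReal :=
  ENNReal.toReal_pos (zero_lt_one.trans_le hp.1).ne' h

theorem recip_eq (p : ℝ≥0∞) : recip p = p.toReal⁻¹ := by
  simp [recip]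

theorem recip_le_one [hp : Fact (1 ≤ p)] : recip p ≤ 1 := by
  have := ENNReal.toReal_mono ENNReal.one_ne_top (ENNReal.inv_le_one.2 hp.1)
  simpa [recip] using this

theorem recip_two : recip 2 = 1 / 2 := by simp [recip]

theorem ellNorm_of_abs_eq [Fact (1 ≤ p)] (hd : 0 < d) {x : Fin d → ℝ} {c : ℝ}
    (h : ∀ i, |x i| = c) : ellNorm p x = c * (d : ℝ) ^ recip p := by
  have hc : 0 ≤ c := by rw [← h ⟨0, hd⟩]; exact abs_nonneg _
  have : Nonempty (Fin d) := ⟨⟨0, hd⟩⟩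
  by_cases hp : p = ∞
  · subst hp
    simp [ellNorm_top, h, recip]
  · have hp0 := toReal_pos_of_one_le hp
    rw [ellNorm_eq_sum hp0]
    simp only [h, Finset.sum_const, Finset.card_univ, Fintype.card_fin, nsmul_eq_mul]
    rw [Real.mul_rpow (by positivity) (by positivity), ← Real.rpow_mul hc, recip_eq,
      mul_one_div_cancel hp0.ne', Real.rpow_one, one_div, mul_comm]

theorem ellNorm_anti [Fact (1 ≤ p)] [Fact (1 ≤ q)] (hpq : p ≤ q) (x : Fin d → ℝ) :
    ellNorm q x ≤ ellNorm p x := by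
  by_cases hq : q = ∞
  · subst hq
    exact ellNorm_top_le (ellNorm_nonneg x) (abs_apply_le_ellNorm x)
  have hp : p ≠ ∞ := ne_top_of_le_ne_top hq hpq
  have hp0 := toReal_pos_of_one_le hp
  have hq0 := toReal_pos_of_one_le hq
  have hle : p.toReal ≤ q.toReal := ENNReal.toReal_mono hq hpq
  rcases eq_or_ne x 0 with rfl | hx
  · rw [ellNorm_zero, ellNorm_zero]
  set N := ellNorm p x with hN
  have hNpos : 0 < N := ellNorm_pos hx
  have hsum : ∑ i, |x i| ^ p.toReal = N ^ p.toReal := by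
    rw [hN, ellNorm_eq_sum hp0, ← Real.rpow_mul (by positivity), one_div_mul_cancel hp0.ne',
      Real.rpow_one]
  rw [ellNorm_eq_sum hq0, one_div]
  refine (Real.rpow_le_rpow_iff (by positivity) hNpos.le hq0).1 ?_
  rw [← Real.rpow_mul (by positivity), inv_mul_cancel₀ hq0.ne', Real.rpow_one]
  calc ∑ i, |x i| ^ q.toReal
      ≤ ∑ i, |x i| ^ p.toReal * N ^ (q.toReal - p.toReal) := by
        refine Finset.sum_le_sum fun i _ => ?_
        rcases (abs_nonneg (x i)).eq_or_lt with h0 | h0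
        · rw [← h0, Real.zero_rpow hq0.ne', Real.zero_rpow hp0.ne']; simp
        · calc |x i| ^ q.toReal = |x i| ^ p.toReal * |x i| ^ (q.toReal - p.toReal) := by
                rw [← Real.rpow_add h0]; congr 1; ring
            _ ≤ _ := by
                have hi := abs_apply_le_ellNorm (p := p) x i
                gcongr
    _ = N ^ q.toReal := by
        rw [← Finset.sum_mul, hsum, ← Real.rpow_add hNpos]; congr 1; ring

theorem ellNorm_le_rpow_mul [Fact (1 ≤ p)] [Fact (1 ≤ q)] (hd : 0 < d) (hqp : q ≤ p)
    (x : Fin d → ℝ) : ellNorm q x ≤ (d : ℝ) ^ (recip q - recip p) * ellNorm p x := by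
  have hd' : (0 : ℝ) < d := by exact_mod_cast hd
  by_cases hq : q = ∞
  · have hp : p = ∞ := top_le_iff.1 (hq ▸ hqp)
    subst hq; subst hp; simp
  have hq0 := toReal_pos_of_one_le hq
  by_cases hp : p = ∞
  · subst hp
    rw [ellNorm_eq_sum hq0]
    have hN := ellNorm_nonneg (p := ∞) x
    calc (∑ i, |x i| ^ q.toReal) ^ (1 / q.toReal)
        ≤ (∑ _i : Fin d, ellNorm ∞ x ^ q.toReal) ^ (1 / q.toReal) := by
          gcongr
          exact abs_apply_le_ellNorm x _
      _ = _ := by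
          simp only [Finset.sum_const, Finset.card_univ, Fintype.card_fin, nsmul_eq_mul]
          rw [Real.mul_rpow (by positivity) (by positivity), ← Real.rpow_mul hN,
            mul_one_div_cancel hq0.ne', Real.rpow_one, recip_eq, recip_eq]
          simp
  have hp0 := toReal_pos_of_one_le hp
  have hle : q.toReal ≤ p.toReal := ENNReal.toReal_mono hp hqp
  rw [ellNorm_eq_sum hq0, ellNorm_eq_sum hp0]
  -- the power mean inequality with exponent `p / q ≥ 1`
  have key := Real.rpow_sum_le_const_mul_sum_rpow (Finset.univ : Finset (Fin d))
    (f := fun i => |x i| ^ q.toReal) (p := p.toReal / q.toReal) ((one_le_div hq0).2 hle)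
  have hs : 0 ≤ ∑ i, |x i| ^ q.toReal := by positivity
  simp only [Finset.card_univ, Fintype.card_fin] at key
  have e1 : ∀ i, (|x i| ^ q.toReal) ^ (p.toReal / q.toReal) = |x i| ^ p.toReal := by
    intro i
    rw [← Real.rpow_mul (abs_nonneg _), mul_div_cancel₀ _ hq0.ne']
  have e2 : ∀ i, |(|x i| ^ q.toReal)| = |x i| ^ q.toReal := fun i => abs_of_nonneg (by positivity)
  simp only [e2, e1] at key
  have key2 := Real.rpow_le_rpow (by positivity) key (z := 1 / p.toReal) (by positivity)
  rw [← Real.rpow_mul hs, Real.mul_rpow (by positivity) (by positivity),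
    ← Real.rpow_mul hd'.le] at key2
  have e3 : p.toReal / q.toReal * (1 / p.toReal) = 1 / q.toReal := by field_simp
  have e4 : (p.toReal / q.toReal - 1) * (1 / p.toReal) = recip q - recip p := by
    rw [recip_eq, recip_eq]; field_simp
  rwa [e3, e4] at key2

/-- Comparison of two `ℓ_p`-norms with the optimal power of the dimension. -/
theorem ellNorm_le_rpow_min_mul [Fact (1 ≤ p)] [Fact (1 ≤ q)] (hd : 0 < d) (x : Fin d → ℝ) :
    ellNorm q x ≤ (d : ℝ) ^ (recip (min q p) - recip p) * ellNorm p x := by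
  rcases le_total q p with h | h
  · rw [min_eq_left h]; exact ellNorm_le_rpow_mul hd h x
  · rw [min_eq_right h]; simpa using ellNorm_anti h x

theorem fact_one_le_conjExponent : Fact (1 ≤ ENNReal.conjExponent p) := ⟨le_self_add⟩

theorem recip_conjExponent [hp : Fact (1 ≤ p)] :
    recip (ENNReal.conjExponent p) = 1 - recip p := by
  have h := (ENNReal.HolderConjugate.conjExponent hp.1)
  have h1 : p⁻¹ + (ENNReal.conjExponent p)⁻¹ = 1 := h.inv_add_inv_eq_one
  have h2 := congrArg ENNReal.toReal h1
  rw [ENNReal.toReal_add] at h2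
  · simp only [recip]; simp at h2 ⊢; linarith
  · exact ne_top_of_le_ne_top ENNReal.one_ne_top (h1 ▸ le_self_add)
  · exact ne_top_of_le_ne_top ENNReal.one_ne_top (h1 ▸ le_add_self)

/-- Hölder's inequality for the dual pair of an `ℓ_p`-norm and an `ℓ_{p*}`-norm. -/
theorem abs_dotProduct_le [hp : Fact (1 ≤ p)] (g x : Fin d → ℝ) :
    |g ⬝ᵥ x| ≤ ellNorm (ENNReal.conjExponent p) g * ellNorm p x := by
  have h := (ENNReal.HolderConjugate.conjExponent hp.1)
  have hab : |g ⬝ᵥ x| ≤ ∑ i, |g i| * |x i| := by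
    simp only [dotProduct]
    refine (Finset.abs_sum_le_sum_abs _ _).trans (le_of_eq ?_)
    simp [abs_mul]
  refine hab.trans ?_
  by_cases h1 : p = 1
  · subst h1
    have : ENNReal.conjExponent 1 = ∞ := by simp [ENNReal.conjExponent]
    rw [this, ellNorm_one, Finset.mul_sum]
    gcongr
    exact abs_apply_le_ellNorm _ _
  by_cases h2 : p = ∞
  · subst h2
    have : ENNReal.conjExponent ∞ = 1 := by simp [ENNReal.conjExponent]
    rw [this, ellNorm_one, Finset.sum_mul]
    gcongr
    exact abs_apply_le_ellNorm _ _
  have h1' : 1 < p := lt_of_le_of_ne hp.1 (Ne.symm h1)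
  have h3 : ENNReal.conjExponent p ≠ ∞ := by
    simp [ENNReal.conjExponent, tsub_eq_zero_iff_le, h1']
  have := fact_one_le_conjExponent (p := p)
  have hp0 := toReal_pos_of_one_le h2
  have hq0 := toReal_pos_of_one_le h3
  have hc : (ENNReal.conjExponent p).toReal.HolderConjugate p.toReal := by
    have e := recip_conjExponent (p := p)
    rw [recip_eq, recip_eq] at e
    exact { inv_add_inv_eq_inv := by rw [e]; simp, left_pos := hq0, right_pos := hp0 }
  rw [ellNorm_eq_sum hq0, ellNorm_eq_sum hp0]
  have := Real.inner_le_Lp_mul_Lq (Finset.univ : Finset (Fin d)) (fun i => |g i|) (fun i => |x i|) hc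
  simpa using this

end Norms

/-! ### Polar coordinates for the `ℓ_1`-norm -/

section Polar

open Set Measure

variable {d : ℕ}

theorem measurable_ellNorm {p : ℝ≥0∞} [Fact (1 ≤ p)] :
    Measurable (ellNorm p : (Fin d → ℝ) → ℝ) := continuous_ellNorm.measurable

theorem measurableSet_ellBall {p : ℝ≥0∞} [Fact (1 ≤ p)] (r : ℝ) :
    MeasurableSet (ellBall d p r) := measurable_ellNorm measurableSet_Iio

/-- The normalizing constant of polar coordinates, the mass of the cone measure of the sphere. -/
noncomputable def polarConst (d : ℕ) : ℝ≥0∞ := d * volume (ellBall d 1 1)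

theorem measurable_normalize :
    Measurable (fun x : Fin d → ℝ => (ellNorm 1 x)⁻¹ • x) :=
  measurable_ellNorm.inv.smul measurable_id

/-- Polar coordinates for the `ℓ_1`-norm with respect to some measure on the sphere. This is
Mathlib's polar decomposition of a Haar measure, applied to `PiLp 1`. -/
theorem exists_coneMeasure (hd : 0 < d) : ∃ τ : Measure (Fin d → ℝ), IsFiniteMeasure τ ∧ τ ≠ 0 ∧
    (∀ᵐ s ∂τ, ellNorm 1 s = 1) ∧
    ∀ g : (Fin d → ℝ) → ℝ≥0∞, Measurable g → ∫⁻ x, g x =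
      ∫⁻ t in Ioi (0 : ℝ), ENNReal.ofReal (t ^ (d - 1)) * ∫⁻ s, g (t • s) ∂τ := by
  let E := PiLp 1 (fun _ : Fin d => ℝ)
  have : Nonempty (Fin d) := ⟨⟨0, hd⟩⟩
  let ν : Measure E := (volume : Measure (Fin d → ℝ)).map (WithLp.toLp 1)
  have hν : ν.IsAddHaarMeasure :=
    (PiLp.continuousLinearEquiv 1 ℝ (fun _ : Fin d => ℝ)).symm.isAddHaarMeasure_map volume
  have : Nontrivial E := (WithLp.equiv 1 (Fin d → ℝ)).nontrivial
  have hdim : Module.finrank ℝ E = d := by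
    rw [(PiLp.continuousLinearEquiv 1 ℝ (fun _ : Fin d => ℝ)).toLinearEquiv.finrank_eq]
    simp
  have hm : Measurable (fun s : Metric.sphere (0 : E) 1 => (WithLp.ofLp s.1 : Fin d → ℝ)) :=
    (PiLp.continuous_ofLp 1 _).measurable.comp measurable_subtype_coe
  refine ⟨ν.toSphere.map (fun s => WithLp.ofLp s.1), ?_, ?_, ?_, ?_⟩
  · infer_instance
  · rw [Ne, Measure.map_eq_zero_iff hm.aemeasurable]
    exact ν.toSphere_ne_zero
  · rw [ae_map_iff (p := fun s => ellNorm 1 s = 1) hm.aemeasurable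
      (measurable_ellNorm (measurableSet_singleton 1))]
    refine Filter.Eventually.of_forall fun s => ?_
    simp [ellNorm]
  · intro g hg
    have hg' : Measurable (fun z : E => g (WithLp.ofLp z)) :=
      hg.comp (PiLp.continuous_ofLp 1 _).measurable
    have h1 : ∫⁻ x, g x = ∫⁻ z, g (WithLp.ofLp z) ∂ν := by
      rw [lintegral_map hg' (PiLp.continuous_toLp 1 _).measurable]
    have h2 : ∫⁻ z, g (WithLp.ofLp z) ∂ν
        = ∫⁻ z : ({0}ᶜ : Set E), g (WithLp.ofLp z.1) ∂(ν.comap (↑)) := by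
      rw [lintegral_subtype_comap (measurableSet_singleton (0 : E)).compl
        (fun z : E => g (WithLp.ofLp z)), restrict_compl_singleton]
    have h3 : ∫⁻ z : ({0}ᶜ : Set E), g (WithLp.ofLp z.1) ∂(ν.comap (↑))
        = ∫⁻ w, g ((w.2 : ℝ) • WithLp.ofLp (w.1 : E))
          ∂(ν.toSphere.prod (volumeIoiPow (Module.finrank ℝ E - 1))) := by
      rw [← ν.measurePreserving_homeomorphUnitSphereProd.lintegral_comp_emb
        (Homeomorph.measurableEmbedding _)]
      refine lintegral_congr fun z => ?_
      have hz : (z.1 : E) ≠ 0 := z.2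
      congr 1
      simp only [homeomorphUnitSphereProd_apply_snd_coe, homeomorphUnitSphereProd_apply_fst_coe]
      rw [← WithLp.ofLp_smul, smul_smul, mul_inv_cancel₀ (norm_ne_zero_iff.2 hz), one_smul]
    have hg2 : Measurable (fun w : Metric.sphere (0 : E) 1 × Ioi (0 : ℝ) =>
        g ((w.2 : ℝ) • WithLp.ofLp (w.1 : E))) :=
      hg.comp ((measurable_subtype_coe.comp measurable_snd).smul (hm.comp measurable_fst))
    rw [h1, h2, h3, lintegral_prod_symm' _ hg2, hdim, volumeIoiPow,
      lintegral_withDensity_eq_lintegral_mul _ (by fun_prop) hg2.lintegral_prod_left']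
    have h4 : ∀ t : ℝ, ∫⁻ s, g (t • s) ∂(ν.toSphere.map (fun s => WithLp.ofLp s.1))
        = ∫⁻ s : Metric.sphere (0 : E) 1, g (t • WithLp.ofLp (s : E)) ∂ν.toSphere := fun t =>
      lintegral_map (hg.comp (measurable_const_smul t)) hm
    simp only [h4, Pi.mul_apply]
    rw [lintegral_subtype_comap measurableSet_Ioi
      (fun t : ℝ => ENNReal.ofReal (t ^ (d - 1)) *
        ∫⁻ s : Metric.sphere (0 : E) 1, g (t • WithLp.ofLp (s : E)) ∂ν.toSphere)]

theorem lintegral_Ioi_indicator_pow (hd : 0 < d) :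
    ∫⁻ t in Ioi (0 : ℝ), ENNReal.ofReal (t ^ (d - 1)) * (Iio (1 : ℝ)).indicator 1 t = (d : ℝ≥0∞)⁻¹ := by
  have h1 : ∀ t : ℝ, ENNReal.ofReal (t ^ (d - 1)) * (Iio (1 : ℝ)).indicator 1 t
      = (Iio (1 : ℝ)).indicator (fun t => ENNReal.ofReal (t ^ (d - 1))) t := by
    intro t
    by_cases ht : t ∈ Iio (1 : ℝ) <;> simp [ht]
  simp only [h1]
  rw [setLIntegral_indicator measurableSet_Iio, Iio_inter_Ioi,
    ← ofReal_integral_eq_lintegral_ofReal, ← integral_Ioc_eq_integral_Ioo,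
    ← intervalIntegral.integral_of_le zero_le_one, integral_pow]
  · have : ((d - 1 : ℕ) : ℝ) + 1 = d := by
      rw [Nat.cast_sub hd]; simp
    rw [this, Nat.sub_add_cancel hd, zero_pow hd.ne', one_pow, sub_zero, one_div,
      ENNReal.ofReal_inv_of_pos (by exact_mod_cast hd), ENNReal.ofReal_natCast]
  · exact (intervalIntegral.intervalIntegrable_pow (d - 1) (a := 0) (b := 1)).1.mono_set
      Ioo_subset_Ioc_self
  · filter_upwards [ae_restrict_mem measurableSet_Ioo] with t ht
    exact pow_nonneg ht.1.le _

/-- The measure in polar coordinates is a multiple of `unifL1Sphere`: both are determined by the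
volumes of the cones over subsets of the sphere. -/
theorem coneMeasure_spec (hd : 0 < d) : ∃ τ : Measure (Fin d → ℝ), IsFiniteMeasure τ ∧
    (∀ᵐ s ∂τ, ellNorm 1 s = 1) ∧ τ univ = polarConst d ∧ polarConst d ≠ 0 ∧
    unifL1Sphere d = (polarConst d)⁻¹ • τ ∧
    ∀ g : (Fin d → ℝ) → ℝ≥0∞, Measurable g → ∫⁻ x, g x =
      ∫⁻ t in Ioi (0 : ℝ), ENNReal.ofReal (t ^ (d - 1)) * ∫⁻ s, g (t • s) ∂τ := by
  obtain ⟨τ, hfin, h0, hs, hg⟩ := exists_coneMeasure hd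
  have hd0 : (d : ℝ≥0∞) ≠ 0 := by exact_mod_cast hd.ne'
  have hcone : ∀ A : Set (Fin d → ℝ), MeasurableSet A →
      volume (ellBall d 1 1 ∩ (fun x => (ellNorm 1 x)⁻¹ • x) ⁻¹' A) = (d : ℝ≥0∞)⁻¹ * τ A := by
    intro A hA
    have hmA := (measurableSet_ellBall (d := d) (p := 1) 1).inter (measurable_normalize hA)
    rw [← lintegral_indicator_one hmA, hg _ (measurable_one.indicator hmA)]
    have h1 : ∀ t ∈ Ioi (0 : ℝ), ENNReal.ofReal (t ^ (d - 1)) *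
        ∫⁻ s, (ellBall d 1 1 ∩ (fun x => (ellNorm 1 x)⁻¹ • x) ⁻¹' A).indicator 1 (t • s) ∂τ
        = ENNReal.ofReal (t ^ (d - 1)) * (Iio (1 : ℝ)).indicator 1 t * τ A := by
      intro t ht
      rw [mul_assoc]
      congr 1
      have ht' : 0 < t := ht
      rw [← lintegral_indicator_one hA, ← lintegral_const_mul _ (measurable_one.indicator hA)]
      refine lintegral_congr_ae ?_
      filter_upwards [hs] with s hs
      have e1 : ellNorm 1 (t • s) = t := by rw [ellNorm_smul, hs, abs_of_pos ht', mul_one]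
      have e2 : t⁻¹ • t • s = s := inv_smul_smul₀ ht'.ne' s
      by_cases hA : s ∈ A <;> by_cases ht1 : t < 1 <;>
        simp [indicator, ellBall, e1, e2, hA, ht1]
    rw [setLIntegral_congr_fun measurableSet_Ioi h1, lintegral_mul_const _ (by
      refine Measurable.mul (by fun_prop) (measurable_one.indicator measurableSet_Iio)),
      lintegral_Ioi_indicator_pow hd]
  have huniv : τ univ = polarConst d := by
    have := hcone univ MeasurableSet.univ
    rw [preimage_univ, inter_univ] at this
    rw [polarConst, this, ← mul_assoc, ENNReal.mul_inv_cancel hd0 (by simp), one_mul]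
  refine ⟨τ, hfin, hs, huniv, ?_, ?_, hg⟩
  · rw [← huniv]; simpa using h0
  · ext A hA
    have hb : volume (ellBall d 1 1) = (d : ℝ≥0∞)⁻¹ * τ univ := by
      simpa using hcone univ MeasurableSet.univ
    rw [unifL1Sphere, Measure.map_apply measurable_normalize hA, cond_apply
      (measurableSet_ellBall 1), hcone A hA, Measure.smul_apply, smul_eq_mul, hb, ← huniv,
      ENNReal.mul_inv (Or.inr (measure_ne_top τ _)) (Or.inl (ENNReal.inv_ne_top.2 hd0)), inv_inv]
    calc (d : ℝ≥0∞) * (τ univ)⁻¹ * ((d : ℝ≥0∞)⁻¹ * τ A)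
        = (d : ℝ≥0∞) * (d : ℝ≥0∞)⁻¹ * ((τ univ)⁻¹ * τ A) := by ring
      _ = _ := by rw [ENNReal.mul_inv_cancel hd0 (by simp), one_mul]

theorem polarConst_ne_zero (hd : 0 < d) : polarConst d ≠ 0 := by
  obtain ⟨τ, -, -, -, h, -⟩ := coneMeasure_spec hd
  exact h

theorem polarConst_ne_top (hd : 0 < d) : polarConst d ≠ ∞ := by
  obtain ⟨τ, hfin, -, h, -⟩ := coneMeasure_spec hd
  rw [← h]; exact measure_ne_top τ _

theorem isProbabilityMeasure_unifL1Sphere (hd : 0 < d) :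
    IsProbabilityMeasure (unifL1Sphere d) := by
  obtain ⟨τ, hfin, -, h, h0, he, -⟩ := coneMeasure_spec hd
  refine ⟨?_⟩
  rw [he, Measure.smul_apply, h, smul_eq_mul, ENNReal.inv_mul_cancel h0 (polarConst_ne_top hd)]

theorem ae_ellNorm_unifL1Sphere (hd : 0 < d) : ∀ᵐ s ∂(unifL1Sphere d), ellNorm 1 s = 1 := by
  obtain ⟨τ, hfin, hs, -, -, he, -⟩ := coneMeasure_spec hd
  rw [he]
  exact Measure.smul_absolutelyContinuous.ae_le hs

/-- Integration in polar coordinates for the `ℓ_1`-norm. -/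
theorem lintegral_polar (hd : 0 < d) {g : (Fin d → ℝ) → ℝ≥0∞} (hg : Measurable g) :
    ∫⁻ x, g x = polarConst d *
      ∫⁻ t in Ioi (0 : ℝ), ENNReal.ofReal (t ^ (d - 1)) * ∫⁻ s, g (t • s) ∂(unifL1Sphere d) := by
  have := isProbabilityMeasure_unifL1Sphere hd
  obtain ⟨τ, hfin, -, -, h0, he, hτ⟩ := coneMeasure_spec hd
  have hm : Measurable fun t : ℝ => ∫⁻ s, g (t • s) ∂(unifL1Sphere d) :=
    Measurable.lintegral_prod_right' (f := fun w : ℝ × (Fin d → ℝ) => g (w.1 • w.2))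
      (hg.comp (measurable_fst.smul measurable_snd))
  have hm2 : Measurable fun t : ℝ =>
      ENNReal.ofReal (t ^ (d - 1)) * ∫⁻ s, g (t • s) ∂(unifL1Sphere d) :=
    Measurable.mul (by fun_prop) hm
  rw [hτ g hg, ← lintegral_const_mul _ hm2]
  refine lintegral_congr fun t => ?_
  rw [he, lintegral_smul_measure, smul_eq_mul]
  calc _ = ENNReal.ofReal (t ^ (d - 1)) * (1 * ∫⁻ s, g (t • s) ∂τ) := by rw [one_mul]
    _ = _ := by rw [← ENNReal.mul_inv_cancel h0 (polarConst_ne_top hd)]; ring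

/-- The radial part of Lebesgue measure in polar coordinates. -/
noncomputable def radialMeasure (d : ℕ) : Measure ℝ :=
  (volume.restrict (Ioi (0 : ℝ))).withDensity
    (fun t => polarConst d * ENNReal.ofReal (t ^ (d - 1)))

/-- Lebesgue measure is the image of the product of its radial part and the uniform measure of the
`ℓ_1`-sphere. -/
theorem map_smul_radialMeasure_prod (hd : 0 < d) :
    ((radialMeasure d).prod (unifL1Sphere d)).map (fun w => w.1 • w.2) = volume := by
  have := isProbabilityMeasure_unifL1Sphere hd
  have hm : Measurable (fun w : ℝ × (Fin d → ℝ) => w.1 • w.2) :=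
    measurable_fst.smul measurable_snd
  refine Measure.ext_of_lintegral _ fun g hg => ?_
  have hgm : Measurable fun w : ℝ × (Fin d → ℝ) => g (w.1 • w.2) := hg.comp hm
  have hgs : Measurable fun t : ℝ => ∫⁻ s, g (t • s) ∂(unifL1Sphere d) :=
    hgm.lintegral_prod_right'
  have hm2 : Measurable fun t : ℝ =>
      ENNReal.ofReal (t ^ (d - 1)) * ∫⁻ s, g (t • s) ∂(unifL1Sphere d) :=
    Measurable.mul (by fun_prop) hgs
  rw [lintegral_map hg hm, lintegral_prod _ hgm.aemeasurable, lintegral_polar hd hg,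
    radialMeasure, lintegral_withDensity_eq_lintegral_mul _ (by fun_prop) hgs,
    ← lintegral_const_mul _ hm2]
  refine lintegral_congr fun t => ?_
  simp only [Pi.mul_apply, mul_assoc]

theorem map_neg_unifL1Sphere (hd : 0 < d) :
    (unifL1Sphere d).map (fun s => -s) = unifL1Sphere d := by
  obtain ⟨τ, hfin, hs, huniv, h0, he, hτ⟩ := coneMeasure_spec hd
  have hb : (cond volume (ellBall d 1 1)).map (fun x : Fin d → ℝ => -x)
      = cond volume (ellBall d 1 1) := by
    ext A hA
    rw [Measure.map_apply measurable_neg hA, cond_apply (measurableSet_ellBall 1),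
      cond_apply (measurableSet_ellBall 1)]
    congr 1
    rw [← Measure.measure_neg volume (ellBall d 1 1 ∩ A)]
    congr 1
    ext x
    simp [ellBall, ellNorm_neg]
  rw [unifL1Sphere, Measure.map_map measurable_neg measurable_normalize]
  conv_rhs => rw [← hb, Measure.map_map measurable_normalize measurable_neg]
  congr 1
  ext x i
  simp [ellNorm_neg]

end Polar

/-! ### Tensorization of the variance -/

section EfronStein

/-- The decomposition of the second moment about `c` into variance and squared bias. -/
theorem lintegral_sq_sub_eq {α : Type*} [MeasurableSpace α] {μ : Measure α}
    [IsProbabilityMeasure μ] {f : α → ℝ} (hf : Measurable f) {M : ℝ} (hM : ∀ a, |f a| ≤ M) (c : ℝ) :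
    ∫⁻ a, ENNReal.ofReal ((f a - c) ^ 2) ∂μ =
      ∫⁻ a, ENNReal.ofReal ((f a - ∫ b, f b ∂μ) ^ 2) ∂μ +
        ENNReal.ofReal ((∫ b, f b ∂μ - c) ^ 2) := by
  have hi : Integrable f μ := .of_bound hf.aestronglyMeasurable M (.of_forall hM)
  have hi2 : ∀ e, Integrable (fun a => (f a - e) ^ 2) μ := fun e =>
    .of_bound ((hf.sub_const e).pow_const 2).aestronglyMeasurable ((M + |e|) ^ 2)
      (.of_forall fun a => by
        rw [Real.norm_eq_abs, abs_pow]
        gcongr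
        exact (abs_sub _ _).trans (by linarith [hM a]))
  set m := ∫ b, f b ∂μ
  have key : ∫ a, (f a - c) ^ 2 ∂μ = ∫ a, (f a - m) ^ 2 ∂μ + (m - c) ^ 2 := by
    have e : ∀ a, (f a - c) ^ 2 = (f a - m) ^ 2 + (2 * (m - c) * (f a - m) + (m - c) ^ 2) :=
      fun a => by ring
    have hi3 : Integrable (fun a => 2 * (m - c) * (f a - m)) μ :=
      (hi.sub (integrable_const m)).const_mul _
    have hi4 : Integrable (fun a => 2 * (m - c) * (f a - m) + (m - c) ^ 2) μ :=
      hi3.add (integrable_const _)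
    simp only [e]
    rw [integral_add (hi2 m) hi4, integral_add hi3 (integrable_const _),
      integral_const_mul, integral_sub hi (integrable_const m)]
    simp [m]
  rw [← ofReal_integral_eq_lintegral_ofReal (hi2 c) (.of_forall fun _ => sq_nonneg _),
    ← ofReal_integral_eq_lintegral_ofReal (hi2 m) (.of_forall fun _ => sq_nonneg _), key,
    ENNReal.ofReal_add (integral_nonneg fun _ => sq_nonneg _) (sq_nonneg _)]

theorem measurable_integral_right {α β : Type*} [MeasurableSpace α] [MeasurableSpace β]
    {ν : Measure β} [IsProbabilityMeasure ν] {F : α × β → ℝ} (hF : Measurable F) :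
    Measurable fun a => ∫ y, F (a, y) ∂ν :=
  (hF.stronglyMeasurable.integral_prod_right' (ν := ν)).measurable

theorem measurable_integral_left {α β : Type*} [MeasurableSpace α] [MeasurableSpace β]
    {μ : Measure α} [IsProbabilityMeasure μ] {F : α × β → ℝ} (hF : Measurable F) :
    Measurable fun y => ∫ a, F (a, y) ∂μ :=
  (hF.stronglyMeasurable.integral_prod_left' (μ := μ)).measurable

theorem abs_integral_le_of_bound {α : Type*} [MeasurableSpace α] {μ : Measure α}
    [IsProbabilityMeasure μ] {f : α → ℝ} {M : ℝ} (hM : ∀ a, |f a| ≤ M) : |∫ a, f a ∂μ| ≤ M := by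
  simpa using norm_integral_le_of_norm_le_const (μ := μ) (f := f) (C := M) (.of_forall hM)

/-- Subadditivity of the variance over a product of two probability spaces. -/
theorem variance_prod_le {α β : Type*} [MeasurableSpace α] [MeasurableSpace β]
    {μ : Measure α} [IsProbabilityMeasure μ] {ν : Measure β} [IsProbabilityMeasure ν]
    {F : α × β → ℝ} (hF : Measurable F) {M : ℝ} (hM : ∀ a, |F a| ≤ M) :
    ∫⁻ w, ENNReal.ofReal ((F w - ∫ z, F z ∂(μ.prod ν)) ^ 2) ∂(μ.prod ν) ≤
      ∫⁻ a, ∫⁻ y, ENNReal.ofReal ((F (a, y) - ∫ z, F (a, z) ∂ν) ^ 2) ∂ν ∂μ +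
      ∫⁻ y, ∫⁻ a, ENNReal.ofReal ((F (a, y) - ∫ b, F (b, y) ∂μ) ^ 2) ∂μ ∂ν := by
  have hFi : Integrable F (μ.prod ν) := .of_bound hF.aestronglyMeasurable M (.of_forall hM)
  have hA := measurable_integral_right (ν := ν) hF
  have hB := measurable_integral_left (μ := μ) hF
  set m := ∫ z, F z ∂(μ.prod ν)
  have hm : m = ∫ y, ∫ a, F (a, y) ∂μ ∂ν := integral_prod_symm F hFi
  have hsec : ∀ a, Measurable fun y => F (a, y) := fun a => hF.comp (measurable_const.prodMk measurable_id)
  have hFB : Measurable fun w : α × β => ENNReal.ofReal ((F w - ∫ b, F (b, w.2) ∂μ) ^ 2) :=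
    ((hF.sub (hB.comp measurable_snd)).pow_const 2).ennreal_ofReal
  have hFA : Measurable fun w : α × β => ENNReal.ofReal ((F w - ∫ z, F (w.1, z) ∂ν) ^ 2) :=
    ((hF.sub (hA.comp measurable_fst)).pow_const 2).ennreal_ofReal
  calc ∫⁻ w, ENNReal.ofReal ((F w - m) ^ 2) ∂(μ.prod ν)
      = ∫⁻ a, ∫⁻ y, ENNReal.ofReal ((F (a, y) - m) ^ 2) ∂ν ∂μ :=
        lintegral_prod _ ((hF.sub_const m).pow_const 2).ennreal_ofReal.aemeasurable
    _ ≤ ∫⁻ a, (∫⁻ y, ENNReal.ofReal ((F (a, y) - ∫ z, F (a, z) ∂ν) ^ 2) ∂ν +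
          ∫⁻ y, ENNReal.ofReal ((F (a, y) - ∫ b, F (b, y) ∂μ) ^ 2) ∂ν) ∂μ := by
        refine lintegral_mono fun a => ?_
        dsimp only
        rw [lintegral_sq_sub_eq (hsec a) (fun y => hM (a, y)) m]
        gcongr
        -- Jensen's inequality for the deviation from the mean over the first variable
        have hb : ∀ y, |F (a, y) - ∫ b, F (b, y) ∂μ| ≤ M + M := fun y =>
          (abs_sub _ _).trans (add_le_add (hM _) (abs_integral_le_of_bound fun b => hM (b, y)))
        have h0 := lintegral_sq_sub_eq (μ := ν) (f := fun y => F (a, y) - ∫ b, F (b, y) ∂μ)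
          ((hsec a).sub hB) hb 0
        simp only [sub_zero] at h0
        rw [h0, integral_sub, ← hm]
        · exact le_add_self
        · exact .of_bound (hsec a).aestronglyMeasurable M (.of_forall fun y => hM _)
        · exact .of_bound hB.aestronglyMeasurable M
            (.of_forall fun y => abs_integral_le_of_bound fun b => hM (b, y))
    _ = _ := by
        rw [lintegral_add_left (hFA.lintegral_prod_right')]
        congr 1
        exact lintegral_lintegral_swap hFB.aemeasurable

/-- The Efron–Stein inequality: the variance of a bounded function of independent variables is at
most the sum of the expected variances in the single variables. -/
theorem efron_stein {μ : Measure ℝ} [IsProbabilityMeasure μ] {n : ℕ} {F : (Fin n → ℝ) → ℝ}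
    (hF : Measurable F) {M : ℝ} (hM : ∀ x, |F x| ≤ M) :
    ∫⁻ x, ENNReal.ofReal ((F x - ∫ z, F z ∂(Measure.pi fun _ => μ)) ^ 2) ∂(Measure.pi fun _ => μ) ≤
      ∑ i, ∫⁻ x, ∫⁻ a, ENNReal.ofReal ((F (Function.update x i a) -
        ∫ b, F (Function.update x i b) ∂μ) ^ 2) ∂μ ∂(Measure.pi fun _ => μ) := by
  induction n with
  | zero =>
    have h : ∀ x : Fin 0 → ℝ, F x = ∫ z, F z ∂(Measure.pi fun _ => μ) := by
      intro x
      have : ∀ z, F z = F x := fun z => by rw [Subsingleton.elim z x]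
      simp [this]
    have h' : ∀ x : Fin 0 → ℝ, ENNReal.ofReal ((F x - ∫ z, F z ∂(Measure.pi fun _ => μ)) ^ 2) = 0 :=
      fun x => by rw [← h x]; simp
    simp only [h', lintegral_zero]; exact zero_le
  | succ n ih =>
    have mp := (measurePreserving_piFinSuccAbove (fun _ : Fin (n + 1) => μ) 0).symm
    have hcons : ∀ w : ℝ × (Fin n → ℝ),
        (MeasurableEquiv.piFinSuccAbove (fun _ : Fin (n + 1) => ℝ) 0).symm w
          = (Fin.cons w.1 w.2 : Fin (n + 1) → ℝ) := by
      intro w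
      simp [MeasurableEquiv.piFinSuccAbove_symm_apply, Fin.insertNthEquiv]
    have hlint : ∀ g : (Fin (n + 1) → ℝ) → ℝ≥0∞,
        ∫⁻ x, g x ∂(Measure.pi fun _ => μ) =
          ∫⁻ w, g (Fin.cons w.1 w.2) ∂(μ.prod (Measure.pi fun _ => μ)) := by
      intro g
      rw [← mp.lintegral_comp_emb (MeasurableEquiv.measurableEmbedding _)]
      simp only [hcons]
    have hint : ∫ z, F z ∂(Measure.pi fun _ => μ) =
        ∫ w, F (Fin.cons w.1 w.2) ∂(μ.prod (Measure.pi fun _ : Fin n => μ)) := by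
      rw [← mp.integral_comp (MeasurableEquiv.measurableEmbedding _)]
      simp only [hcons]
    have hmc : Measurable fun w : ℝ × (Fin n → ℝ) => (Fin.cons w.1 w.2 : Fin (n + 1) → ℝ) := by
      have := (MeasurableEquiv.piFinSuccAbove (fun _ : Fin (n + 1) => ℝ) 0).symm.measurable
      exact (funext hcons) ▸ this
    have hF' : Measurable fun w : ℝ × (Fin n → ℝ) => F (Fin.cons w.1 w.2) := hF.comp hmc
    have hsec : ∀ a, Measurable fun y : Fin n → ℝ => F (Fin.cons a y) := fun a =>
      hF'.comp (measurable_const.prodMk measurable_id)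
    rw [hlint, hint]
    refine (variance_prod_le (μ := μ) (ν := Measure.pi fun _ : Fin n => μ) hF' (fun w => hM _)).trans ?_
    rw [Fin.sum_univ_succ, add_comm]
    have hupd : ∀ j : Fin n, Measurable fun w : (ℝ × (Fin n → ℝ)) × ℝ =>
        F (Function.update (Fin.cons w.1.1 w.1.2 : Fin (n + 1) → ℝ) j.succ w.2) := fun j =>
      hF.comp (measurable_update'.comp ((hmc.comp measurable_fst).prodMk measurable_snd))
    have hmeas : ∀ j : Fin n, Measurable fun w : ℝ × (Fin n → ℝ) => ∫⁻ a, ENNReal.ofReal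
        ((F (Function.update (Fin.cons w.1 w.2 : Fin (n + 1) → ℝ) j.succ a) -
        ∫ b, F (Function.update (Fin.cons w.1 w.2 : Fin (n + 1) → ℝ) j.succ b) ∂μ) ^ 2) ∂μ := by
      intro j
      have h1 := measurable_integral_right (ν := μ) (hupd j)
      exact (((hupd j).sub (h1.comp measurable_fst)).pow_const 2).ennreal_ofReal.lintegral_prod_right'
    have hmeas0 : Measurable fun w : ℝ × (Fin n → ℝ) => ∫⁻ a, ENNReal.ofReal
        ((F (Function.update (Fin.cons w.1 w.2 : Fin (n + 1) → ℝ) 0 a) -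
        ∫ b, F (Function.update (Fin.cons w.1 w.2 : Fin (n + 1) → ℝ) 0 b) ∂μ) ^ 2) ∂μ := by
      have hu : Measurable fun w : (ℝ × (Fin n → ℝ)) × ℝ =>
        F (Function.update (Fin.cons w.1.1 w.1.2 : Fin (n + 1) → ℝ) 0 w.2) :=
        hF.comp (measurable_update'.comp ((hmc.comp measurable_fst).prodMk measurable_snd))
      have h1 := measurable_integral_right (ν := μ) hu
      exact ((hu.sub (h1.comp measurable_fst)).pow_const 2).ennreal_ofReal.lintegral_prod_right'
    refine add_le_add ?_ ?_
    · rw [hlint, lintegral_prod _ hmeas0.aemeasurable]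
      simp [Fin.update_cons_zero]
    · have h3 : ∀ j : Fin n, ∫⁻ x, ∫⁻ a, ENNReal.ofReal ((F (Function.update x j.succ a) -
            ∫ b, F (Function.update x j.succ b) ∂μ) ^ 2) ∂μ ∂(Measure.pi fun _ => μ)
          = ∫⁻ c, ∫⁻ y, ∫⁻ a, ENNReal.ofReal ((F (Fin.cons c (Function.update y j a)) -
            ∫ b, F (Fin.cons c (Function.update y j b)) ∂μ) ^ 2) ∂μ ∂(Measure.pi fun _ => μ) ∂μ := by
        intro j
        rw [hlint, lintegral_prod _ (hmeas j).aemeasurable]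
        simp [Fin.cons_update]
      simp only [h3]
      rw [← lintegral_finsetSum]
      · exact lintegral_mono fun c => ih (hsec c) (fun y => hM _)
      · intro j _
        have := (hmeas j).lintegral_prod_right' (ν := Measure.pi fun _ : Fin n => μ)
        simpa only [← Fin.cons_update] using this

/-- Resampling one coordinate preserves a product measure. -/
theorem lintegral_update_pi {μ : Measure ℝ} [IsProbabilityMeasure μ] {n : ℕ}
    {g : (Fin n → ℝ) → ℝ≥0∞} (hg : Measurable g) (i : Fin n) :
    ∫⁻ x, ∫⁻ a, g (Function.update x i a) ∂μ ∂(Measure.pi fun _ => μ) =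
      ∫⁻ x, g x ∂(Measure.pi fun _ => μ) := by
  obtain ⟨n, rfl⟩ : ∃ k, n = k + 1 := ⟨n - 1, by have := i.pos; omega⟩
  have mp := (measurePreserving_piFinSuccAbove (fun _ : Fin (n + 1) => μ) i).symm
  have hcons : ∀ w : ℝ × (Fin n → ℝ),
      (MeasurableEquiv.piFinSuccAbove (fun _ : Fin (n + 1) => ℝ) i).symm w
        = (i.insertNth w.1 w.2 : Fin (n + 1) → ℝ) := by
    intro w
    simp [MeasurableEquiv.piFinSuccAbove_symm_apply, Fin.insertNthEquiv]
  have hlint : ∀ g : (Fin (n + 1) → ℝ) → ℝ≥0∞,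
      ∫⁻ x, g x ∂(Measure.pi fun _ => μ) =
        ∫⁻ w, g (i.insertNth w.1 w.2) ∂(μ.prod (Measure.pi fun _ => μ)) := by
    intro g
    rw [← mp.lintegral_comp_emb (MeasurableEquiv.measurableEmbedding _)]
    simp only [hcons]
  have hmc : Measurable fun w : ℝ × (Fin n → ℝ) => (i.insertNth w.1 w.2 : Fin (n + 1) → ℝ) := by
    have := (MeasurableEquiv.piFinSuccAbove (fun _ : Fin (n + 1) => ℝ) i).symm.measurable
    exact (funext hcons) ▸ this
  have hu : Measurable fun w : (ℝ × (Fin n → ℝ)) × ℝ =>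
      g (Function.update (i.insertNth w.1.1 w.1.2 : Fin (n + 1) → ℝ) i w.2) :=
    hg.comp (measurable_update'.comp ((hmc.comp measurable_fst).prodMk measurable_snd))
  have hg2 : Measurable fun w : ℝ × (Fin n → ℝ) => g (i.insertNth w.1 w.2) := hg.comp hmc
  rw [hlint, hlint, lintegral_prod _ hu.lintegral_prod_right'.aemeasurable,
    lintegral_prod_symm _ hg2.aemeasurable]
  simp

end EfronStein

/-! ### The Laplace distribution -/

section Laplace

open Set

/-- The Laplace (two-sided exponential) distribution. -/
noncomputable def laplaceMeasure : Measure ℝ :=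
  volume.withDensity fun x => ENNReal.ofReal (Real.exp (-|x|) / 2)

theorem measurable_laplaceDensity :
    Measurable fun x : ℝ => ENNReal.ofReal (Real.exp (-|x|) / 2) := by fun_prop

/-- Integration against the Laplace distribution, folded to the positive half-line. -/
theorem lintegral_laplaceMeasure {g : ℝ → ℝ≥0∞} (hg : Measurable g) :
    ∫⁻ x, g x ∂laplaceMeasure =
      ∫⁻ x in Ioi (0 : ℝ), ENNReal.ofReal (Real.exp (-x) / 2) * (g x + g (-x)) := by
  have hmul : Measurable fun x : ℝ => ENNReal.ofReal (Real.exp (-|x|) / 2) * g x :=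
    measurable_laplaceDensity.mul hg
  have h1 : ∫⁻ x, g x ∂laplaceMeasure = ∫⁻ x, ENNReal.ofReal (Real.exp (-|x|) / 2) * g x := by
    rw [laplaceMeasure, lintegral_withDensity_eq_lintegral_mul _ measurable_laplaceDensity hg]
    rfl
  have h2 : ∫⁻ x in Iic (0 : ℝ), ENNReal.ofReal (Real.exp (-|x|) / 2) * g x
      = ∫⁻ x in Ioi (0 : ℝ), ENNReal.ofReal (Real.exp (-|x|) / 2) * g (-x) := by
    have hneg := (Measure.measurePreserving_neg (volume : Measure ℝ)).setLIntegral_comp_preimage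
      (measurableSet_Iic (a := (0 : ℝ))) hmul
    rw [← hneg]
    simp only [abs_neg]
    have : (Neg.neg : ℝ → ℝ) ⁻¹' Iic 0 = Ici 0 := by ext; simp
    rw [this]
    exact (setLIntegral_congr Ioi_ae_eq_Ici).symm
  rw [h1, ← lintegral_add_compl _ (measurableSet_Ioi (a := (0 : ℝ))), compl_Ioi, h2,
    ← lintegral_add_left hmul]
  refine setLIntegral_congr_fun measurableSet_Ioi fun x hx => ?_
  have hx' : (0 : ℝ) < x := hx
  simp only [abs_of_pos hx', mul_add]

theorem lintegral_rpow_mul_exp {a : ℝ} (ha : 0 < a) :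
    ∫⁻ t in Ioi (0 : ℝ), ENNReal.ofReal (Real.exp (-t) * t ^ (a - 1)) =
      ENNReal.ofReal (Real.Gamma a) := by
  rw [Real.Gamma_eq_integral ha, ofReal_integral_eq_lintegral_ofReal (Real.GammaIntegral_convergent ha)]
  filter_upwards [ae_restrict_mem measurableSet_Ioi] with t ht
  have : (0 : ℝ) < t := ht
  positivity

instance : IsProbabilityMeasure laplaceMeasure := by
  refine ⟨?_⟩
  have h := lintegral_laplaceMeasure (g := fun _ => 1) measurable_const
  simp only [lintegral_const, one_mul] at h
  have hG := lintegral_rpow_mul_exp zero_lt_one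
  rw [Real.Gamma_one, ENNReal.ofReal_one] at hG
  refine h.trans (Eq.trans (setLIntegral_congr_fun measurableSet_Ioi fun x hx => ?_) hG)
  have h2 : (1 + 1 : ℝ≥0∞) = ENNReal.ofReal 2 := by norm_num
  rw [h2, ← ENNReal.ofReal_mul (by positivity)]
  simp

theorem lintegral_sq_laplaceMeasure :
    ∫⁻ x, ENNReal.ofReal (x ^ 2) ∂laplaceMeasure = 2 := by
  rw [lintegral_laplaceMeasure (by fun_prop)]
  have h3 : Real.Gamma 3 = 2 := by
    have := Real.Gamma_nat_eq_factorial 2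
    norm_num at this ⊢
  have h : (2 : ℝ≥0∞) = ENNReal.ofReal (Real.Gamma 3) := by rw [h3]; norm_num
  rw [h, ← lintegral_rpow_mul_exp (by norm_num)]
  refine setLIntegral_congr_fun measurableSet_Ioi fun x hx => ?_
  have hx : (0 : ℝ) < x := hx
  rw [neg_sq, ← ENNReal.ofReal_add (sq_nonneg x) (sq_nonneg x), ← ENNReal.ofReal_mul (by positivity)]
  congr 1
  norm_num
  ring

/-- A Hardy inequality on an interval with exponential weight, obtained by integration by parts. -/
theorem integral_sq_mul_exp_le {φ φ' : ℝ → ℝ} {K A : ℝ} (hA : 0 ≤ A) (hφ : Continuous φ)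
    (h0 : φ 0 = 0) (hd : ∀ x, 0 < x → HasDerivAt φ (φ' x) x) (hK : ∀ x, 0 < x → |φ' x| ≤ K)
    (hm : Measurable φ') :
    ∫ x in (0 : ℝ)..A, φ x ^ 2 * Real.exp (-x) ≤ 4 * ∫ x in (0 : ℝ)..A, φ' x ^ 2 * Real.exp (-x) := by
  have hφ'i : IntervalIntegrable φ' volume 0 A := by
    rw [intervalIntegrable_iff_integrableOn_Ioc_of_le hA]
    refine Measure.integrableOn_of_bounded (M := K) (by simp) hm.aestronglyMeasurable ?_
    filter_upwards [ae_restrict_mem measurableSet_Ioc] with x hx using hK x hx.1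
  have hφ'2i : IntervalIntegrable (fun x => φ' x ^ 2) volume 0 A := by
    rw [intervalIntegrable_iff_integrableOn_Ioc_of_le hA]
    refine Measure.integrableOn_of_bounded (M := K ^ 2) (by simp)
      (hm.pow_const 2).aestronglyMeasurable ?_
    filter_upwards [ae_restrict_mem measurableSet_Ioc] with x hx
    rw [Real.norm_eq_abs, abs_pow]
    exact pow_le_pow_left₀ (abs_nonneg _) (hK x hx.1) 2
  have hexp : Continuous fun x : ℝ => Real.exp (-x) := by fun_prop
  have i1 : IntervalIntegrable (fun x => φ x ^ 2 * Real.exp (-x)) volume 0 A :=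
    ((hφ.pow 2).mul hexp).intervalIntegrable _ _
  have i2 : IntervalIntegrable (fun x => φ' x ^ 2 * Real.exp (-x)) volume 0 A :=
    hφ'2i.mul_continuousOn hexp.continuousOn
  have i3 : IntervalIntegrable (fun x => 2 * φ x * φ' x * Real.exp (-x)) volume 0 A :=
    (hφ'i.continuousOn_mul (continuous_const.mul hφ).continuousOn).mul_continuousOn hexp.continuousOn
  have ftc := intervalIntegral.integral_eq_sub_of_hasDeriv_right_of_le hA
    (f := fun x => φ x ^ 2 * Real.exp (-x))
    (f' := fun x => 2 * φ x * φ' x * Real.exp (-x) - φ x ^ 2 * Real.exp (-x))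
    ((hφ.pow 2).mul hexp).continuousOn
    (fun x hx => by
      have e1 := ((hd x hx.1).pow 2).mul ((hasDerivAt_neg x).exp)
      convert! e1.hasDerivWithinAt using 1
      simp; ring)
    (i3.sub i1)
  rw [intervalIntegral.integral_sub i3 i1] at ftc
  have hle : ∫ x in (0 : ℝ)..A, 2 * φ x * φ' x * Real.exp (-x) ≤
      ∫ x in (0 : ℝ)..A, ((1 / 2) * (φ x ^ 2 * Real.exp (-x)) + 2 * (φ' x ^ 2 * Real.exp (-x))) := by
    refine intervalIntegral.integral_mono_on hA i3 ((i1.const_mul _).add (i2.const_mul _)) fun x _ => ?_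
    have : 0 ≤ (φ x - 2 * φ' x) ^ 2 * Real.exp (-x) := by positivity
    nlinarith
  rw [intervalIntegral.integral_add (i1.const_mul _) (i2.const_mul _),
    intervalIntegral.integral_const_mul, intervalIntegral.integral_const_mul] at hle
  have hend : 0 ≤ φ A ^ 2 * Real.exp (-A) := by positivity
  simp only [h0] at ftc
  simp only [ne_eq, OfNat.ofNat_ne_zero, not_false_eq_true, zero_pow, zero_mul, sub_zero] at ftc
  linarith

theorem lintegral_Ioi_sq_mul_exp_le {φ φ' : ℝ → ℝ} {K : ℝ} (hφ : Continuous φ)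
    (h0 : φ 0 = 0) (hd : ∀ x, 0 < x → HasDerivAt φ (φ' x) x) (hK : ∀ x, 0 < x → |φ' x| ≤ K)
    (hm : Measurable φ') :
    ∫⁻ x in Ioi (0 : ℝ), ENNReal.ofReal (Real.exp (-x) / 2) * ENNReal.ofReal (φ x ^ 2) ≤
      4 * ∫⁻ x in Ioi (0 : ℝ), ENNReal.ofReal (Real.exp (-x) / 2) * ENNReal.ofReal (φ' x ^ 2) := by
  have hexp : Continuous fun x : ℝ => Real.exp (-x) := by fun_prop
  have h2 : ∀ ψ : ℝ → ℝ, ∀ x, ENNReal.ofReal (Real.exp (-x) / 2) * ENNReal.ofReal (ψ x ^ 2)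
      = ENNReal.ofReal (1 / 2) * ENNReal.ofReal (ψ x ^ 2 * Real.exp (-x)) := fun ψ x => by
    rw [← ENNReal.ofReal_mul (by positivity), ← ENNReal.ofReal_mul (by positivity)]
    congr 1; ring
  have hmφ : Measurable fun x => ENNReal.ofReal (φ x ^ 2 * Real.exp (-x)) :=
    ((hφ.pow 2).mul hexp).measurable.ennreal_ofReal
  have hmφ' : Measurable fun x => ENNReal.ofReal (φ' x ^ 2 * Real.exp (-x)) :=
    ((hm.pow_const 2).mul hexp.measurable).ennreal_ofReal
  simp only [h2]
  rw [lintegral_const_mul _ hmφ, lintegral_const_mul _ hmφ', ← mul_assoc, mul_comm 4, mul_assoc]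
  gcongr
  have key : ∀ n : ℕ, ∫⁻ x in Ioc (0 : ℝ) n, ENNReal.ofReal (φ x ^ 2 * Real.exp (-x)) ≤
      4 * ∫⁻ x in Ioi (0 : ℝ), ENNReal.ofReal (φ' x ^ 2 * Real.exp (-x)) := by
    intro n
    have hn : (0 : ℝ) ≤ n := n.cast_nonneg
    have i1 : IntegrableOn (fun x => φ x ^ 2 * Real.exp (-x)) (Ioc 0 n) :=
      (((hφ.pow 2).mul hexp).intervalIntegrable (μ := volume) 0 n).1
    have i2 : IntegrableOn (fun x => φ' x ^ 2 * Real.exp (-x)) (Ioc 0 n) := by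
      refine Measure.integrableOn_of_bounded (M := K ^ 2) (by simp)
        ((hm.pow_const 2).mul hexp.measurable).aestronglyMeasurable ?_
      filter_upwards [ae_restrict_mem measurableSet_Ioc] with x hx
      rw [Real.norm_eq_abs, abs_mul, abs_pow, abs_of_pos (Real.exp_pos _)]
      have := pow_le_pow_left₀ (abs_nonneg _) (hK x hx.1) 2
      have h1 : Real.exp (-x) ≤ 1 := Real.exp_le_one_iff.2 (by linarith [hx.1])
      calc |φ' x| ^ 2 * Real.exp (-x) ≤ K ^ 2 * 1 := by gcongr
        _ = K ^ 2 := mul_one _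
    have := integral_sq_mul_exp_le hn hφ h0 hd hK hm
    rw [intervalIntegral.integral_of_le hn, intervalIntegral.integral_of_le hn] at this
    rw [← ofReal_integral_eq_lintegral_ofReal i1 (.of_forall fun x => by positivity)]
    refine (ENNReal.ofReal_le_ofReal this).trans ?_
    rw [ENNReal.ofReal_mul (by norm_num),
      ofReal_integral_eq_lintegral_ofReal i2 (.of_forall fun x => by positivity)]
    have h4 : ENNReal.ofReal 4 = 4 := by norm_num
    rw [h4]
    gcongr
    exact Ioc_subset_Ioi_self
  have hcover : AECover (volume.restrict (Ioi (0 : ℝ))) Filter.atTop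
      (fun n : ℕ => Ioc (0 : ℝ) n) :=
    { ae_eventually_mem := by
        filter_upwards [ae_restrict_mem measurableSet_Ioi] with x hx
        filter_upwards [Filter.eventually_ge_atTop ⌈x⌉₊] with n hn
        exact ⟨hx, Nat.ceil_le.1 hn⟩
      measurableSet := fun n => measurableSet_Ioc }
  refine le_of_tendsto' (hcover.lintegral_tendsto_of_countably_generated hmφ.aemeasurable) fun n => ?_
  rw [Measure.restrict_restrict measurableSet_Ioc, inter_eq_left.2 Ioc_subset_Ioi_self]
  exact key n

/-- The Poincaré inequality for the Laplace distribution. -/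
theorem lintegral_sq_sub_laplace_le {φ φ' : ℝ → ℝ} {K : ℝ} (hφ : Continuous φ)
    (hd : ∀ x, x ≠ 0 → HasDerivAt φ (φ' x) x) (hK : ∀ x, x ≠ 0 → |φ' x| ≤ K)
    (hm : Measurable φ') :
    ∫⁻ x, ENNReal.ofReal ((φ x - φ 0) ^ 2) ∂laplaceMeasure ≤
      4 * ∫⁻ x, ENNReal.ofReal (φ' x ^ 2) ∂laplaceMeasure := by
  have hexp : Measurable fun x : ℝ => ENNReal.ofReal (Real.exp (-x) / 2) := by fun_prop
  have hm1 : Measurable fun x => ENNReal.ofReal ((φ x - φ 0) ^ 2) :=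
    ((hφ.measurable.sub_const _).pow_const 2).ennreal_ofReal
  have hm2 : Measurable fun x => ENNReal.ofReal (φ' x ^ 2) := (hm.pow_const 2).ennreal_ofReal
  rw [lintegral_laplaceMeasure hm1, lintegral_laplaceMeasure hm2]
  simp only [mul_add]
  have hm3 : Measurable fun x =>
      ENNReal.ofReal (Real.exp (-x) / 2) * ENNReal.ofReal ((φ x - φ 0) ^ 2) := hexp.mul hm1
  have hm4 : Measurable fun x =>
      ENNReal.ofReal (Real.exp (-x) / 2) * ENNReal.ofReal (φ' x ^ 2) := hexp.mul hm2
  rw [lintegral_add_left hm3, lintegral_add_left hm4, mul_add]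
  refine add_le_add ?_ ?_
  · exact lintegral_Ioi_sq_mul_exp_le (φ := fun x => φ x - φ 0) (hφ.sub continuous_const) (by simp)
      (fun x hx => (hd x hx.ne').sub_const _) (fun x hx => hK x hx.ne') hm
  · have := lintegral_Ioi_sq_mul_exp_le (φ := fun x => φ (-x) - φ 0) (φ' := fun x => - φ' (-x)) (K := K)
      ((hφ.comp continuous_neg).sub continuous_const) (by simp)
      (fun x hx => by
        have h := (hd (-x) (by linarith)).comp x (hasDerivAt_neg x)
        simpa using h.sub_const (φ 0))
      (fun x hx => by rw [abs_neg]; exact hK _ (by linarith)) (hm.comp measurable_neg).neg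
    simpa using this

/-- The density of the product of Laplace distributions. -/
theorem pi_laplaceMeasure (d : ℕ) : Measure.pi (fun _ : Fin d => laplaceMeasure) =
    (volume : Measure (Fin d → ℝ)).withDensity
      fun x => ENNReal.ofReal (Real.exp (-ellNorm 1 x) / 2 ^ d) := by
  have hprod : ∀ x : Fin d → ℝ, Real.exp (-ellNorm 1 x) / 2 ^ d = ∏ i, Real.exp (-|x i|) / 2 := by
    intro x
    rw [Finset.prod_div_distrib, ← Real.exp_sum, ellNorm_one]
    simp
  have hint : Integrable fun x : ℝ => Real.exp (-|x|) / 2 := by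
    have h1 : Measurable fun x : ℝ => Real.exp (-|x|) / 2 := by fun_prop
    refine ⟨h1.aestronglyMeasurable, ?_⟩
    rw [hasFiniteIntegral_iff_ofReal (.of_forall fun x => by positivity)]
    have : laplaceMeasure univ < ∞ := measure_lt_top _ _
    rwa [laplaceMeasure, withDensity_apply _ MeasurableSet.univ, Measure.restrict_univ] at this
  refine Measure.pi_eq (μ := fun _ : Fin d => laplaceMeasure) fun s hs => ?_
  rw [withDensity_apply _ (MeasurableSet.univ_pi hs), ← lintegral_indicator (MeasurableSet.univ_pi hs)]
  have hi : ∀ i, Integrable ((s i).indicator fun x : ℝ => Real.exp (-|x|) / 2) := fun i =>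
    hint.indicator (hs i)
  have hnn : ∀ i x, 0 ≤ (s i).indicator (fun x : ℝ => Real.exp (-|x|) / 2) x := fun i x =>
    indicator_nonneg (fun x _ => by positivity) x
  have h1 : ∀ x : Fin d → ℝ, (univ.pi s).indicator
      (fun x => ENNReal.ofReal (Real.exp (-ellNorm 1 x) / 2 ^ d)) x
      = ENNReal.ofReal (∏ i, (s i).indicator (fun x : ℝ => Real.exp (-|x|) / 2) (x i)) := by
    intro x
    by_cases hx : x ∈ univ.pi s
    · rw [indicator_of_mem hx, hprod]
      congr 1
      exact Finset.prod_congr rfl fun i _ => (indicator_of_mem (hx i (mem_univ i))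
        fun x : ℝ => Real.exp (-|x|) / 2).symm
    · rw [indicator_of_notMem hx]
      simp only [mem_pi, mem_univ, true_imp_iff, not_forall] at hx
      obtain ⟨i, hi⟩ := hx
      rw [Finset.prod_eq_zero (Finset.mem_univ i) (indicator_of_notMem hi _), ENNReal.ofReal_zero]
  simp only [h1]
  rw [← ofReal_integral_eq_lintegral_ofReal, volume_pi, integral_fintype_prod_eq_prod,
    ENNReal.ofReal_prod_of_nonneg (fun i _ => integral_nonneg (hnn i))]
  · refine Finset.prod_congr rfl fun i _ => ?_
    rw [ofReal_integral_eq_lintegral_ofReal (hi i) (.of_forall (hnn i)), laplaceMeasure,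
      withDensity_apply _ (hs i), ← lintegral_indicator (hs i)]
    refine lintegral_congr fun x => ?_
    by_cases hx : x ∈ s i <;> simp [hx]
  · exact Integrable.fintype_prod hi
  · exact .of_forall fun x => Finset.prod_nonneg fun i _ => hnn i _

/-- Under a product of Laplace distributions the direction of a vector is uniform on the
`ℓ_1`-sphere and independent of the `ℓ_1`-norm, which has a Gamma distribution. -/
theorem lintegral_normalize_mul_rpow_laplace {d : ℕ} (hd : 0 < d) {H : (Fin d → ℝ) → ℝ≥0∞}
    (hH : Measurable H) {m : ℝ} (hm : 0 < d + m) :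
    ∫⁻ x, H ((ellNorm 1 x)⁻¹ • x) * ENNReal.ofReal (ellNorm 1 x ^ m)
        ∂(Measure.pi fun _ : Fin d => laplaceMeasure) =
      (∫⁻ s, H s ∂(unifL1Sphere d)) * ENNReal.ofReal (Real.Gamma (d + m) / Real.Gamma d) := by
  have hprob := isProbabilityMeasure_unifL1Sphere hd
  have hd' : (0 : ℝ) < d := by exact_mod_cast hd
  have hdens : Measurable fun x : Fin d → ℝ => ENNReal.ofReal (Real.exp (-ellNorm 1 x) / 2 ^ d) :=
    ((Real.measurable_exp.comp measurable_ellNorm.neg).div_const _).ennreal_ofReal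
  have key : ∀ {H : (Fin d → ℝ) → ℝ≥0∞}, Measurable H → ∀ {m : ℝ}, 0 < d + m →
      ∫⁻ x, H ((ellNorm 1 x)⁻¹ • x) * ENNReal.ofReal (ellNorm 1 x ^ m)
        ∂(Measure.pi fun _ : Fin d => laplaceMeasure) =
      (∫⁻ s, H s ∂(unifL1Sphere d)) * (ENNReal.ofReal (Real.Gamma (d + m)) *
        (polarConst d * ENNReal.ofReal (1 / 2 ^ d))) := by
    intro H hH m hm
    have hg : Measurable fun x : Fin d → ℝ =>
        H ((ellNorm 1 x)⁻¹ • x) * ENNReal.ofReal (ellNorm 1 x ^ m) :=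
      (hH.comp measurable_normalize).mul (measurable_ellNorm.pow_const m).ennreal_ofReal
    rw [pi_laplaceMeasure, lintegral_withDensity_eq_lintegral_mul _ hdens hg,
      lintegral_polar hd (hdens.mul hg)]
    have h1 : ∀ t ∈ Ioi (0 : ℝ), ENNReal.ofReal (t ^ (d - 1)) *
        ∫⁻ s, ((fun x : Fin d → ℝ => ENNReal.ofReal (Real.exp (-ellNorm 1 x) / 2 ^ d)) *
          fun x => H ((ellNorm 1 x)⁻¹ • x) * ENNReal.ofReal (ellNorm 1 x ^ m)) (t • s)
          ∂(unifL1Sphere d)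
        = ENNReal.ofReal (Real.exp (-t) * t ^ (d + m - 1)) *
          (ENNReal.ofReal (1 / 2 ^ d) * ∫⁻ s, H s ∂(unifL1Sphere d)) := by
      intro t ht
      have ht : 0 < t := ht
      rw [← mul_assoc, ← ENNReal.ofReal_mul (by positivity), ← lintegral_const_mul _ hH,
        ← lintegral_const_mul' _ _ ENNReal.ofReal_ne_top]
      refine lintegral_congr_ae ?_
      filter_upwards [ae_ellNorm_unifL1Sphere hd] with s hs
      have e1 : ellNorm 1 (t • s) = t := by rw [ellNorm_smul, hs, abs_of_pos ht, mul_one]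
      simp only [Pi.mul_apply, e1, inv_smul_smul₀ ht.ne']
      rw [mul_comm (H s), ← mul_assoc, ← mul_assoc, ← ENNReal.ofReal_mul (by positivity),
        ← ENNReal.ofReal_mul (by positivity)]
      congr 2
      have e2 : t ^ (d + m - 1) = t ^ (d - 1) * t ^ m := by
        rw [← Real.rpow_natCast, ← Real.rpow_add ht, Nat.cast_sub hd]
        congr 1; push_cast; ring
      rw [e2]; ring
    rw [setLIntegral_congr_fun measurableSet_Ioi h1, lintegral_mul_const _ (by fun_prop),
      lintegral_rpow_mul_exp hm]
    ring
  have hΓ := Real.Gamma_pos_of_pos hd'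
  have h1 := key (H := fun _ => 1) measurable_const (m := 0) (by simpa using hd')
  simp only [Real.rpow_zero, ENNReal.ofReal_one, mul_one, lintegral_const, measure_univ, one_mul,
    add_zero] at h1
  rw [key hH hm]
  congr 1
  rw [ENNReal.ofReal_div_of_pos hΓ, div_eq_mul_inv]
  congr 1
  exact ENNReal.eq_inv_of_mul_eq_one_left (by rw [mul_comm]; exact h1.symm)

end Laplace

/-! ### A Poincaré inequality on the `ℓ_1`-sphere -/

section SpherePoincare

variable {d : ℕ}

theorem abs_fderiv_le_of_lipschitz {h : (Fin d → ℝ) → ℝ} (hh : Differentiable ℝ h) {L : ℝ}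
    (hL : 0 ≤ L) (hlip : ∀ x y, |h x - h y| ≤ L * ellNorm 2 (x - y)) (x v : Fin d → ℝ) :
    |fderiv ℝ h x v| ≤ L * ellNorm 2 v := by
  have h1 : HasDerivAt (fun t : ℝ => h (x + t • v)) (fderiv ℝ h x v) 0 :=
    (hh x).hasFDerivAt.hasLineDerivAt v
  refine h1.le_of_lip' (mul_nonneg hL (ellNorm_nonneg v)) (.of_forall fun t => ?_)
  have := hlip (x + t • v) (x + (0 : ℝ) • v)
  rw [add_sub_add_left_eq_sub, ← sub_smul, ellNorm_smul] at this
  rw [Real.norm_eq_abs, Real.norm_eq_abs]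
  linarith

/-- The gradient of a function that is `L`-Lipschitz for the `ℓ_2`-norm has `ℓ_2`-norm at most `L`. -/
theorem sum_fderiv_sq_le_of_lipschitz {h : (Fin d → ℝ) → ℝ} (hh : Differentiable ℝ h) {L : ℝ}
    (hL : 0 ≤ L) (hlip : ∀ x y, |h x - h y| ≤ L * ellNorm 2 (x - y)) (x : Fin d → ℝ) :
    ∑ i, fderiv ℝ h x (Pi.single i 1) ^ 2 ≤ L ^ 2 := by
  set a : Fin d → ℝ := fun i => fderiv ℝ h x (Pi.single i 1)
  have h1 : fderiv ℝ h x a = ∑ i, a i ^ 2 := by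
    conv_lhs => rw [pi_eq_sum_univ' a]
    rw [map_sum]
    refine Finset.sum_congr rfl fun i _ => ?_
    rw [map_smul, smul_eq_mul, sq]
  have h2 := (le_abs_self _).trans (abs_fderiv_le_of_lipschitz hh hL hlip x a)
  rw [h1, ← ellNorm_two_sq] at h2
  have h0 := ellNorm_nonneg (p := 2) a
  have h3 : ellNorm 2 a ≤ L := by
    by_contra! hc
    nlinarith
  rw [← ellNorm_two_sq]
  gcongr

theorem map_normalize_laplace (hd : 0 < d) :
    (Measure.pi fun _ : Fin d => laplaceMeasure).map (fun x => (ellNorm 1 x)⁻¹ • x) =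
      unifL1Sphere d := by
  refine Measure.ext_of_lintegral _ fun g hg => ?_
  have hd' : (0 : ℝ) < d := by exact_mod_cast hd
  rw [lintegral_map hg measurable_normalize]
  have := lintegral_normalize_mul_rpow_laplace hd hg (m := 0) (by simpa using hd')
  simpa [div_self (Real.Gamma_pos_of_pos hd').ne'] using this

/-- The mean of `‖s‖₂²` over the `ℓ_1`-sphere, from the second moments of Laplace variables. -/
theorem lintegral_ellNorm_two_sq_unifL1Sphere (hd : 0 < d) :
    ∫⁻ s, ENNReal.ofReal (ellNorm 2 s ^ 2) ∂(unifL1Sphere d) = ENNReal.ofReal (2 / (d + 1)) := by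
  have hd' : (0 : ℝ) < d := by exact_mod_cast hd
  have h1 := lintegral_normalize_mul_rpow_laplace hd (m := 2)
    (H := fun s => ENNReal.ofReal (ellNorm 2 s ^ 2)) (measurable_ellNorm.pow_const 2).ennreal_ofReal
    (by positivity)
  have h2 : ∀ x : Fin d → ℝ, ENNReal.ofReal (ellNorm 2 ((ellNorm 1 x)⁻¹ • x) ^ 2) *
      ENNReal.ofReal (ellNorm 1 x ^ (2 : ℝ)) = ∑ i, ENNReal.ofReal (x i ^ 2) := by
    intro x
    rw [← ENNReal.ofReal_sum_of_nonneg (fun i _ => sq_nonneg _), ← ellNorm_two_sq,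
      ← ENNReal.ofReal_mul (sq_nonneg _), ellNorm_smul, Real.rpow_two]
    congr 1
    rcases eq_or_ne x 0 with rfl | hx
    · simp [ellNorm_zero]
    · have := ellNorm_pos (p := 1) hx
      rw [abs_of_pos (inv_pos.2 this)]
      field_simp
  simp only [h2] at h1
  rw [lintegral_finsetSum _ (fun i _ => by fun_prop)] at h1
  have h3 : ∀ i : Fin d, ∫⁻ x, ENNReal.ofReal (x i ^ 2) ∂(Measure.pi fun _ : Fin d => laplaceMeasure)
      = 2 := by
    intro i
    rw [← lintegral_sq_laplaceMeasure]
    exact (measurePreserving_eval (fun _ : Fin d => laplaceMeasure) i).lintegral_comp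
      (f := fun a => ENNReal.ofReal (a ^ 2)) (by fun_prop)
  have hΓ : Real.Gamma (d + 2) / Real.Gamma d = (d + 1) * d := by
    have e : (d : ℝ) + 2 = d + 1 + 1 := by ring
    rw [e, Real.Gamma_add_one (by positivity), Real.Gamma_add_one hd'.ne']
    field_simp [(Real.Gamma_pos_of_pos hd').ne']
  simp only [h3, hΓ, Finset.sum_const, Finset.card_univ, Fintype.card_fin, nsmul_eq_mul] at h1
  have h4 : (d : ℝ≥0∞) * 2 = ENNReal.ofReal (2 / (d + 1)) * ENNReal.ofReal ((d + 1) * d) := by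
    rw [← ENNReal.ofReal_mul (by positivity)]
    have : 2 / ((d : ℝ) + 1) * ((d + 1) * d) = d * 2 := by field_simp
    rw [this, ENNReal.ofReal_mul hd'.le]
    simp
  rw [h4] at h1
  refine ((ENNReal.mul_left_inj ?_ ENNReal.ofReal_ne_top).1 h1).symm
  simpa using ENNReal.ofReal_pos.2 (by positivity)

theorem ellNorm_one_normalize_le (x : Fin d → ℝ) : ellNorm 1 ((ellNorm 1 x)⁻¹ • x) ≤ 1 := by
  rw [ellNorm_smul, abs_of_nonneg (inv_nonneg.2 (ellNorm_nonneg x))]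
  exact inv_mul_le_one

theorem ellNorm_two_le_one (x : Fin d → ℝ) : ellNorm 2 x ≤ ellNorm 1 x :=
  ellNorm_anti (by norm_num) x

theorem ellNorm_one_update (x : Fin d → ℝ) (i : Fin d) (a : ℝ) :
    ellNorm 1 (Function.update x i a) = |a| + ∑ j ∈ Finset.univ.erase i, |x j| := by
  rw [ellNorm_one, ← Finset.add_sum_erase _ _ (Finset.mem_univ i), Function.update_self]
  congr 1
  refine Finset.sum_congr rfl fun j hj => ?_
  rw [Function.update_of_ne (Finset.ne_of_mem_erase hj)]

/-- The partial derivative of `x ↦ h (x / ‖x‖₁)` in the direction of the `i`-th coordinate,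
where `x` has no vanishing coordinate. -/
noncomputable def radialPartial (h : (Fin d → ℝ) → ℝ) (i : Fin d) (x : Fin d → ℝ) : ℝ :=
  (ellNorm 1 x)⁻¹ * (fderiv ℝ h ((ellNorm 1 x)⁻¹ • x) (Pi.single i 1) -
    signVec x i * fderiv ℝ h ((ellNorm 1 x)⁻¹ • x) ((ellNorm 1 x)⁻¹ • x))

theorem measurable_signVec : Measurable (signVec : (Fin d → ℝ) → Fin d → ℝ) := by
  refine measurable_pi_iff.2 fun i => ?_
  exact Measurable.ite (measurableSet_lt (measurable_pi_apply i) measurable_const)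
    measurable_const measurable_const

theorem abs_signVec (x : Fin d → ℝ) (i : Fin d) : |signVec x i| = 1 := by
  unfold signVec; split_ifs <;> simp

theorem measurable_radialPartial (h : (Fin d → ℝ) → ℝ) (i : Fin d) :
    Measurable (radialPartial h i) := by
  have hn := measurable_normalize (d := d)
  have h1 : ∀ v, Measurable fun x : Fin d → ℝ => fderiv ℝ h ((ellNorm 1 x)⁻¹ • x) v := fun v =>
    (measurable_fderiv_apply_const ℝ h v).comp hn
  have h2 : Measurable fun x : Fin d → ℝ =>
      fderiv ℝ h ((ellNorm 1 x)⁻¹ • x) ((ellNorm 1 x)⁻¹ • x) := by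
    have e : ∀ x : Fin d → ℝ, fderiv ℝ h ((ellNorm 1 x)⁻¹ • x) ((ellNorm 1 x)⁻¹ • x)
        = ∑ j, ((ellNorm 1 x)⁻¹ • x) j * fderiv ℝ h ((ellNorm 1 x)⁻¹ • x) (Pi.single j 1) := by
      intro x
      conv_lhs => rw [pi_eq_sum_univ' ((ellNorm 1 x)⁻¹ • x), map_sum]
      refine Finset.sum_congr rfl fun j _ => ?_
      rw [map_smul, smul_eq_mul]
      congr 2
      rw [← pi_eq_sum_univ']
    simp only [e]
    exact Finset.measurable_sum _ fun j _ => ((measurable_pi_apply j).comp hn).mul (h1 _)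
  exact measurable_ellNorm.inv.mul
    ((h1 _).sub (((measurable_pi_apply i).comp measurable_signVec).mul h2))

/-- A second nonzero coordinate keeps the line in direction `i` away from the origin, so that the
composition with `x ↦ x / ‖x‖₁` is differentiable except where the `i`-th coordinate vanishes. -/
theorem hasDerivAt_comp_normalize_update {h : (Fin d → ℝ) → ℝ} (hh : Differentiable ℝ h)
    {x : Fin d → ℝ} {i j : Fin d} (hij : j ≠ i) (hx : x j ≠ 0) {a : ℝ} (ha : a ≠ 0) :
    HasDerivAt (fun b => h ((ellNorm 1 (Function.update x i b))⁻¹ • Function.update x i b))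
      (radialPartial h i (Function.update x i a)) a := by
  have hupd : HasDerivAt (fun b : ℝ => Function.update x i b) (Pi.single i (1 : ℝ)) a :=
    hasDerivAt_update x i a
  have hne : Function.update x i a ≠ 0 := fun h0 => hx (by
    have := congrFun h0 j
    rwa [Function.update_of_ne hij] at this)
  have hpos := ellNorm_pos (p := 1) hne
  have hs : HasDerivAt (fun b : ℝ => |b|) (signVec (Function.update x i a) i) a := by
    unfold signVec
    rw [Function.update_self]
    rcases lt_or_gt_of_ne ha with h | h
    · rw [if_pos h]; exact hasDerivAt_abs_neg h
    · rw [if_neg h.not_gt]; exact hasDerivAt_abs_pos h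
  have hN : HasDerivAt (fun b : ℝ => ellNorm 1 (Function.update x i b))
      (signVec (Function.update x i a) i) a := by
    simp only [ellNorm_one_update]
    exact hs.add_const _
  have hc := (hN.inv hpos.ne').smul hupd
  have h2 := (hh ((ellNorm 1 (Function.update x i a))⁻¹ • Function.update x i a)).hasFDerivAt.comp_hasDerivAt
    a hc
  convert! h2 using 1
  rw [radialPartial, map_add, map_smul, map_smul, map_smul]
  simp only [smul_eq_mul, Pi.inv_apply]
  field_simp
  ring

theorem abs_radialPartial_le {h : (Fin d → ℝ) → ℝ} (hh : Differentiable ℝ h) {L : ℝ}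
    (hL : 0 ≤ L) (hlip : ∀ x y, |h x - h y| ≤ L * ellNorm 2 (x - y)) (i : Fin d) (x : Fin d → ℝ) :
    |radialPartial h i x| ≤ (ellNorm 1 x)⁻¹ * (2 * L) := by
  have hN := ellNorm_nonneg (p := 1) x
  rw [radialPartial, abs_mul, abs_of_nonneg (inv_nonneg.2 hN)]
  gcongr
  refine (abs_sub _ _).trans ?_
  rw [abs_mul, abs_signVec, one_mul]
  have h1 := abs_fderiv_le_of_lipschitz hh hL hlip ((ellNorm 1 x)⁻¹ • x) (Pi.single i 1)
  have h2 := abs_fderiv_le_of_lipschitz hh hL hlip ((ellNorm 1 x)⁻¹ • x) ((ellNorm 1 x)⁻¹ • x)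
  rw [ellNorm_single, abs_one, mul_one] at h1
  have h3 := (ellNorm_two_le_one _).trans (ellNorm_one_normalize_le x)
  nlinarith

theorem sum_radialPartial_sq_le {h : (Fin d → ℝ) → ℝ} (hh : Differentiable ℝ h) {L : ℝ}
    (hL : 0 ≤ L) (hlip : ∀ x y, |h x - h y| ≤ L * ellNorm 2 (x - y)) (x : Fin d → ℝ) :
    ∑ i, radialPartial h i x ^ 2 ≤
      2 * L ^ 2 * (1 + d * ellNorm 2 ((ellNorm 1 x)⁻¹ • x) ^ 2) * ellNorm 1 x ^ (-2 : ℝ) := by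
  have hN := ellNorm_nonneg (p := 1) x
  set s := (ellNorm 1 x)⁻¹ • x with hs
  set β := fderiv ℝ h s s with hβ
  have hβ2 : β ^ 2 ≤ L ^ 2 * ellNorm 2 s ^ 2 := by
    rw [← mul_pow, ← sq_abs]
    gcongr
    exact abs_fderiv_le_of_lipschitz hh hL hlip s s
  have hterm : ∀ i, radialPartial h i x ^ 2 ≤
      (2 * fderiv ℝ h s (Pi.single i 1) ^ 2 + 2 * β ^ 2) * ellNorm 1 x ^ (-2 : ℝ) := by
    intro i
    rw [radialPartial, mul_pow, mul_comm, Real.rpow_neg hN, Real.rpow_two, inv_pow]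
    gcongr
    have h1 : signVec x i ^ 2 = 1 := by rw [← sq_abs, abs_signVec, one_pow]
    nlinarith [sq_nonneg (fderiv ℝ h s (Pi.single i 1) + signVec x i * β)]
  refine (Finset.sum_le_sum fun i _ => hterm i).trans ?_
  rw [← Finset.sum_mul]
  gcongr
  rw [Finset.sum_add_distrib, ← Finset.mul_sum]
  simp only [Finset.sum_const, Finset.card_univ, Fintype.card_fin, nsmul_eq_mul]
  have h2 := sum_fderiv_sq_le_of_lipschitz hh hL hlip s
  have hd0 : (0 : ℝ) ≤ d := d.cast_nonneg
  nlinarith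

/-- The Poincaré inequality on the `ℓ_1`-sphere, for smooth functions. It is inherited from the
product of Laplace distributions through the radial projection. -/
theorem variance_unifL1Sphere_le_of_differentiable (hd : 3 ≤ d) {h : (Fin d → ℝ) → ℝ}
    (hh : Differentiable ℝ h) {L : ℝ} (hL : 0 ≤ L)
    (hlip : ∀ x y, |h x - h y| ≤ L * ellNorm 2 (x - y)) :
    ∫⁻ s, ENNReal.ofReal ((h s - ∫ z, h z ∂(unifL1Sphere d)) ^ 2) ∂(unifL1Sphere d) ≤
      ENNReal.ofReal (108 * L ^ 2 / d ^ 2) := by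
  have hd0 : 0 < d := by omega
  have hd3 : (3 : ℝ) ≤ d := by exact_mod_cast hd
  have hprob := isProbabilityMeasure_unifL1Sphere hd0
  let F : (Fin d → ℝ) → ℝ := fun x => h ((ellNorm 1 x)⁻¹ • x)
  have hhm : Measurable h := hh.continuous.measurable
  have hF : Measurable F := hhm.comp measurable_normalize
  have hM : ∀ x, |F x| ≤ |h 0| + L := by
    intro x
    have h1 := hlip ((ellNorm 1 x)⁻¹ • x) 0
    rw [sub_zero] at h1
    have h2 := (ellNorm_two_le_one _).trans (ellNorm_one_normalize_le x)
    have h3 : |F x| ≤ |F x - h 0| + |h 0| := by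
      have := abs_add_le (F x - h 0) (h 0); rwa [sub_add_cancel] at this
    nlinarith
  have hint : ∫ z, F z ∂(Measure.pi fun _ : Fin d => laplaceMeasure)
      = ∫ z, h z ∂(unifL1Sphere d) := by
    rw [← map_normalize_laplace hd0, integral_map measurable_normalize.aemeasurable
      hhm.aestronglyMeasurable]
  have hvar : ∫⁻ s, ENNReal.ofReal ((h s - ∫ z, h z ∂(unifL1Sphere d)) ^ 2) ∂(unifL1Sphere d) =
      ∫⁻ x, ENNReal.ofReal ((F x - ∫ z, F z ∂(Measure.pi fun _ => laplaceMeasure)) ^ 2)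
        ∂(Measure.pi fun _ : Fin d => laplaceMeasure) := by
    rw [hint]
    conv_lhs => rw [← map_normalize_laplace hd0]
    rw [lintegral_map ((hhm.sub_const _).pow_const 2).ennreal_ofReal measurable_normalize]
    rw [map_normalize_laplace hd0]
  have hna : NullSingletonClass laplaceMeasure :=
    ⟨fun x => withDensity_absolutelyContinuous _ _ (measure_singleton x)⟩
  have hcoord : ∀ i, ∫⁻ x, ∫⁻ a, ENNReal.ofReal ((F (Function.update x i a) -
        ∫ b, F (Function.update x i b) ∂laplaceMeasure) ^ 2) ∂laplaceMeasure
        ∂(Measure.pi fun _ : Fin d => laplaceMeasure) ≤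
      4 * ∫⁻ x, ENNReal.ofReal (radialPartial h i x ^ 2)
        ∂(Measure.pi fun _ : Fin d => laplaceMeasure) := by
    intro i
    -- another coordinate, which is almost surely nonzero
    obtain ⟨j, hij⟩ : ∃ j : Fin d, j ≠ i := by
      have : Nontrivial (Fin d) := Fin.nontrivial_iff_two_le.2 (by omega)
      exact exists_ne i
    rw [← lintegral_update_pi ((measurable_radialPartial h i).pow_const 2).ennreal_ofReal i,
      ← lintegral_const_mul' _ _ (by norm_num)]
    refine lintegral_mono_ae ?_
    filter_upwards [Measure.ae_eval_ne (μ := fun _ : Fin d => laplaceMeasure) j 0] with x hx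
    have hupd : Measurable fun a : ℝ => Function.update x i a := measurable_update x
    refine le_trans ?_ (lintegral_sq_sub_laplace_le
      (φ := fun a => F (Function.update x i a)) (K := |x j|⁻¹ * (2 * L)) ?_ ?_ ?_ ?_)
    · -- the mean minimizes the second moment, and `φ 0` may replace it
      rw [lintegral_sq_sub_eq (f := fun a => F (Function.update x i a)) (hF.comp hupd)
        (fun a => hM _) (F (Function.update x i 0))]
      exact le_self_add
    · have hne : ∀ a, ellNorm 1 (Function.update x i a) ≠ 0 := fun a h0 => hx (by
        have := congrFun (ellNorm_eq_zero.1 h0) j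
        rwa [Function.update_of_ne hij] at this)
      have hcu : Continuous fun a : ℝ => Function.update x i a :=
        continuous_const.update i continuous_id
      exact hh.continuous.comp (((continuous_ellNorm.comp hcu).inv₀ hne).smul hcu)
    · exact fun a ha => hasDerivAt_comp_normalize_update hh hij hx ha
    · intro a _
      refine (abs_radialPartial_le hh hL hlip i _).trans ?_
      have h1 := abs_apply_le_ellNorm (p := 1) (Function.update x i a) j
      rw [Function.update_of_ne hij] at h1
      have h2 : 0 < |x j| := abs_pos.2 hx
      gcongr
    · exact (measurable_radialPartial h i).comp hupd
  rw [hvar]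
  refine (efron_stein hF hM).trans ((Finset.sum_le_sum fun i _ => hcoord i).trans ?_)
  rw [← Finset.mul_sum, ← lintegral_finsetSum _
    (fun i _ => ((measurable_radialPartial h i).pow_const 2).ennreal_ofReal)]
  have hH : Measurable fun s : Fin d → ℝ =>
      ENNReal.ofReal (2 * L ^ 2) * (1 + d * ENNReal.ofReal (ellNorm 2 s ^ 2)) :=
    ((((measurable_ellNorm.pow_const 2).ennreal_ofReal).const_mul _).const_add 1).const_mul _
  have haff : ∀ {A : ℝ}, 0 ≤ A →
      (1 : ℝ≥0∞) + d * ENNReal.ofReal A = ENNReal.ofReal (1 + d * A) := fun hA => by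
    rw [ENNReal.ofReal_add zero_le_one (by positivity), ENNReal.ofReal_mul d.cast_nonneg,
      ENNReal.ofReal_natCast, ENNReal.ofReal_one]
  have hpt : ∀ x : Fin d → ℝ, ∑ i, ENNReal.ofReal (radialPartial h i x ^ 2) ≤
      ENNReal.ofReal (2 * L ^ 2) *
        (1 + d * ENNReal.ofReal (ellNorm 2 ((ellNorm 1 x)⁻¹ • x) ^ 2)) *
        ENNReal.ofReal (ellNorm 1 x ^ (-2 : ℝ)) := by
    intro x
    rw [← ENNReal.ofReal_sum_of_nonneg (fun i _ => sq_nonneg _), haff (sq_nonneg _),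
      ← ENNReal.ofReal_mul (by positivity), ← ENNReal.ofReal_mul (by positivity)]
    exact ENNReal.ofReal_le_ofReal (sum_radialPartial_sq_le hh hL hlip x)
  -- the inverse second moment of the norm is finite because `d > 2`
  have hpol := lintegral_normalize_mul_rpow_laplace hd0 hH (m := -2) (by linarith)
  have hΓ : Real.Gamma (d + -2) / Real.Gamma d = 1 / ((d - 1) * (d - 2)) := by
    have e : (d : ℝ) = (d + -2) + 1 + 1 := by ring
    have hp : 0 < Real.Gamma (d + -2) := Real.Gamma_pos_of_pos (by linarith)
    conv_lhs => rw [e, Real.Gamma_add_one (by linarith), Real.Gamma_add_one (by linarith)]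
    have e1 : (d : ℝ) - 1 ≠ 0 := by linarith
    have e2 : (d : ℝ) - 2 ≠ 0 := by linarith
    have e3 : (d : ℝ) + -2 + 1 + 1 + -2 = d + -2 := by ring
    rw [e3]
    have e4 : (d : ℝ) + -2 + 1 = d - 1 := by ring
    rw [e4]
    have e5 : (d : ℝ) + -2 = d - 2 := by ring
    rw [e5] at hp ⊢
    field_simp
  calc 4 * ∫⁻ x, ∑ i, ENNReal.ofReal (radialPartial h i x ^ 2)
        ∂(Measure.pi fun _ : Fin d => laplaceMeasure)
      ≤ 4 * ((∫⁻ s, ENNReal.ofReal (2 * L ^ 2) * (1 + d * ENNReal.ofReal (ellNorm 2 s ^ 2))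
          ∂(unifL1Sphere d)) * ENNReal.ofReal (1 / ((d - 1) * (d - 2)))) := by
        rw [← hΓ, ← hpol]
        gcongr with x
        exact hpt x
    _ = ENNReal.ofReal (4 * (2 * L ^ 2 * (1 + d * (2 / (d + 1))) * (1 / ((d - 1) * (d - 2))))) := by
        have hm : Measurable fun s : Fin d → ℝ => ENNReal.ofReal (ellNorm 2 s ^ 2) :=
          (measurable_ellNorm.pow_const 2).ennreal_ofReal
        rw [lintegral_const_mul _ ((hm.const_mul _).const_add 1),
          lintegral_add_left measurable_const, lintegral_const_mul _ hm,
          lintegral_ellNorm_two_sq_unifL1Sphere hd0, lintegral_const, measure_univ, mul_one,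
          haff (by positivity), ← ENNReal.ofReal_mul (by positivity),
          ← ENNReal.ofReal_mul (by positivity), ENNReal.ofReal_mul (p := 4) (by norm_num)]
        norm_num
    _ ≤ _ := by
        refine ENNReal.ofReal_le_ofReal ?_
        have e1 : (d : ℝ) * (2 / (d + 1)) ≤ 2 := by
          rw [mul_div_assoc', div_le_iff₀ (by positivity)]; linarith
        have e2 : 1 / (((d : ℝ) - 1) * (d - 2)) ≤ 9 / (2 * d ^ 2) := by
          have p1 : (0 : ℝ) < d - 1 := by linarith
          have p2 : (0 : ℝ) < d - 2 := by linarith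
          rw [div_le_div_iff₀ (by positivity) (by positivity)]
          nlinarith
        have e3 : 0 ≤ 1 / (((d : ℝ) - 1) * (d - 2)) :=
          one_div_nonneg.2 (mul_nonneg (by linarith) (by linarith))
        calc 4 * (2 * L ^ 2 * (1 + d * (2 / (d + 1))) * (1 / (((d : ℝ) - 1) * (d - 2))))
            ≤ 4 * (2 * L ^ 2 * (1 + 2) * (9 / (2 * d ^ 2))) := by gcongr
          _ = 108 * L ^ 2 / d ^ 2 := by field_simp; ring

end SpherePoincare

/-! ### The second moment of the gradient estimator -/

section SecondMoment

variable {d : ℕ}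

theorem continuous_of_ellNorm_lipschitz {h : (Fin d → ℝ) → ℝ} {p : ℝ≥0∞} [Fact (1 ≤ p)] {L : ℝ}
    (hlip : ∀ x y, |h x - h y| ≤ L * ellNorm p (x - y)) : Continuous h := by
  refine continuous_iff_continuousAt.2 fun x => ?_
  rw [ContinuousAt, tendsto_iff_norm_sub_tendsto_zero]
  have h1 : Filter.Tendsto (fun y => L * ellNorm p (y - x)) (nhds x) (nhds 0) := by
    have : Continuous fun y => L * ellNorm p (y - x) :=
      continuous_const.mul (continuous_ellNorm.comp (continuous_id.sub continuous_const))
    simpa [ellNorm_zero] using this.tendsto x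
  exact squeeze_zero (fun _ => norm_nonneg _) (fun y => hlip y x) h1

/-- Mollification of a Lipschitz function. -/
theorem exists_differentiable_lipschitz_approx {h : (Fin d → ℝ) → ℝ} {L : ℝ}
    (hlip : ∀ x y, |h x - h y| ≤ L * ellNorm 2 (x - y)) {δ : ℝ} (hδ : 0 < δ) :
    ∃ h' : (Fin d → ℝ) → ℝ, Differentiable ℝ h' ∧
      (∀ x y, |h' x - h' y| ≤ L * ellNorm 2 (x - y)) ∧ ∀ x, |h' x - h x| ≤ δ := by
  have hc := continuous_of_ellNorm_lipschitz hlip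
  obtain ⟨r, hr, hball⟩ : ∃ r > 0, ∀ v : Fin d → ℝ, ‖v‖ < r → L * ellNorm 2 v ≤ δ := by
    have h1 : Continuous fun v : Fin d → ℝ => L * ellNorm 2 v := continuous_const.mul continuous_ellNorm
    have h2 := h1.tendsto 0
    rw [ellNorm_zero, mul_zero] at h2
    obtain ⟨r, hr, h3⟩ := Metric.eventually_nhds_iff.1 (h2.eventually (gt_mem_nhds hδ))
    exact ⟨r, hr, fun v hv => (h3 (by simpa [dist_eq_norm] using hv)).le⟩
  let φ : ContDiffBump (0 : Fin d → ℝ) := ⟨r / 2, r, by positivity, by linarith⟩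
  have hφ : Continuous (φ.normed volume) := φ.continuous_normed
  have hφs : HasCompactSupport (φ.normed volume) := φ.hasCompactSupport_normed
  refine ⟨convolution (φ.normed volume) h (ContinuousLinearMap.lsmul ℝ ℝ) volume, ?_, ?_, ?_⟩
  · exact (hφs.contDiff_convolution_left _ (φ.contDiff_normed (n := 1))
      hc.locallyIntegrable).differentiable one_ne_zero
  · intro x y
    have hi : ∀ x, Integrable fun t => φ.normed volume t * h (x - t) := fun x =>
      (hφ.mul (hc.comp (continuous_const.sub continuous_id))).integrable_of_hasCompactSupport
        hφs.mul_right
    simp only [convolution_def, ContinuousLinearMap.lsmul_apply, smul_eq_mul]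
    rw [← integral_sub (hi x) (hi y)]
    calc |∫ t, (φ.normed volume t * h (x - t) - φ.normed volume t * h (y - t))|
        ≤ ∫ t, φ.normed volume t * (L * ellNorm 2 (x - y)) := by
          rw [← Real.norm_eq_abs]
          refine norm_integral_le_of_norm_le (φ.integrable_normed.mul_const _) (.of_forall fun t => ?_)
          rw [← mul_sub, norm_mul, Real.norm_of_nonneg (φ.nonneg_normed t)]
          refine mul_le_mul_of_nonneg_left ?_ (φ.nonneg_normed t)
          have := hlip (x - t) (y - t)
          rwa [sub_sub_sub_cancel_right] at this
      _ = L * ellNorm 2 (x - y) := by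
          rw [integral_mul_const, φ.integral_normed, one_mul]
  · intro x
    refine φ.dist_normed_convolution_le hc.aestronglyMeasurable fun z hz => ?_
    rw [Real.dist_eq]
    exact (hlip z x).trans (hball _ (by simpa [dist_eq_norm, φ] using hz))

theorem integrable_unifL1Sphere_of_continuous (hd : 0 < d) {h : (Fin d → ℝ) → ℝ}
    (hc : Continuous h) : Integrable h (unifL1Sphere d) := by
  have := isProbabilityMeasure_unifL1Sphere hd
  obtain ⟨C, hC⟩ : ∃ C, ∀ s : Fin d → ℝ, ellNorm 1 s = 1 → |h s| ≤ C := by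
    have hK : IsCompact (Metric.closedBall (0 : Fin d → ℝ) 1) := isCompact_closedBall _ _
    obtain ⟨C, hC⟩ := hK.exists_bound_of_continuousOn hc.continuousOn
    refine ⟨C, fun s hs => hC s ?_⟩
    rw [mem_closedBall_zero_iff, pi_norm_le_iff_of_nonneg zero_le_one]
    exact fun i => hs ▸ abs_apply_le_ellNorm s i
  refine .of_bound hc.aestronglyMeasurable C ?_
  filter_upwards [ae_ellNorm_unifL1Sphere hd] with s hs using hC s hs

/-- The Poincaré inequality on the `ℓ_1`-sphere for centered Lipschitz functions. -/
theorem integral_sq_unifL1Sphere_le (hd : 3 ≤ d) {h : (Fin d → ℝ) → ℝ} {L : ℝ} (hL : 0 < L)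
    (hlip : ∀ x y, |h x - h y| ≤ L * ellNorm 2 (x - y)) (h0 : ∫ s, h s ∂(unifL1Sphere d) = 0) :
    ∫ s, h s ^ 2 ∂(unifL1Sphere d) ≤ 224 * L ^ 2 / d ^ 2 := by
  have hd0 : 0 < d := by omega
  have hd' : (0 : ℝ) < d := by exact_mod_cast hd0
  have := isProbabilityMeasure_unifL1Sphere hd0
  have hc := continuous_of_ellNorm_lipschitz hlip
  -- a mollification at this scale costs no more than the variance itself
  set δ := L / d with hδ
  have hδ0 : 0 < δ := by positivity
  obtain ⟨h', hdiff, hlip', happ⟩ := exists_differentiable_lipschitz_approx hlip hδ0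
  have hc' := hdiff.continuous
  set m := ∫ s, h' s ∂(unifL1Sphere d)
  have hm : |m| ≤ δ := by
    have : m = ∫ s, (h' s - h s) ∂(unifL1Sphere d) := by
      rw [integral_sub (integrable_unifL1Sphere_of_continuous hd0 hc')
        (integrable_unifL1Sphere_of_continuous hd0 hc), h0, sub_zero]
    rw [this]
    exact abs_integral_le_of_bound happ
  have hi1 : Integrable (fun s => (h' s - m) ^ 2) (unifL1Sphere d) :=
    integrable_unifL1Sphere_of_continuous hd0 ((hc'.sub continuous_const).pow 2)
  have hv : ∫ s, (h' s - m) ^ 2 ∂(unifL1Sphere d) ≤ 108 * L ^ 2 / d ^ 2 := by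
    have h1 := variance_unifL1Sphere_le_of_differentiable hd hdiff hL.le hlip'
    rw [← ofReal_integral_eq_lintegral_ofReal hi1 (.of_forall fun s => sq_nonneg _)] at h1
    exact (ENNReal.ofReal_le_ofReal_iff (by positivity)).1 h1
  calc ∫ s, h s ^ 2 ∂(unifL1Sphere d)
      ≤ ∫ s, (2 * (h' s - m) ^ 2 + 8 * δ ^ 2) ∂(unifL1Sphere d) := by
        refine integral_mono (integrable_unifL1Sphere_of_continuous hd0 (hc.pow 2))
          ((hi1.const_mul 2).add (integrable_const _)) fun s => ?_
        have e1 : |m - (h' s - h s)| ≤ 2 * δ := (abs_sub _ _).trans (by linarith [happ s])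
        have e2 : (m - (h' s - h s)) ^ 2 ≤ (2 * δ) ^ 2 := by
          rw [← sq_abs]; gcongr
        have e3 : 0 ≤ ((h' s - m) - (m - (h' s - h s))) ^ 2 := sq_nonneg _
        dsimp only
        nlinarith
    _ = 2 * ∫ s, (h' s - m) ^ 2 ∂(unifL1Sphere d) + 8 * δ ^ 2 := by
        rw [integral_add (hi1.const_mul 2) (integrable_const _), integral_const_mul]
        simp
    _ ≤ 2 * (108 * L ^ 2 / d ^ 2) + 8 * δ ^ 2 := by gcongr
    _ = 224 * L ^ 2 / d ^ 2 := by rw [hδ]; field_simp; ring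

theorem integral_comp_neg_unifL1Sphere (hd : 0 < d) (h : (Fin d → ℝ) → ℝ) :
    ∫ s, h (-s) ∂(unifL1Sphere d) = ∫ s, h s ∂(unifL1Sphere d) := by
  conv_rhs => rw [← map_neg_unifL1Sphere hd]
  exact ((MeasurableEquiv.neg (Fin d → ℝ)).measurableEmbedding.integral_map h).symm

/-- The second moment of a symmetric difference of a Lipschitz function over the `ℓ_1`-sphere. The
difference is odd, hence has mean zero, and the Poincaré inequality applies. -/
theorem integral_sq_symmDiff_le (hd : 3 ≤ d) {q : ℝ≥0∞} [Fact (1 ≤ q)] {f : (Fin d → ℝ) → ℝ}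
    {X : Set (Fin d → ℝ)} {G : ℝ} (hG : 0 < G)
    (hf : ∀ x ∈ X, ∀ y ∈ X, |f x - f y| ≤ G * ellNorm q (x - y)) {μ : ℝ} (hμ : 0 < μ)
    {y : Fin d → ℝ} (hy : ∀ b, ellNorm 1 b ≤ 1 → y + μ • b ∈ X) :
    ∫ s, (f (y + μ • s) - f (y - μ • s)) ^ 2 ∂(unifL1Sphere d) ≤
      224 * (2 * μ * (G * (d : ℝ) ^ (recip (min q 2) - recip 2))) ^ 2 / d ^ 2 := by
  have hd0 : 0 < d := by omega
  have hd' : (0 : ℝ) < d := by exact_mod_cast hd0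
  set K := G * (d : ℝ) ^ (recip (min q 2) - recip 2) with hK
  have hK0 : 0 < K := by positivity
  -- extend the restriction of `f` to a function that is Lipschitz on the whole space
  have hlipOn : LipschitzOnWith ⟨K, hK0.le⟩
      (fun x : PiLp 2 (fun _ : Fin d => ℝ) => f (WithLp.ofLp x)) {x | WithLp.ofLp x ∈ X} := by
    refine LipschitzOnWith.of_dist_le_mul fun x hx z hz => ?_
    rw [Real.dist_eq, dist_eq_norm]
    refine (hf _ hx _ hz).trans ?_
    have := ellNorm_le_rpow_min_mul (q := q) (p := 2) hd0 (WithLp.ofLp x - WithLp.ofLp z)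
    calc G * ellNorm q (WithLp.ofLp x - WithLp.ofLp z)
        ≤ G * ((d : ℝ) ^ (recip (min q 2) - recip 2) *
          ellNorm 2 (WithLp.ofLp x - WithLp.ofLp z)) := by gcongr
      _ = K * ellNorm 2 (WithLp.ofLp x - WithLp.ofLp z) := by rw [hK]; ring
  obtain ⟨g, hg, hgf⟩ := hlipOn.extend_real
  have hg' : ∀ x z : Fin d → ℝ, |g (WithLp.toLp 2 x) - g (WithLp.toLp 2 z)| ≤ K * ellNorm 2 (x - z) := by
    intro x z
    have := hg.dist_le_mul (WithLp.toLp 2 x) (WithLp.toLp 2 z)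
    rwa [Real.dist_eq, dist_eq_norm] at this
  let h : (Fin d → ℝ) → ℝ := fun s => g (WithLp.toLp 2 (y + μ • s)) - g (WithLp.toLp 2 (y - μ • s))
  have hlip : ∀ s s', |h s - h s'| ≤ (2 * μ * K) * ellNorm 2 (s - s') := by
    intro s s'
    have h1 := hg' (y + μ • s) (y + μ • s')
    have h2 := hg' (y - μ • s) (y - μ • s')
    rw [add_sub_add_left_eq_sub, ← smul_sub, ellNorm_smul, abs_of_pos hμ] at h1
    rw [sub_sub_sub_cancel_left, ← smul_sub, ellNorm_smul, abs_of_pos hμ, ellNorm_sub_comm] at h2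
    have h3 : h s - h s' = (g (WithLp.toLp 2 (y + μ • s)) - g (WithLp.toLp 2 (y + μ • s'))) -
      (g (WithLp.toLp 2 (y - μ • s)) - g (WithLp.toLp 2 (y - μ • s'))) := by simp only [h]; ring
    rw [h3]
    refine (abs_sub _ _).trans ?_
    linarith
  have hodd : ∫ s, h s ∂(unifL1Sphere d) = 0 := by
    have h1 := integral_comp_neg_unifL1Sphere hd0 h
    have h2 : ∀ s, h (-s) = - h s := fun s => by
      simp only [h, smul_neg, sub_neg_eq_add, ← sub_eq_add_neg, neg_sub]
    simp only [h2, integral_neg] at h1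
    linarith
  refine le_trans (le_of_eq ?_) (integral_sq_unifL1Sphere_le hd (by positivity) hlip hodd)
  refine integral_congr_ae ?_
  filter_upwards [ae_ellNorm_unifL1Sphere hd0] with s hs
  have e1 := hgf (x := WithLp.toLp 2 (y + μ • s)) (hy s hs.le)
  have e2 := hgf (x := WithLp.toLp 2 (y - μ • s))
    (by have := hy (-s) (by rw [ellNorm_neg]; exact hs.le); rwa [smul_neg, ← sub_eq_add_neg] at this)
  simp only [h, ← e1, ← e2]

theorem ellNorm_estimator (hd : 0 < d) {p : ℝ≥0∞} [Fact (1 ≤ p)] {μ : ℝ} (hμ : 0 < μ)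
    (f : (Fin d → ℝ) → ℝ) (y s : Fin d → ℝ) :
    ellNorm (ENNReal.conjExponent p) (PBMD.estimator μ f y s) =
      d / (2 * μ) * |f (y + μ • s) - f (y - μ • s)| * (d : ℝ) ^ (1 - recip p) := by
  have := fact_one_le_conjExponent (p := p)
  rw [← recip_conjExponent (p := p)]
  refine ellNorm_of_abs_eq hd fun i => ?_
  rw [PBMD.estimator, Pi.smul_apply, smul_eq_mul, abs_mul, abs_signVec, mul_one, abs_mul,
    abs_of_nonneg (by positivity)]

/-- The second moment of the gradient estimator in the dual norm. -/
theorem integral_ellNorm_estimator_sq_le (hd : 3 ≤ d) {p q : ℝ≥0∞} [Fact (1 ≤ p)] [Fact (1 ≤ q)]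
    {f : (Fin d → ℝ) → ℝ} {X : Set (Fin d → ℝ)} {G : ℝ} (hG : 0 < G)
    (hf : ∀ x ∈ X, ∀ y ∈ X, |f x - f y| ≤ G * ellNorm q (x - y)) {μ : ℝ} (hμ : 0 < μ)
    {y : Fin d → ℝ} (hy : ∀ b, ellNorm 1 b ≤ 1 → y + μ • b ∈ X) :
    ∫ s, ellNorm (ENNReal.conjExponent p) (PBMD.estimator μ f y s) ^ 2 ∂(unifL1Sphere d) ≤
      224 * G ^ 2 * xiConst p q d := by
  have hd0 : 0 < d := by omega
  have hd' : (0 : ℝ) < d := by exact_mod_cast hd0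
  simp only [ellNorm_estimator hd0 hμ, mul_pow, sq_abs]
  have e : ∀ s : Fin d → ℝ, ((d : ℝ) / (2 * μ)) ^ 2 * (f (y + μ • s) - f (y - μ • s)) ^ 2 *
      ((d : ℝ) ^ (1 - recip p)) ^ 2 = (((d : ℝ) / (2 * μ)) ^ 2 * ((d : ℝ) ^ (1 - recip p)) ^ 2) *
      (f (y + μ • s) - f (y - μ • s)) ^ 2 := fun s => by ring
  simp only [e]
  rw [integral_const_mul]
  refine (mul_le_mul_of_nonneg_left (integral_sq_symmDiff_le hd hG hf hμ hy) (by positivity)).trans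
    (le_of_eq ?_)
  have e2 : xiConst p q d = ((d : ℝ) ^ (1 - recip p)) ^ 2 *
      ((d : ℝ) ^ (recip (min q 2) - recip 2)) ^ 2 := by
    rw [xiConst, ← Real.rpow_natCast, ← Real.rpow_mul hd'.le, ← Real.rpow_natCast,
      ← Real.rpow_mul hd'.le, ← Real.rpow_add hd', recip_two]
    congr 1; push_cast; ring
  rw [e2]
  field_simp

end SecondMoment

/-! ### The bias of the gradient estimator -/

section Bias

open Filter Topology Set

variable {d : ℕ}

/-- A Lipschitz cutoff function, equal to `1` on the `ℓ_1`-ball of radius `1 - ε` and to `0` outside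
the unit `ℓ_1`-ball. -/
noncomputable def l1Cutoff (ε : ℝ) (x : Fin d → ℝ) : ℝ := max 0 (min 1 ((1 - ellNorm 1 x) / ε))

/-- The part of the unit `ℓ_1`-ball at `ℓ_1`-distance less than `ε` from its
boundary. -/
def l1Shell (d : ℕ) (ε : ℝ) : Set (Fin d → ℝ) := {x | 1 - ε < ellNorm 1 x ∧ ellNorm 1 x < 1}

theorem l1Cutoff_nonneg (ε : ℝ) (x : Fin d → ℝ) : 0 ≤ l1Cutoff ε x := le_max_left _ _

theorem l1Cutoff_le_one (ε : ℝ) (x : Fin d → ℝ) : l1Cutoff ε x ≤ 1 :=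
  max_le zero_le_one (min_le_left _ _)

theorem l1Cutoff_eq_zero {ε : ℝ} (hε : 0 < ε) {x : Fin d → ℝ} (hx : 1 ≤ ellNorm 1 x) :
    l1Cutoff ε x = 0 := by
  refine max_eq_left ((min_le_right _ _).trans ?_)
  exact div_nonpos_of_nonpos_of_nonneg (by linarith) hε.le

theorem l1Cutoff_eq_one {ε : ℝ} (hε : 0 < ε) {x : Fin d → ℝ} (hx : ellNorm 1 x ≤ 1 - ε) :
    l1Cutoff ε x = 1 := by
  have : 1 ≤ (1 - ellNorm 1 x) / ε := by rw [le_div_iff₀ hε]; linarith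
  rw [l1Cutoff, min_eq_left this, max_eq_right zero_le_one]

theorem l1Cutoff_of_mem_shell {ε : ℝ} (hε : 0 < ε) {x : Fin d → ℝ} (hx : x ∈ l1Shell d ε) :
    l1Cutoff ε x = (1 - ellNorm 1 x) / ε := by
  have h1 : (1 - ellNorm 1 x) / ε ≤ 1 := by rw [div_le_iff₀ hε]; linarith [hx.1]
  have h2 : 0 ≤ (1 - ellNorm 1 x) / ε := div_nonneg (by linarith [hx.2]) hε.le
  rw [l1Cutoff, min_eq_right h1, max_eq_right h2]

theorem continuous_l1Cutoff (ε : ℝ) : Continuous (l1Cutoff ε : (Fin d → ℝ) → ℝ) :=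
  continuous_const.max (continuous_const.min ((continuous_const.sub continuous_ellNorm).div_const _))

theorem abs_l1Cutoff_sub_le {ε : ℝ} (hε : 0 < ε) (x y : Fin d → ℝ) :
    |l1Cutoff ε x - l1Cutoff ε y| ≤ ellNorm 1 (x - y) / ε := by
  have h1 : |l1Cutoff ε x - l1Cutoff ε y| ≤
      |min 1 ((1 - ellNorm 1 x) / ε) - min 1 ((1 - ellNorm 1 y) / ε)| := by
    simpa [l1Cutoff] using abs_max_sub_max_le_max 0 (min 1 ((1 - ellNorm 1 x) / ε)) 0
      (min 1 ((1 - ellNorm 1 y) / ε))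
  have h2 : |min 1 ((1 - ellNorm 1 x) / ε) - min 1 ((1 - ellNorm 1 y) / ε)| ≤
      |(1 - ellNorm 1 x) / ε - (1 - ellNorm 1 y) / ε| := by
    simpa using abs_min_sub_min_le_max 1 ((1 - ellNorm 1 x) / ε) 1 ((1 - ellNorm 1 y) / ε)
  refine (h1.trans h2).trans ?_
  rw [← sub_div, abs_div, abs_of_pos hε]
  gcongr
  have h3 := ellNorm_add_le (p := 1) (x - y) y
  have h4 := ellNorm_add_le (p := 1) (y - x) x
  rw [sub_add_cancel] at h3 h4
  rw [ellNorm_sub_comm] at h4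
  rw [abs_le]
  constructor <;> linarith

theorem isOpen_l1Shell (ε : ℝ) : IsOpen (l1Shell d ε) :=
  (isOpen_lt continuous_const continuous_ellNorm).inter (isOpen_lt continuous_ellNorm continuous_const)

theorem hasDerivAt_ellNorm_one_sub_smul {x : Fin d → ℝ} (hx : ∀ i, x i ≠ 0) (w : Fin d → ℝ) :
    HasDerivAt (fun δ : ℝ => ellNorm 1 (x - δ • w)) (-(signVec x ⬝ᵥ w)) 0 := by
  simp only [ellNorm_one]
  have h : ∀ i ∈ (Finset.univ : Finset (Fin d)),
      HasDerivAt (fun δ : ℝ => |(x - δ • w) i|) (signVec x i * (-w i)) 0 := by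
    intro i _
    have h1 : HasDerivAt (fun δ : ℝ => (x - δ • w) i) (-w i) 0 := by
      simpa using ((hasDerivAt_id (0 : ℝ)).mul_const (w i)).const_sub (x i)
    have h2 : HasDerivAt (fun b : ℝ => |b|) (signVec x i) ((x - (0 : ℝ) • w) i) := by
      simp only [zero_smul, sub_zero]
      unfold signVec
      rcases lt_or_gt_of_ne (hx i) with h | h
      · rw [if_pos h]; exact hasDerivAt_abs_neg h
      · rw [if_neg h.not_gt]; exact hasDerivAt_abs_pos h
    exact h2.comp 0 h1
  convert! HasDerivAt.fun_sum h using 1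
  simp [dotProduct]

theorem hasDerivAt_l1Cutoff_sub_smul {ε : ℝ} (hε : 0 < ε) {x : Fin d → ℝ} (hx : ∀ i, x i ≠ 0)
    (h1 : ellNorm 1 x ≠ 1) (h2 : ellNorm 1 x ≠ 1 - ε) (w : Fin d → ℝ) :
    HasDerivAt (fun δ : ℝ => l1Cutoff ε (x - δ • w))
      ((l1Shell d ε).indicator (fun x => (signVec x ⬝ᵥ w) / ε) x) 0 := by
  have hcont : Continuous fun δ : ℝ => x - δ • w := by fun_prop
  have hN : Continuous fun δ : ℝ => ellNorm 1 (x - δ • w) := continuous_ellNorm.comp hcont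
  have hN0 : Tendsto (fun δ : ℝ => ellNorm 1 (x - δ • w)) (𝓝 0) (𝓝 (ellNorm 1 x)) := by
    simpa using hN.tendsto 0
  by_cases hs : x ∈ l1Shell d ε
  · rw [indicator_of_mem hs]
    have hev : (fun δ : ℝ => l1Cutoff ε (x - δ • w)) =ᶠ[𝓝 0]
        fun δ => (1 - ellNorm 1 (x - δ • w)) / ε := by
      filter_upwards [hN0.eventually (lt_mem_nhds hs.1), hN0.eventually (gt_mem_nhds hs.2)]
        with δ e1 e2 using l1Cutoff_of_mem_shell hε ⟨e1, e2⟩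
    refine HasDerivAt.congr_of_eventuallyEq ?_ hev
    simpa using ((hasDerivAt_ellNorm_one_sub_smul hx w).const_sub 1).div_const ε
  · rw [indicator_of_notMem hs]
    rcases lt_or_gt_of_ne h2 with h | h
    · refine (hasDerivAt_const (0 : ℝ) (1 : ℝ)).congr_of_eventuallyEq ?_
      filter_upwards [hN0.eventually (gt_mem_nhds h)] with δ e1 using l1Cutoff_eq_one hε e1.le
    · have h3 : 1 < ellNorm 1 x := lt_of_le_of_ne (not_lt.1 fun h4 => hs ⟨h, h4⟩) h1.symm
      refine (hasDerivAt_const (0 : ℝ) (0 : ℝ)).congr_of_eventuallyEq ?_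
      filter_upwards [hN0.eventually (lt_mem_nhds h3)] with δ e1 using l1Cutoff_eq_zero hε e1.le

theorem isCompact_l1Ball (r : ℝ) : IsCompact {x : Fin d → ℝ | ellNorm 1 x ≤ r} := by
  refine Metric.isCompact_of_isClosed_isBounded (isClosed_le continuous_ellNorm continuous_const) ?_
  rw [isBounded_iff_forall_norm_le]
  refine ⟨max r 0, fun x hx => (pi_norm_le_iff_of_nonneg (le_max_right _ _)).2 fun i => ?_⟩
  exact (abs_apply_le_ellNorm (p := 1) x i).trans (le_trans hx (le_max_left _ _))

theorem measurable_signVec_dotProduct (w : Fin d → ℝ) :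
    Measurable fun x : Fin d → ℝ => signVec x ⬝ᵥ w := by
  simp only [dotProduct]
  exact Finset.measurable_sum _ fun i _ =>
    ((measurable_pi_apply i).comp measurable_signVec).mul_const _

theorem abs_signVec_dotProduct_le (x w : Fin d → ℝ) : |signVec x ⬝ᵥ w| ≤ ellNorm 1 w := by
  rw [ellNorm_one, dotProduct]
  refine (Finset.abs_sum_le_sum_abs _ _).trans (le_of_eq (Finset.sum_congr rfl fun i _ => ?_))
  rw [abs_mul, abs_signVec, one_mul]

theorem ae_ellNorm_one_ne (hd : 0 < d) (r : ℝ) :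
    ∀ᵐ x : Fin d → ℝ, ellNorm 1 x ≠ r := by
  have := isProbabilityMeasure_unifL1Sphere hd
  have hm : MeasurableSet {x : Fin d → ℝ | ellNorm 1 x = r} :=
    measurable_ellNorm (measurableSet_singleton r)
  rw [ae_iff]
  simp only [not_not]
  rw [← lintegral_indicator_one hm, lintegral_polar hd (measurable_one.indicator hm)]
  have h1 : ∀ᵐ t ∂(volume.restrict (Ioi (0 : ℝ))), ENNReal.ofReal (t ^ (d - 1)) *
      ∫⁻ s, {x : Fin d → ℝ | ellNorm 1 x = r}.indicator 1 (t • s) ∂(unifL1Sphere d) = 0 := by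
    have hne : ∀ᵐ t ∂(volume.restrict (Ioi (0 : ℝ))), t ≠ r := by
      refine ae_restrict_of_ae ?_
      rw [ae_iff]; simp
    filter_upwards [ae_restrict_mem measurableSet_Ioi, hne] with t ht htr
    have ht : 0 < t := ht
    rw [lintegral_congr_ae (g := fun _ => 0), lintegral_zero, mul_zero]
    filter_upwards [ae_ellNorm_unifL1Sphere hd] with s hs
    refine indicator_of_notMem (fun h => htr ?_) _
    have h' : ellNorm 1 (t • s) = r := h
    rwa [ellNorm_smul, hs, abs_of_pos ht, mul_one] at h'
  rw [lintegral_congr_ae h1]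
  simp

/-- Integration by parts for a convex function against the cutoff function, in the form of an
inequality: difference quotients of `h` in the direction `w` are at most `h (x + w) - h x`, and
translation moves them to the cutoff function. -/
theorem integral_shell_le (hd : 0 < d) {h : (Fin d → ℝ) → ℝ} (hh : ConvexOn ℝ univ h)
    (hc : Continuous h) (w : Fin d → ℝ) {ε : ℝ} (hε : 0 < ε) :
    ∫ x, h x * (l1Shell d ε).indicator (fun x => (signVec x ⬝ᵥ w) / ε) x ≤
      ∫ x, l1Cutoff ε x * (h (x + w) - h x) := by
  have hk := continuous_l1Cutoff (d := d) ε
  have hcs : HasCompactSupport (l1Cutoff ε : (Fin d → ℝ) → ℝ) :=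
    .of_support_subset_isCompact (isCompact_l1Ball 1) fun x hx => by
      by_contra hcon
      exact hx (l1Cutoff_eq_zero hε (not_le.1 hcon).le)
  have hint : ∀ g : (Fin d → ℝ) → ℝ, Continuous g → Integrable fun x => l1Cutoff ε x * g x :=
    fun g hg => (hk.mul hg).integrable_of_hasCompactSupport hcs.mul_right
  let δ : ℕ → ℝ := fun n => 1 / ((n : ℝ) + 1)
  have hδ0 : ∀ n, 0 < δ n := fun n => Nat.one_div_pos_of_nat
  have hδ1 : ∀ n, δ n ≤ 1 := fun n => by
    simp only [δ]; rw [div_le_one (by positivity)]; linarith [n.cast_nonneg (α := ℝ)]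
  have hδt : Tendsto δ atTop (𝓝 0) := tendsto_one_div_add_atTop_nhds_zero_nat
  have hle : ∀ n, ∫ x, h x * ((l1Cutoff ε (x - δ n • w) - l1Cutoff ε x) / δ n) ≤
      ∫ x, l1Cutoff ε x * (h (x + w) - h x) := by
    intro n
    have hshift : ∫ x, l1Cutoff ε x * h (x + δ n • w) = ∫ x, l1Cutoff ε (x - δ n • w) * h x := by
      rw [← integral_sub_right_eq_self (fun x => l1Cutoff ε x * h (x + δ n • w)) (δ n • w)]
      simp only [sub_add_cancel]
    have i1 := hint (fun x => h (x + δ n • w)) (hc.comp (continuous_id.add continuous_const))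
    have i2 := hint h hc
    have i3 : Integrable fun x => l1Cutoff ε (x - δ n • w) * h x := by
      have := i1.comp_sub_right (δ n • w)
      simpa only [sub_add_cancel] using this
    have e1 : ∫ x, h x * ((l1Cutoff ε (x - δ n • w) - l1Cutoff ε x) / δ n) =
        ∫ x, l1Cutoff ε x * ((h (x + δ n • w) - h x) / δ n) := by
      have a1 : ∀ x, h x * ((l1Cutoff ε (x - δ n • w) - l1Cutoff ε x) / δ n) =
        (l1Cutoff ε (x - δ n • w) * h x - l1Cutoff ε x * h x) / δ n := fun x => by ring
      have a2 : ∀ x, l1Cutoff ε x * ((h (x + δ n • w) - h x) / δ n) =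
        (l1Cutoff ε x * h (x + δ n • w) - l1Cutoff ε x * h x) / δ n := fun x => by ring
      simp only [a1, a2, integral_div]
      rw [integral_sub i3 i2, integral_sub i1 i2, hshift]
    rw [e1]
    -- convexity makes the difference quotients monotone
    refine integral_mono (hint _ (((hc.comp (continuous_id.add continuous_const)).sub hc).div_const _))
      (hint _ ((hc.comp (continuous_id.add continuous_const)).sub hc)) fun x => ?_
    refine mul_le_mul_of_nonneg_left ?_ (l1Cutoff_nonneg ε x)
    rw [div_le_iff₀ (hδ0 n)]
    have := hh.2 (mem_univ x) (mem_univ (x + w))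
      (sub_nonneg.2 (hδ1 n)) (hδ0 n).le (sub_add_cancel 1 (δ n))
    have e : (1 - δ n) • x + δ n • (x + w) = x + δ n • w := by
      rw [smul_add, sub_smul, one_smul]; abel
    rw [e, smul_eq_mul, smul_eq_mul] at this
    linarith
  refine le_of_tendsto' (tendsto_integral_of_dominated_convergence
    (fun x => {x : Fin d → ℝ | ellNorm 1 x ≤ 1 + ellNorm 1 w}.indicator
      (fun x => |h x| * (ellNorm 1 w / ε)) x) ?_ ?_ ?_ ?_) hle
  · intro n
    exact (hc.mul (((hk.comp (continuous_id.sub continuous_const)).sub hk).div_const _)).aestronglyMeasurable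
  · rw [integrable_indicator_iff (isCompact_l1Ball _).measurableSet]
    exact (hc.abs.mul continuous_const).continuousOn.integrableOn_compact (isCompact_l1Ball _)
  · intro n
    refine .of_forall fun x => ?_
    have hw0 := ellNorm_nonneg (p := 1) w
    have hsm : ellNorm 1 (δ n • w) ≤ ellNorm 1 w := by
      rw [ellNorm_smul, abs_of_pos (hδ0 n)]
      exact mul_le_of_le_one_left hw0 (hδ1 n)
    by_cases hx : ellNorm 1 x ≤ 1 + ellNorm 1 w
    · rw [indicator_of_mem (by exact hx), Real.norm_eq_abs, abs_mul]
      gcongr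
      rw [abs_div, abs_of_pos (hδ0 n), div_le_iff₀ (hδ0 n)]
      refine (abs_l1Cutoff_sub_le hε _ _).trans (le_of_eq ?_)
      rw [sub_sub_cancel_left, ellNorm_neg, ellNorm_smul, abs_of_pos (hδ0 n)]
      ring
    · rw [indicator_of_notMem (by exact hx)]
      rw [not_le] at hx
      have h3 := ellNorm_add_le (p := 1) (x - δ n • w) (δ n • w)
      rw [sub_add_cancel] at h3
      rw [l1Cutoff_eq_zero hε (by linarith), l1Cutoff_eq_zero hε (by linarith)]
      simp
  · have hne : ∀ᵐ x : Fin d → ℝ, ∀ i, x i ≠ 0 := by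
      rw [ae_all_iff, volume_pi]
      exact fun i => Measure.ae_eval_ne (μ := fun _ : Fin d => (volume : Measure ℝ)) i 0
    filter_upwards [hne, ae_ellNorm_one_ne hd 1, ae_ellNorm_one_ne hd (1 - ε)] with x h0 h1 h2
    refine Tendsto.const_mul _ ?_
    have h3 := (hasDerivAt_iff_tendsto_slope_zero.1 (hasDerivAt_l1Cutoff_sub_smul hε h0 h1 h2 w))
    have h4 : Tendsto δ atTop (𝓝[≠] 0) :=
      tendsto_nhdsWithin_iff.2 ⟨hδt, .of_forall fun n => (hδ0 n).ne'⟩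
    refine (h3.comp h4).congr fun n => ?_
    simp only [Function.comp, zero_add, zero_smul, sub_zero, smul_eq_mul]
    ring

theorem signVec_smul {t : ℝ} (ht : 0 < t) (x : Fin d → ℝ) : signVec (t • x) = signVec x := by
  ext i
  simp only [signVec, Pi.smul_apply, smul_eq_mul, mul_neg_iff, ht, true_and, ht.not_gt, false_and,
    or_false]

/-- The density in the radius of the integral of `h x * ⟨sign x, w⟩`. -/
noncomputable def radialMoment (h : (Fin d → ℝ) → ℝ) (w : Fin d → ℝ) (t : ℝ) : ℝ :=
  t ^ (d - 1) * ∫ s, h (t • s) * (signVec s ⬝ᵥ w) ∂(unifL1Sphere d)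

theorem continuous_radialMoment (hd : 0 < d) {h : (Fin d → ℝ) → ℝ} (hc : Continuous h)
    (w : Fin d → ℝ) : Continuous (radialMoment h w) := by
  have := isProbabilityMeasure_unifL1Sphere hd
  refine (continuous_pow _).mul (continuous_iff_continuousAt.2 fun t₀ => ?_)
  obtain ⟨C, hC⟩ := (isCompact_l1Ball (d := d) (|t₀| + 1)).exists_bound_of_continuousOn hc.continuousOn
  refine continuousAt_of_dominated (bound := fun _ => C * ellNorm 1 w) ?_ ?_ (integrable_const _) ?_
  · exact .of_forall fun t => ((hc.comp (continuous_const_smul t)).measurable.mul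
      (measurable_signVec_dotProduct w)).aestronglyMeasurable
  · filter_upwards [Metric.ball_mem_nhds t₀ one_pos] with t ht
    filter_upwards [ae_ellNorm_unifL1Sphere hd] with s hs
    rw [Real.norm_eq_abs, abs_mul]
    have h1 : |h (t • s)| ≤ C := by
      refine hC _ ?_
      change ellNorm 1 (t • s) ≤ |t₀| + 1
      rw [ellNorm_smul, hs, mul_one]
      rw [Metric.mem_ball, Real.dist_eq] at ht
      have := abs_add_le (t - t₀) t₀
      rw [sub_add_cancel] at this
      linarith
    exact mul_le_mul h1 (abs_signVec_dotProduct_le s w) (abs_nonneg _) ((abs_nonneg _).trans h1)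
  · refine .of_forall fun s => ?_
    exact ((hc.comp (continuous_id.smul continuous_const)).mul continuous_const).continuousAt

/-- The integral over the shell in polar coordinates. -/
theorem integral_shell_eq (hd : 0 < d) {h : (Fin d → ℝ) → ℝ} (hc : Continuous h)
    (w : Fin d → ℝ) {ε : ℝ} (hε : 0 < ε) (hε1 : ε < 1) :
    ∫ x, h x * (l1Shell d ε).indicator (fun x => (signVec x ⬝ᵥ w) / ε) x =
      (polarConst d).toReal * (ε⁻¹ * ∫ t in (1 - ε)..1, radialMoment h w t) := by
  have := isProbabilityMeasure_unifL1Sphere hd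
  set g : (Fin d → ℝ) → ℝ :=
    fun x => h x * (l1Shell d ε).indicator (fun x => (signVec x ⬝ᵥ w) / ε) x with hg
  have hgm : Measurable g := hc.measurable.mul
    (((measurable_signVec_dotProduct w).div_const ε).indicator (isOpen_l1Shell ε).measurableSet)
  have hgi : Integrable g := by
    obtain ⟨C, hC⟩ := (isCompact_l1Ball (d := d) 1).exists_bound_of_continuousOn hc.continuousOn
    have hgb : Integrable fun x : Fin d → ℝ => {x : Fin d → ℝ | ellNorm 1 x ≤ 1}.indicator
        (fun _ => C * (ellNorm 1 w / ε)) x := by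
      rw [integrable_indicator_iff (isCompact_l1Ball _).measurableSet]
      exact continuousOn_const.integrableOn_compact (isCompact_l1Ball _)
    refine hgb.mono' hgm.aestronglyMeasurable (.of_forall fun x => ?_)
    by_cases hx : x ∈ l1Shell d ε
    · have hx1 : ellNorm 1 x ≤ 1 := hx.2.le
      rw [hg, indicator_of_mem (by exact hx1)]
      simp only [indicator_of_mem hx]
      rw [norm_mul, norm_div, Real.norm_of_nonneg hε.le]
      have h1 := hC x hx1
      have h2 := abs_signVec_dotProduct_le x w
      gcongr
      · exact (norm_nonneg _).trans h1
      · exact h2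
    · rw [hg]
      simp only [indicator_of_notMem hx, mul_zero, norm_zero]
      refine indicator_nonneg (fun x hx => ?_) x
      have := (norm_nonneg _).trans (hC x hx)
      have := ellNorm_nonneg (p := 1) w
      positivity
  have hsm : Measurable (fun z : ℝ × (Fin d → ℝ) => z.1 • z.2) :=
    measurable_fst.smul measurable_snd
  have hinner : ∀ t, 0 < t → ∫ s, g (t • s) ∂(unifL1Sphere d) =
      (Ioo (1 - ε) 1).indicator
        (fun t => ε⁻¹ * ∫ s, h (t • s) * (signVec s ⬝ᵥ w) ∂(unifL1Sphere d)) t := by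
    intro t ht
    have hmem : ∀ s : Fin d → ℝ, ellNorm 1 s = 1 → (t • s ∈ l1Shell d ε ↔ t ∈ Ioo (1 - ε) 1) := by
      intro s hs
      simp only [l1Shell, mem_ofPred_eq, ellNorm_smul, hs, abs_of_pos ht, mul_one, mem_Ioo]
    by_cases htI : t ∈ Ioo (1 - ε) 1
    · rw [indicator_of_mem htI, ← integral_const_mul]
      refine integral_congr_ae ?_
      filter_upwards [ae_ellNorm_unifL1Sphere hd] with s hs
      rw [hg]
      simp only [indicator_of_mem ((hmem s hs).2 htI), signVec_smul ht]
      ring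
    · rw [indicator_of_notMem htI]
      refine integral_eq_zero_of_ae ?_
      filter_upwards [ae_ellNorm_unifL1Sphere hd] with s hs
      rw [hg]
      simp only [indicator_of_notMem (fun hh => htI ((hmem s hs).1 hh)), mul_zero, Pi.zero_apply]
  have hfin : IsFiniteMeasure (volume.restrict (Ioo (1 - ε) 1) : Measure ℝ) := by infer_instance
  have hsf : SFinite (radialMeasure d) := by unfold radialMeasure; infer_instance
  have hi2 : Integrable (fun z : ℝ × (Fin d → ℝ) => g (z.1 • z.2))
      ((radialMeasure d).prod (unifL1Sphere d)) := by
    have h1 := hgi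
    rw [← map_smul_radialMeasure_prod hd] at h1
    exact (integrable_map_measure hgm.aestronglyMeasurable hsm.aemeasurable).1 h1
  calc ∫ x, g x = ∫ z, g (z.1 • z.2) ∂((radialMeasure d).prod (unifL1Sphere d)) := by
        conv_lhs => rw [← map_smul_radialMeasure_prod hd]
        rw [integral_map hsm.aemeasurable hgm.aestronglyMeasurable]
    _ = ∫ t, ∫ s, g (t • s) ∂(unifL1Sphere d) ∂(radialMeasure d) := integral_prod _ hi2
    _ = ∫ t in Ioi (0 : ℝ), (polarConst d * ENNReal.ofReal (t ^ (d - 1))).toReal •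
          ∫ s, g (t • s) ∂(unifL1Sphere d) := by
        rw [radialMeasure, integral_withDensity_eq_integral_toReal_smul (by fun_prop)]
        exact .of_forall fun t => ENNReal.mul_lt_top (polarConst_ne_top hd).lt_top
          ENNReal.ofReal_lt_top
    _ = ∫ t in Ioi (0 : ℝ), (Ioo (1 - ε) 1).indicator
          (fun t => (polarConst d).toReal * (ε⁻¹ * radialMoment h w t)) t := by
        refine setIntegral_congr_fun measurableSet_Ioi fun t ht => ?_
        have ht : 0 < t := ht
        rw [hinner t ht, ENNReal.toReal_mul, ENNReal.toReal_ofReal (by positivity), smul_eq_mul]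
        by_cases htI : t ∈ Ioo (1 - ε) 1
        · rw [indicator_of_mem htI, indicator_of_mem htI, radialMoment]; ring
        · rw [indicator_of_notMem htI, indicator_of_notMem htI, mul_zero]
    _ = (polarConst d).toReal * (ε⁻¹ * ∫ t in (1 - ε)..1, radialMoment h w t) := by
        rw [setIntegral_indicator measurableSet_Ioo, inter_eq_right.2 fun t ht => by
          have := ht.1; exact lt_trans (by linarith) this, ← integral_Ioc_eq_integral_Ioo,
          ← intervalIntegral.integral_of_le (by linarith), intervalIntegral.integral_const_mul,
          intervalIntegral.integral_const_mul]

/-- The divergence theorem on the unit `ℓ_1`-ball, as an inequality for convex functions. -/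
theorem polarConst_mul_integral_sphere_le (hd : 0 < d) {h : (Fin d → ℝ) → ℝ}
    (hh : ConvexOn ℝ univ h) (hc : Continuous h) (w : Fin d → ℝ) :
    (polarConst d).toReal * ∫ s, h s * (signVec s ⬝ᵥ w) ∂(unifL1Sphere d) ≤
      ∫ x in ellBall d 1 1, (h (x + w) - h x) := by
  let ε : ℕ → ℝ := fun n => 1 / ((n : ℝ) + 2)
  have hε0 : ∀ n, 0 < ε n := fun n => by positivity
  have hε1 : ∀ n, ε n < 1 := fun n => by
    simp only [ε]; rw [div_lt_one (by positivity)]; linarith [n.cast_nonneg (α := ℝ)]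
  have hεt : Tendsto ε atTop (𝓝 0) := by
    have := (tendsto_one_div_add_atTop_nhds_zero_nat (𝕜 := ℝ)).comp (tendsto_add_atTop_nat 1)
    refine this.congr fun n => ?_
    simp only [Function.comp, ε]; push_cast; congr 1; ring
  have hle : ∀ n, (polarConst d).toReal * ((ε n)⁻¹ * ∫ t in (1 - ε n)..1, radialMoment h w t) ≤
      ∫ x, l1Cutoff (ε n) x * (h (x + w) - h x) := fun n => by
    rw [← integral_shell_eq hd hc w (hε0 n) (hε1 n)]
    exact integral_shell_le hd hh hc w (hε0 n)
  have hM := continuous_radialMoment hd hc w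
  have hlim1 : Tendsto (fun n => (polarConst d).toReal *
      ((ε n)⁻¹ * ∫ t in (1 - ε n)..1, radialMoment h w t)) atTop
      (𝓝 ((polarConst d).toReal * radialMoment h w 1)) := by
    refine Tendsto.const_mul _ ?_
    have h1 : HasDerivAt (fun u => ∫ t in (0 : ℝ)..u, radialMoment h w t) (radialMoment h w 1) 1 :=
      intervalIntegral.integral_hasDerivAt_right (hM.intervalIntegrable _ _)
        (hM.stronglyMeasurableAtFilter _ _) hM.continuousAt
    have h2 := hasDerivAt_iff_tendsto_slope_zero.1 h1
    have h3 : Tendsto (fun n => - ε n) atTop (𝓝[≠] 0) :=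
      tendsto_nhdsWithin_iff.2 ⟨by simpa using hεt.neg,
        .of_forall fun n => (neg_lt_zero.2 (hε0 n)).ne⟩
    refine (h2.comp h3).congr fun n => ?_
    simp only [Function.comp, smul_eq_mul]
    rw [← intervalIntegral.integral_interval_sub_left (hM.intervalIntegrable 0 1)
      (hM.intervalIntegrable 0 (1 - ε n)), ← sub_eq_add_neg, inv_neg]
    ring
  have hlim2 : Tendsto (fun n => ∫ x, l1Cutoff (ε n) x * (h (x + w) - h x)) atTop
      (𝓝 (∫ x in ellBall d 1 1, (h (x + w) - h x))) := by
    have hcw : Continuous fun x => h (x + w) - h x :=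
      (hc.comp (continuous_id.add continuous_const)).sub hc
    rw [← integral_indicator (measurableSet_ellBall 1)]
    refine tendsto_integral_of_dominated_convergence
      (fun x => {x : Fin d → ℝ | ellNorm 1 x ≤ 1}.indicator (fun x => |h (x + w) - h x|) x) ?_ ?_ ?_ ?_
    · exact fun n => ((continuous_l1Cutoff _).mul hcw).aestronglyMeasurable
    · rw [integrable_indicator_iff (isCompact_l1Ball _).measurableSet]
      exact hcw.abs.continuousOn.integrableOn_compact (isCompact_l1Ball _)
    · refine fun n => .of_forall fun x => ?_
      by_cases hx : ellNorm 1 x ≤ 1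
      · rw [indicator_of_mem (by exact hx), norm_mul, Real.norm_of_nonneg (l1Cutoff_nonneg _ _)]
        exact mul_le_of_le_one_left (norm_nonneg _) (l1Cutoff_le_one _ _)
      · rw [l1Cutoff_eq_zero (hε0 n) (not_le.1 hx).le, zero_mul, norm_zero]
        exact indicator_nonneg (fun _ _ => abs_nonneg _) _
    · refine .of_forall fun x => tendsto_const_nhds.congr' ?_
      by_cases hx : ellNorm 1 x < 1
      · filter_upwards [hεt.eventually (gt_mem_nhds (sub_pos.2 hx))] with n hn
        rw [l1Cutoff_eq_one (hε0 n) (by linarith), one_mul, indicator_of_mem (by exact hx)]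
      · refine .of_forall fun n => ?_
        dsimp only
        rw [l1Cutoff_eq_zero (hε0 n) (not_lt.1 hx), zero_mul, indicator_of_notMem (by exact hx)]
  have h1 : radialMoment h w 1 = ∫ s, h s * (signVec s ⬝ᵥ w) ∂(unifL1Sphere d) := by
    simp [radialMoment]
  rw [← h1]
  exact le_of_tendsto_of_tendsto' hlim1 hlim2 hle

theorem ae_ne_zero_unifL1Sphere (hd : 0 < d) : ∀ᵐ s ∂(unifL1Sphere d), ∀ i, s i ≠ 0 := by
  have hm : MeasurableSet {s : Fin d → ℝ | ∀ i, s i ≠ 0} := by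
    simp only [ofPred_forall]
    exact MeasurableSet.iInter fun i => (measurable_pi_apply i (measurableSet_singleton 0)).compl
  rw [← map_normalize_laplace hd, ae_map_iff measurable_normalize.aemeasurable hm,
    pi_laplaceMeasure]
  refine (withDensity_absolutelyContinuous _ _).ae_le ?_
  have hne : ∀ᵐ x : Fin d → ℝ, ∀ i, x i ≠ 0 := by
    rw [ae_all_iff, volume_pi]
    exact fun i => Measure.ae_eval_ne (μ := fun _ : Fin d => (volume : Measure ℝ)) i 0
  filter_upwards [hne] with x hx i
  have hx0 : x ≠ 0 := fun h => hx i (by rw [h]; rfl)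
  exact mul_ne_zero (inv_ne_zero (ellNorm_pos hx0).ne') (hx i)

/-- The gradient estimator is unbiased up to the smoothing error: it satisfies the subgradient
inequality for a convex Lipschitz function with an error of `2 G μ`. -/
theorem integral_estimator_dotProduct_le (hd : 0 < d) {q : ℝ≥0∞} [Fact (1 ≤ q)]
    {f : (Fin d → ℝ) → ℝ} {X : Set (Fin d → ℝ)} {G : ℝ} (hG : 0 < G) (hcv : ConvexOn ℝ univ f)
    (hf : ∀ x ∈ X, ∀ y ∈ X, |f x - f y| ≤ G * ellNorm q (x - y)) {μ : ℝ} (hμ : 0 < μ)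
    {y v : Fin d → ℝ} (hy : ∀ b, ellNorm 1 b ≤ 1 → y + μ • b ∈ X)
    (hv : ∀ b, ellNorm 1 b ≤ 1 → v + μ • b ∈ X) :
    ∫ s, PBMD.estimator μ f y s ⬝ᵥ (v - y) ∂(unifL1Sphere d) ≤ f v - f y + 2 * G * μ := by
  have hd' : (0 : ℝ) < d := by exact_mod_cast hd
  have := isProbabilityMeasure_unifL1Sphere hd
  have hc : Continuous f := by
    have := hcv.continuousOn_interior
    rwa [interior_univ, continuousOn_univ] at this
  let h : (Fin d → ℝ) → ℝ := fun x => f (y + μ • x)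
  have hhc : Continuous h := hc.comp (continuous_const.add (continuous_const_smul μ))
  have hhcv : ConvexOn ℝ univ h := by
    refine ⟨convex_univ, fun x _ z _ a b ha hb hab => ?_⟩
    have := hcv.2 (mem_univ (y + μ • x)) (mem_univ (y + μ • z)) ha hb hab
    have e : a • (y + μ • x) + b • (y + μ • z) = y + μ • (a • x + b • z) := by
      rw [smul_add, smul_add, smul_add, smul_comm a μ, smul_comm b μ]
      have : a • y + b • y = y := by rw [← add_smul, hab, one_smul]
      calc _ = (a • y + b • y) + (μ • a • x + μ • b • z) := by abel
        _ = _ := by rw [this]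
    rwa [e] at this
  have key := polarConst_mul_integral_sphere_le hd hhcv hhc (μ⁻¹ • (v - y))
  have hbound : ∫ x in ellBall d 1 1, (h (x + μ⁻¹ • (v - y)) - h x) ≤
      volume.real (ellBall d 1 1) * (f v - f y + 2 * G * μ) := by
    have hpt : ∀ x ∈ ellBall d 1 1, h (x + μ⁻¹ • (v - y)) - h x ≤ f v - f y + 2 * G * μ := by
      intro x hx
      have hx1 : ellNorm 1 x ≤ 1 := le_of_lt hx
      have hz : ellNorm 1 (0 : Fin d → ℝ) ≤ 1 := by rw [ellNorm_zero]; exact zero_le_one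
      have hyX := hy 0 hz
      have hvX := hv 0 hz
      rw [smul_zero, add_zero] at hyX hvX
      have e1 : y + μ • (x + μ⁻¹ • (v - y)) = v + μ • x := by
        rw [smul_add, smul_inv_smul₀ hμ.ne']; abel
      have hq : ellNorm q x ≤ 1 := (ellNorm_anti Fact.out x).trans hx1
      have h1 := hf _ (hv x hx1) _ hvX
      have h2 := hf _ (hy x hx1) _ hyX
      rw [add_sub_cancel_left, ellNorm_smul, abs_of_pos hμ] at h1 h2
      have h3 : G * (μ * ellNorm q x) ≤ G * μ := by
        have : μ * ellNorm q x ≤ μ * 1 := by gcongr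
        nlinarith
      simp only [h, e1]
      have h4 := (abs_le.1 h1).2
      have h5 := (abs_le.1 h2).1
      linarith
    have hfinB : volume (ellBall d 1 1) < ∞ :=
      (measure_mono fun x (hx : ellNorm 1 x < 1) => hx.le).trans_lt
        (isCompact_l1Ball (d := d) 1).measure_lt_top
    have hint : IntegrableOn (fun x => h (x + μ⁻¹ • (v - y)) - h x) (ellBall d 1 1) := by
      refine IntegrableOn.mono_set (t := {x | ellNorm 1 x ≤ 1}) ?_ (fun x (hx : ellNorm 1 x < 1) => hx.le)
      exact ((hhc.comp (continuous_id.add continuous_const)).sub hhc).continuousOn.integrableOn_compact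
        (isCompact_l1Ball _)
    calc _ ≤ ∫ x in ellBall d 1 1, (f v - f y + 2 * G * μ) :=
          setIntegral_mono_on hint (integrableOn_const hfinB.ne) (measurableSet_ellBall 1) hpt
      _ = _ := by rw [setIntegral_const, smul_eq_mul]
  have hpc : (polarConst d).toReal = d * volume.real (ellBall d 1 1) := by
    rw [polarConst, ENNReal.toReal_mul, ENNReal.toReal_natCast]; rfl
  have hvol : 0 < volume.real (ellBall d 1 1) := by
    have h1 : 0 < (polarConst d).toReal :=
      ENNReal.toReal_pos (polarConst_ne_zero hd) (polarConst_ne_top hd)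
    rw [hpc] at h1
    exact pos_of_mul_pos_right h1 hd'.le
  have hI : ∀ g : (Fin d → ℝ) → ℝ, Continuous g →
      Integrable (fun s => g s * (signVec s ⬝ᵥ (v - y))) (unifL1Sphere d) := fun g hg =>
    (integrable_unifL1Sphere_of_continuous hd hg).mul_bdd (c := ellNorm 1 (v - y))
      (measurable_signVec_dotProduct _).aestronglyMeasurable
      (.of_forall fun s => abs_signVec_dotProduct_le s _)
  -- the two evaluations contribute equally, by the symmetry of the sphere
  have hsym : ∫ s, f (y - μ • s) * (signVec s ⬝ᵥ (v - y)) ∂(unifL1Sphere d) =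
      - ∫ s, h s * (signVec s ⬝ᵥ (v - y)) ∂(unifL1Sphere d) := by
    rw [← integral_comp_neg_unifL1Sphere hd, ← integral_neg]
    refine integral_congr_ae ?_
    filter_upwards [ae_ne_zero_unifL1Sphere hd] with s hs
    have e : signVec (-s) = - signVec s := by
      ext i
      simp only [signVec, Pi.neg_apply, neg_lt_zero]
      rcases lt_or_gt_of_ne (hs i) with h | h
      · simp [h, h.not_gt]
      · simp [h, h.not_gt]
    simp only [h, e, neg_dotProduct, smul_neg, sub_neg_eq_add, mul_neg]
  have hest : ∫ s, PBMD.estimator μ f y s ⬝ᵥ (v - y) ∂(unifL1Sphere d) =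
      d * ∫ s, h s * (signVec s ⬝ᵥ (μ⁻¹ • (v - y))) ∂(unifL1Sphere d) := by
    have e1 : ∀ s, PBMD.estimator μ f y s ⬝ᵥ (v - y) = (d : ℝ) / (2 * μ) *
        (h s * (signVec s ⬝ᵥ (v - y)) - f (y - μ • s) * (signVec s ⬝ᵥ (v - y))) := fun s => by
      rw [PBMD.estimator, smul_dotProduct, smul_eq_mul]; ring
    have e2 : ∀ s, h s * (signVec s ⬝ᵥ (μ⁻¹ • (v - y))) = μ⁻¹ * (h s * (signVec s ⬝ᵥ (v - y))) :=
      fun s => by rw [dotProduct_smul, smul_eq_mul]; ring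
    simp only [e1, e2]
    rw [integral_const_mul, integral_const_mul, integral_sub (hI h hhc)
      (hI (fun s => f (y - μ • s)) (hc.comp (continuous_const.sub (continuous_const_smul μ)))), hsym]
    field_simp
    ring
  rw [hest]
  have h1 := key.trans hbound
  rw [hpc] at h1
  have h2 : volume.real (ellBall d 1 1) *
      (d * ∫ s, h s * (signVec s ⬝ᵥ (μ⁻¹ • (v - y))) ∂(unifL1Sphere d)) ≤
      volume.real (ellBall d 1 1) * (f v - f y + 2 * G * μ) := by linarith
  exact le_of_mul_le_mul_left h2 hvol

end Bias

/-! ### The feasible set -/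

section Geometry

open Set Filter Topology

variable {d : ℕ} {p : ℝ≥0∞} [Fact (1 ≤ p)] {r R α : ℝ} {X : Set (Fin d → ℝ)}

theorem radius_le_of_ellBall_subset (hd : 0 < d) (hr : 0 < r) (h : ellBall d p r ⊆ ellBall d p R) :
    r ≤ R := by
  by_contra! hlt
  -- a multiple of a basis vector that lies in the ball of radius `r` but not in that of radius `R`,
  -- also when `R` is negative
  have hm : max R 0 < r := max_lt hlt hr
  have h1 : (Pi.single ⟨0, hd⟩ (max R 0) : Fin d → ℝ) ∈ ellBall d p r := by
    rw [ellBall, mem_ofPred_eq, ellNorm_single, abs_of_nonneg (le_max_right _ _)]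
    exact hm
  have h2 := h h1
  rw [ellBall, mem_ofPred_eq, ellNorm_single, abs_of_nonneg (le_max_right _ _)] at h2
  exact absurd h2 (not_lt.2 (le_max_left _ _))

theorem mem_of_ellNorm_le (hX : IsClosed X) (hsub : ellBall d p r ⊆ X) (hr : 0 < r)
    {x : Fin d → ℝ} (hx : ellNorm p x ≤ r) : x ∈ X := by
  have ht : Tendsto (fun c : ℝ => c • x) (𝓝[<] 1) (𝓝 x) := by
    have : Tendsto (fun c : ℝ => c • x) (𝓝 1) (𝓝 ((1 : ℝ) • x)) :=
      (continuous_id.smul continuous_const).tendsto 1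
    rw [one_smul] at this
    exact this.mono_left nhdsWithin_le_nhds
  refine hX.mem_of_tendsto ht ?_
  filter_upwards [Ioo_mem_nhdsLT (zero_lt_one (α := ℝ))] with c hc
  refine hsub ?_
  rw [ellBall, mem_ofPred_eq, ellNorm_smul, abs_of_pos hc.1]
  calc c * ellNorm p x ≤ c * r := mul_le_mul_of_nonneg_left hx hc.1.le
    _ < r := by nlinarith [hc.2]

/-- A point of `(1 - α) X` and a vector of norm at most `α r` form a convex combination of points of
`X`. -/
theorem add_mem_of_mem_shrunk (hX : IsClosed X) (hcv : Convex ℝ X) (hsub : ellBall d p r ⊆ X)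
    (hr : 0 < r) (hα : 0 < α) (hα1 : α < 1) {y z : Fin d → ℝ} (hy : y ∈ shrunk X α)
    (hz : ellNorm p z ≤ α * r) : y + z ∈ X := by
  obtain ⟨x, hx, rfl⟩ := hy
  have h1 : α⁻¹ • z ∈ X := by
    refine mem_of_ellNorm_le hX hsub hr ?_
    rw [ellNorm_smul, abs_of_pos (inv_pos.2 hα), inv_mul_le_iff₀ hα]
    exact hz
  have := hcv hx h1 (sub_nonneg.2 hα1.le) hα.le (sub_add_cancel 1 α)
  rwa [smul_inv_smul₀ hα.ne'] at this

theorem shrunk_subset_interior (hX : IsClosed X) (hcv : Convex ℝ X) (hsub : ellBall d p r ⊆ X)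
    (hr : 0 < r) (hα : 0 < α) (hα1 : α < 1) : shrunk X α ⊆ interior X := by
  intro y hy
  refine mem_interior.2 ⟨{w | ellNorm p (w - y) < α * r}, fun w hw => ?_, ?_, ?_⟩
  · have := add_mem_of_mem_shrunk hX hcv hsub hr hα hα1 hy (z := w - y) (le_of_lt hw)
    rwa [add_sub_cancel] at this
  · exact isOpen_lt (continuous_ellNorm.comp (continuous_id.sub continuous_const)) continuous_const
  · rw [mem_ofPred_eq, sub_self, ellNorm_zero]; positivity

theorem isCompact_shrunk (hX : IsCompact X) : IsCompact (shrunk X α) :=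
  hX.image (continuous_const_smul _)

theorem convex_shrunk (hcv : Convex ℝ X) : Convex ℝ (shrunk X α) := hcv.smul (1 - α)

theorem zero_mem_of_ellBall_subset (hr : 0 < r) (hsub : ellBall d p r ⊆ X) : (0 : Fin d → ℝ) ∈ X :=
  hsub (by rw [ellBall, mem_ofPred_eq, ellNorm_zero]; exact hr)

theorem smul_mem_shrunk {u : Fin d → ℝ} (hu : u ∈ X) : (1 - α) • u ∈ shrunk X α := ⟨u, hu, rfl⟩

end Geometry

/-! ### The mirror map -/

section MirrorMap

open Set Filter Topology

variable {d : ℕ} {p : ℝ≥0∞} [Fact (1 ≤ p)] {lam : ℝ} {ψ : (Fin d → ℝ) → ℝ} {S : Set (Fin d → ℝ)}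

theorem StronglyConvexLp.le (hψ : StronglyConvexLp p S lam ψ) {x y : Fin d → ℝ} (hx : x ∈ S)
    (hy : y ∈ S) {a b : ℝ} (ha : 0 ≤ a) (hb : 0 ≤ b) (hab : a + b = 1) :
    ψ (a • x + b • y) ≤ a * ψ x + b * ψ y - a * b * (lam / 2 * ellNorm p (x - y) ^ 2) :=
  hψ.2 (x := WithLp.toLp p x) hx (y := WithLp.toLp p y) hy ha hb hab

/-- The inner product with `gradVec` is the Fréchet derivative, also where the latter is zero because
`ψ` is not differentiable. -/
theorem gradVec_dotProduct (ψ : (Fin d → ℝ) → ℝ) (y v : Fin d → ℝ) :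
    gradVec ψ y ⬝ᵥ v = fderiv ℝ ψ y v := by
  conv_rhs => rw [pi_eq_sum_univ' v, map_sum]
  refine Finset.sum_congr rfl fun i _ => ?_
  rw [map_smul, smul_eq_mul, mul_comm]
  rfl

theorem measurable_gradVec (ψ : (Fin d → ℝ) → ℝ) : Measurable (gradVec ψ) :=
  measurable_pi_iff.2 fun _ => measurable_fderiv_apply_const ℝ ψ _

theorem tendsto_slope_gradVec (hS : IsOpen S) (hd : DifferentiableOn ℝ ψ S) {y : Fin d → ℝ}
    (hy : y ∈ S) (v : Fin d → ℝ) :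
    Tendsto (fun t : ℝ => (ψ (y + t • v) - ψ y) / t) (𝓝[>] 0) (𝓝 (gradVec ψ y ⬝ᵥ v)) := by
  have h1 : HasDerivAt (fun t : ℝ => ψ (y + t • v)) (fderiv ℝ ψ y v) 0 :=
    ((hd y hy).differentiableAt (hS.mem_nhds hy)).hasFDerivAt.hasLineDerivAt v
  rw [gradVec_dotProduct]
  refine ((hasDerivAt_iff_tendsto_slope_zero.1 h1).mono_left
    (nhdsWithin_mono _ fun t ht => ne_of_gt ht)).congr fun t => ?_
  simp only [zero_add, zero_smul, add_zero, smul_eq_mul]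
  ring

/-- Strong convexity bounds the Bregman divergence from below. -/
theorem le_bregman (hS : IsOpen S) (hd : DifferentiableOn ℝ ψ S) (hψ : StronglyConvexLp p S lam ψ)
    {x y : Fin d → ℝ} (hx : x ∈ S) (hy : y ∈ S) :
    lam / 2 * ellNorm p (x - y) ^ 2 ≤ bregman ψ x y := by
  have h1 := tendsto_slope_gradVec hS hd hy (x - y)
  have h2 : Tendsto (fun t : ℝ => ψ x - ψ y - (1 - t) * (lam / 2 * ellNorm p (x - y) ^ 2)) (𝓝[>] 0)
      (𝓝 (ψ x - ψ y - (1 - 0) * (lam / 2 * ellNorm p (x - y) ^ 2))) := by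
    have : Continuous fun t : ℝ => ψ x - ψ y - (1 - t) * (lam / 2 * ellNorm p (x - y) ^ 2) := by
      fun_prop
    exact (this.tendsto 0).mono_left nhdsWithin_le_nhds
  have h3 := le_of_tendsto_of_tendsto h1 h2 (by
    filter_upwards [Ioo_mem_nhdsGT (zero_lt_one (α := ℝ))] with t ht
    rw [div_le_iff₀ ht.1]
    have := hψ.le hx hy ht.1.le (sub_nonneg.2 ht.2.le) (by ring)
    have e : t • x + (1 - t) • y = y + t • (x - y) := by
      rw [sub_smul, one_smul, smul_sub]; abel
    rw [e] at this
    linarith)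
  rw [bregman]
  linarith

theorem bregman_nonneg (hS : IsOpen S) (hd : DifferentiableOn ℝ ψ S) (hlam : 0 < lam)
    (hψ : StronglyConvexLp p S lam ψ) {x y : Fin d → ℝ} (hx : x ∈ S) (hy : y ∈ S) :
    0 ≤ bregman ψ x y :=
  le_trans (by positivity) (le_bregman hS hd hψ hx hy)

/-- A strongly convex function is bounded below on a bounded set by a tangent plane at the origin. -/
theorem bddBelow_image (hS : IsOpen S) (hd : DifferentiableOn ℝ ψ S) (hlam : 0 < lam)
    (hψ : StronglyConvexLp p S lam ψ) (h0 : (0 : Fin d → ℝ) ∈ S) {R : ℝ}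
    (hR : ∀ x ∈ S, ellNorm p x ≤ R) : BddBelow (ψ '' S) := by
  have := fact_one_le_conjExponent (p := p)
  refine ⟨ψ 0 - ellNorm (ENNReal.conjExponent p) (gradVec ψ 0) * R, ?_⟩
  rintro _ ⟨x, hx, rfl⟩
  have h1 := bregman_nonneg hS hd hlam hψ hx h0
  rw [bregman, sub_zero] at h1
  have h2 := (abs_le.1 (abs_dotProduct_le (p := p) (gradVec ψ 0) x)).1
  have h3 := mul_le_mul_of_nonneg_left (hR x hx)
    (ellNorm_nonneg (p := ENNReal.conjExponent p) (gradVec ψ 0))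
  linarith

theorem sub_le_oscConst {X : Set (Fin d → ℝ)} (ha : BddAbove (ψ '' interior X))
    (hb : BddBelow (ψ '' interior X)) {x y : Fin d → ℝ} (hx : x ∈ interior X)
    (hy : y ∈ interior X) : ψ x - ψ y ≤ oscConst ψ X :=
  sub_le_sub (le_csSup ha (mem_image_of_mem ψ hx)) (csInf_le hb (mem_image_of_mem ψ hy))

/-- The oscillation of a strongly convex function is at least quadratic in the diameter. -/
theorem sq_le_oscConst {X : Set (Fin d → ℝ)} (hψ : StronglyConvexLp p (interior X) lam ψ)
    (ha : BddAbove (ψ '' interior X)) (hb : BddBelow (ψ '' interior X)) {x y : Fin d → ℝ}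
    (hx : x ∈ interior X) (hy : y ∈ interior X) :
    lam / 8 * ellNorm p (x - y) ^ 2 ≤ oscConst ψ X := by
  have hcv := hψ.1
  have hm : (1 / 2 : ℝ) • x + (1 / 2 : ℝ) • y ∈ interior X :=
    hcv (x := WithLp.toLp p x) hx (y := WithLp.toLp p y) hy (by norm_num) (by norm_num) (by norm_num)
  have h := hψ.le hx hy (a := 1 / 2) (b := 1 / 2) (by norm_num) (by norm_num) (by norm_num)
  have h1 := sub_le_oscConst ha hb hx hm
  have h2 := sub_le_oscConst ha hb hy hm
  linarith

/-! ### The mirror descent step -/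

/-- Rescaling the objective and adding a constant do not change the chosen minimizer. -/
theorem argminOn_congr {h h' : (Fin d → ℝ) → ℝ} {c k : ℝ} (hc : 0 < c)
    (heq : ∀ x, h x = c * h' x + k) : argminOn S h = argminOn S h' := by
  unfold argminOn
  congr 1
  ext x
  simp only [IsMinOn, IsMinFilter, heq, add_le_add_iff_right, mul_le_mul_iff_right₀ hc]

theorem argminOn_spec (hS : IsCompact S) (hne : S.Nonempty) {h : (Fin d → ℝ) → ℝ}
    (hc : ContinuousOn h S) : argminOn S h ∈ S ∧ IsMinOn h S (argminOn S h) := by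
  obtain ⟨x, hx, hmin⟩ := hS.exists_isMinOn hne hc
  exact Classical.epsilon_spec (p := fun x => x ∈ S ∧ IsMinOn h S x) ⟨x, hx, hmin⟩

/-- The minimizer of the sum of `ψ` and the linear function `θ`. -/
noncomputable def linArgmin (S : Set (Fin d → ℝ)) (ψ : (Fin d → ℝ) → ℝ) (θ : Fin d → ℝ) :
    Fin d → ℝ := argminOn S fun x => ψ x + θ ⬝ᵥ x

/-- The mirror descent step is a linear perturbation of the minimization of `ψ`. -/
theorem argminOn_step_eq {η : ℝ} (hη : 0 < η) (g z : Fin d → ℝ) :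
    argminOn S (fun y => g ⬝ᵥ y + 1 / η * bregman ψ y z) = linArgmin S ψ (η • g - gradVec ψ z) := by
  refine argminOn_congr (c := 1 / η) (k := 1 / η * (gradVec ψ z ⬝ᵥ z - ψ z)) (by positivity)
    fun x => ?_
  rw [bregman, sub_dotProduct, smul_dotProduct, dotProduct_sub, smul_eq_mul]
  field_simp
  ring

theorem continuous_dotProduct_left (θ : Fin d → ℝ) : Continuous fun x : Fin d → ℝ => θ ⬝ᵥ x := by
  simp only [dotProduct]; fun_prop

theorem linArgmin_spec (hS : IsCompact S) (hne : S.Nonempty) (hc : ContinuousOn ψ S)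
    (θ : Fin d → ℝ) : linArgmin S ψ θ ∈ S ∧
      ∀ x ∈ S, ψ (linArgmin S ψ θ) + θ ⬝ᵥ linArgmin S ψ θ ≤ ψ x + θ ⬝ᵥ x := by
  have := argminOn_spec hS hne (h := fun x => ψ x + θ ⬝ᵥ x)
    (hc.add (continuous_dotProduct_left θ).continuousOn)
  exact ⟨this.1, fun x hx => this.2 hx⟩

/-- The minimizer of a strongly convex function depends continuously on a linear perturbation. -/
theorem continuous_linArgmin (hlam : 0 < lam) (hS : IsCompact S) (hne : S.Nonempty)
    (hcv : Convex ℝ S) (hc : ContinuousOn ψ S)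
    (hψ : ∀ x ∈ S, ∀ y ∈ S, ψ ((1 / 2 : ℝ) • x + (1 / 2 : ℝ) • y) ≤
      (ψ x + ψ y) / 2 - lam / 8 * ellNorm p (x - y) ^ 2) :
    Continuous (linArgmin S ψ) := by
  have hq := fact_one_le_conjExponent (p := p)
  have hle : ∀ θ θ', ellNorm p (linArgmin S ψ θ - linArgmin S ψ θ') ≤
      2 / lam * ellNorm (ENNReal.conjExponent p) (θ - θ') := by
    intro θ θ'
    obtain ⟨h1, h2⟩ := linArgmin_spec hS hne hc θ
    obtain ⟨h3, h4⟩ := linArgmin_spec hS hne hc θ'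
    set a := linArgmin S ψ θ
    set b := linArgmin S ψ θ'
    have hm : (1 / 2 : ℝ) • a + (1 / 2 : ℝ) • b ∈ S := hcv h1 h3 (by norm_num) (by norm_num) (by norm_num)
    have e1 := h2 _ hm
    have e2 := h4 _ hm
    have e3 := hψ a h1 b h3
    have hθ : ∀ θ : Fin d → ℝ, θ ⬝ᵥ ((1 / 2 : ℝ) • a + (1 / 2 : ℝ) • b) = (θ ⬝ᵥ a + θ ⬝ᵥ b) / 2 := by
      intro θ
      rw [dotProduct_add, dotProduct_smul, dotProduct_smul, smul_eq_mul, smul_eq_mul]; ring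
    rw [hθ] at e1 e2
    have e4 : -((θ - θ') ⬝ᵥ (a - b)) ≤ ellNorm (ENNReal.conjExponent p) (θ - θ') * ellNorm p (a - b) :=
      (neg_le_abs _).trans (abs_dotProduct_le (p := p) (θ - θ') (a - b))
    rw [sub_dotProduct, dotProduct_sub, dotProduct_sub] at e4
    have hN := ellNorm_nonneg (p := p) (a - b)
    have key : lam / 2 * ellNorm p (a - b) ^ 2 ≤
        ellNorm (ENNReal.conjExponent p) (θ - θ') * ellNorm p (a - b) := by linarith
    rcases hN.eq_or_lt with h0 | h0
    · rw [← h0]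
      have := ellNorm_nonneg (p := ENNReal.conjExponent p) (θ - θ')
      positivity
    · have h5 : lam / 2 * ellNorm p (a - b) ≤ ellNorm (ENNReal.conjExponent p) (θ - θ') := by
        refine le_of_mul_le_mul_right ?_ h0
        linarith
      calc ellNorm p (a - b) = 2 / lam * (lam / 2 * ellNorm p (a - b)) := by field_simp
        _ ≤ _ := by gcongr
  refine continuous_pi fun i => ?_
  refine continuous_of_ellNorm_lipschitz (p := ENNReal.conjExponent p) (L := 2 / lam) fun θ θ' => ?_
  exact (abs_apply_le_ellNorm (p := p) (linArgmin S ψ θ - linArgmin S ψ θ') i).trans (hle θ θ')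

/-- The one-step regret bound of mirror descent. -/
theorem mirror_step_le {X : Set (Fin d → ℝ)} (hlam : 0 < lam)
    (hd : DifferentiableOn ℝ ψ (interior X)) (hψ : StronglyConvexLp p (interior X) lam ψ)
    (hS : IsCompact S) (hSX : S ⊆ interior X) (hcv : Convex ℝ S) {η : ℝ} (hη : 0 < η)
    (g : Fin d → ℝ) {z v : Fin d → ℝ} (hz : z ∈ interior X) (hv : v ∈ S) :
    g ⬝ᵥ (z - v) ≤ (bregman ψ v z -
        bregman ψ v (argminOn S fun y => g ⬝ᵥ y + 1 / η * bregman ψ y z)) / η +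
      η / (2 * lam) * ellNorm (ENNReal.conjExponent p) g ^ 2 := by
  have hq := fact_one_le_conjExponent (p := p)
  have hc : ContinuousOn ψ S := hd.continuousOn.mono hSX
  rw [argminOn_step_eq hη]
  obtain ⟨hmem, hmin⟩ := linArgmin_spec hS ⟨v, hv⟩ hc (η • g - gradVec ψ z)
  set y := linArgmin S ψ (η • g - gradVec ψ z)
  -- first-order optimality of the minimizer in the direction of `v`
  have hopt : (gradVec ψ z - η • g) ⬝ᵥ (v - y) ≤ gradVec ψ y ⬝ᵥ (v - y) := by
    refine ge_of_tendsto (tendsto_slope_gradVec isOpen_interior hd (hSX hmem) (v - y)) ?_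
    filter_upwards [Ioo_mem_nhdsGT (zero_lt_one (α := ℝ))] with t ht
    have e : y + t • (v - y) = (1 - t) • y + t • v := by
      rw [sub_smul, one_smul, smul_sub]; abel
    have ht' : y + t • (v - y) ∈ S := by
      rw [e]; exact hcv hmem hv (sub_nonneg.2 ht.2.le) ht.1.le (sub_add_cancel 1 t)
    have h1 := hmin _ ht'
    rw [le_div_iff₀ ht.1]
    rw [dotProduct_add, dotProduct_smul, smul_eq_mul] at h1
    have h2 : (gradVec ψ z - η • g) ⬝ᵥ (v - y) = -((η • g - gradVec ψ z) ⬝ᵥ (v - y)) := by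
      rw [← neg_dotProduct, neg_sub]
    rw [h2]
    linarith
  have hthree : bregman ψ v z - bregman ψ v y - bregman ψ y z =
      gradVec ψ y ⬝ᵥ (v - y) - gradVec ψ z ⬝ᵥ (v - y) := by
    simp only [bregman, dotProduct_sub]; ring
  have hB := le_bregman isOpen_interior hd hψ (hSX hmem) hz
  rw [sub_dotProduct, smul_dotProduct, smul_eq_mul] at hopt
  have hHol := (le_abs_self _).trans (abs_dotProduct_le (p := p) g (z - y))
  have hsplit : g ⬝ᵥ (z - v) = g ⬝ᵥ (z - y) - g ⬝ᵥ (v - y) := by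
    rw [← dotProduct_sub]; congr 1; abel
  rw [ellNorm_sub_comm] at hB
  set a := ellNorm (ENNReal.conjExponent p) g
  set b := ellNorm p (z - y)
  have hyoung : a * b ≤ η / (2 * lam) * a ^ 2 + lam / (2 * η) * b ^ 2 := by
    have h : 0 ≤ (η * a - lam * b) ^ 2 / (2 * lam * η) := by positivity
    have e : (η * a - lam * b) ^ 2 / (2 * lam * η) =
        η / (2 * lam) * a ^ 2 + lam / (2 * η) * b ^ 2 - a * b := by field_simp; ring
    linarith
  have hfin : lam / (2 * η) * b ^ 2 - g ⬝ᵥ (v - y) ≤ (bregman ψ v z - bregman ψ v y) / η := by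
    rw [le_div_iff₀ hη]
    have e : (lam / (2 * η) * b ^ 2 - g ⬝ᵥ (v - y)) * η = lam / 2 * b ^ 2 - η * (g ⬝ᵥ (v - y)) := by
      field_simp
    rw [e]
    linarith
  linarith

end MirrorMap

/-! ### Exponential weights -/

section ExponentialWeights

open Real

/-- This bound holds for all real `x`, so exponential weights need no smallness of the losses. -/
theorem exp_le_add_exp_sq (x : ℝ) : exp x ≤ x + exp (x ^ 2) := by
  have h2 := add_one_le_exp (x ^ 2)
  rcases le_total |x| 1 with h | h
  · have h1 := (abs_le.1 (abs_exp_sub_one_sub_id_le h)).2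
    linarith
  · rcases le_total 0 x with h0 | h0
    · rw [abs_of_nonneg h0] at h
      have : exp x ≤ exp (x ^ 2) := exp_le_exp.2 (by nlinarith)
      linarith
    · rw [abs_of_nonpos h0] at h
      have : exp x ≤ 1 := exp_le_one_iff.2 h0
      nlinarith

variable {N : ℕ} {w φ : ℕ → Fin N → ℝ} {γ : ℝ}

theorem expWeights_pos_and_sum_eq_one (hN : 0 < N)
    (hw : ∀ t k, w (t + 1) k = w t k * exp (-γ * φ t k) / ∑ j, w t j * exp (-γ * φ t j))
    (hpos : ∀ k, 0 < w 0 k) (hsum : ∑ k, w 0 k = 1) (t : ℕ) :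
    (∀ k, 0 < w t k) ∧ ∑ k, w t k = 1 := by
  have hne : (Finset.univ : Finset (Fin N)).Nonempty := ⟨⟨0, hN⟩, Finset.mem_univ _⟩
  induction t with
  | zero => exact ⟨hpos, hsum⟩
  | succ t ih =>
    have hZ : 0 < ∑ j, w t j * exp (-γ * φ t j) :=
      Finset.sum_pos (fun j _ => mul_pos (ih.1 j) (exp_pos _)) hne
    refine ⟨fun k => ?_, ?_⟩
    · rw [hw]; exact div_pos (mul_pos (ih.1 k) (exp_pos _)) hZ
    · simp only [hw]
      rw [← Finset.sum_div, div_self hZ.ne']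

/-- The regret bound of exponential weights for losses whose weighted means vanish. Vanishing means
make the second-order term of the normalizing sums the only one. -/
theorem expWeights_regret_le (hN : 0 < N) (hγ : 0 < γ)
    (hw : ∀ t k, w (t + 1) k = w t k * exp (-γ * φ t k) / ∑ j, w t j * exp (-γ * φ t j))
    (hpos : ∀ k, 0 < w 0 k) (hsum : ∑ k, w 0 k = 1) (hφ : ∀ t, ∑ k, w t k * φ t k = 0)
    {b : ℕ → ℝ} (hb : ∀ t k, |φ t k| ≤ b t) (T : ℕ) (k : Fin N) :
    ∑ t ∈ Finset.range T, -φ t k ≤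
      log (1 / w 0 k) / γ + γ * ∑ t ∈ Finset.range T, b t ^ 2 := by
  have inv := expWeights_pos_and_sum_eq_one hN hw hpos hsum
  have hne : (Finset.univ : Finset (Fin N)).Nonempty := ⟨⟨0, hN⟩, Finset.mem_univ _⟩
  have hZ : ∀ t, 0 < ∑ j, w t j * exp (-γ * φ t j) := fun t =>
    Finset.sum_pos (fun j _ => mul_pos ((inv t).1 j) (exp_pos _)) hne
  have hZle : ∀ t, log (∑ j, w t j * exp (-γ * φ t j)) ≤ γ ^ 2 * b t ^ 2 := by
    intro t
    rw [log_le_iff_le_exp (hZ t)]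
    calc ∑ j, w t j * exp (-γ * φ t j)
        ≤ ∑ j, (-γ * (w t j * φ t j) + w t j * exp (γ ^ 2 * b t ^ 2)) := by
          refine Finset.sum_le_sum fun j _ => ?_
          have h1 := exp_le_add_exp_sq (-γ * φ t j)
          have h2 : exp ((-γ * φ t j) ^ 2) ≤ exp (γ ^ 2 * b t ^ 2) := by
            refine exp_le_exp.2 ?_
            rw [neg_mul, neg_sq, mul_pow, ← sq_abs (φ t j)]
            have := hb t j
            gcongr
          calc w t j * exp (-γ * φ t j) ≤ w t j * (-γ * φ t j + exp (γ ^ 2 * b t ^ 2)) :=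
                mul_le_mul_of_nonneg_left (by linarith) ((inv t).1 j).le
            _ = _ := by ring
      _ = exp (γ ^ 2 * b t ^ 2) := by
          rw [Finset.sum_add_distrib, ← Finset.mul_sum, ← Finset.sum_mul, hφ, (inv t).2]; ring
  -- the weights of learner `k` telescope, and they stay below one
  have hlog : ∀ n, -γ * ∑ t ∈ Finset.range n, φ t k - γ ^ 2 * ∑ t ∈ Finset.range n, b t ^ 2 ≤
      log (w n k) - log (w 0 k) := by
    intro n
    induction n with
    | zero => simp
    | succ n ih =>
      have e : log (w (n + 1) k) =
          log (w n k) - γ * φ n k - log (∑ j, w n j * exp (-γ * φ n j)) := by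
        rw [hw, log_div (mul_pos ((inv n).1 k) (exp_pos _)).ne' (hZ n).ne',
          log_mul ((inv n).1 k).ne' (exp_pos _).ne', log_exp]
        ring
      rw [Finset.sum_range_succ, Finset.sum_range_succ, e]
      have := hZle n
      linarith
  have hle : log (w T k) ≤ 0 := by
    refine log_nonpos ((inv T).1 k).le ?_
    rw [← (inv T).2]
    exact Finset.single_le_sum (fun j _ => ((inv T).1 j).le) (Finset.mem_univ k)
  have h := hlog T
  rw [one_div, log_inv, Finset.sum_neg_distrib]
  have h1 : γ * -∑ t ∈ Finset.range T, φ t k ≤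
      γ * (-log (w 0 k) / γ + γ * ∑ t ∈ Finset.range T, b t ^ 2) := by
    rw [mul_add, mul_div_cancel₀ _ hγ.ne']
    linarith
  exact le_of_mul_le_mul_left h1 hγ

end ExponentialWeights

/-! ### Dynamic regret of mirror descent -/

section Mirror

variable {d : ℕ} {p : ℝ≥0∞} [Fact (1 ≤ p)] {lam : ℝ} {ψ : (Fin d → ℝ) → ℝ} {S : Set (Fin d → ℝ)}

theorem bregman_sub_bregman_le {Gψ : ℝ} {z : Fin d → ℝ}
    (hz : ellNorm (ENNReal.conjExponent p) (gradVec ψ z) ≤ Gψ) (v v' : Fin d → ℝ) :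
    bregman ψ v' z - bregman ψ v z ≤ ψ v' - ψ v + Gψ * ellNorm p (v' - v) := by
  have h1 := (abs_le.1 (abs_dotProduct_le (p := p) (gradVec ψ z) (v' - v))).1
  have h2 := mul_le_mul_of_nonneg_right hz (ellNorm_nonneg (p := p) (v' - v))
  have e : bregman ψ v' z - bregman ψ v z = ψ v' - ψ v - gradVec ψ z ⬝ᵥ (v' - v) := by
    simp only [bregman, dotProduct_sub]; ring
  linarith

/-- The dynamic regret bound of mirror descent. Moving the comparator changes the Bregman divergence
to the current iterate by a telescoping difference of values of `ψ` and by a term that is controlled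
by the gradient of `ψ` at the iterate. -/
theorem mirror_dynamic_regret_le {X : Set (Fin d → ℝ)} (hlam : 0 < lam)
    (hd : DifferentiableOn ℝ ψ (interior X)) (hψ : StronglyConvexLp p (interior X) lam ψ)
    (ha : BddAbove (ψ '' interior X)) (hb : BddBelow (ψ '' interior X))
    (hS : IsCompact S) (hSX : S ⊆ interior X) (hcv : Convex ℝ S) {η : ℝ} (hη : 0 < η)
    {g z v : ℕ → Fin d → ℝ} {Gψ : ℝ} (T : ℕ) (hz : ∀ t, z t ∈ S)
    (hstep : ∀ t, z (t + 1) = argminOn S fun y => g t ⬝ᵥ y + 1 / η * bregman ψ y (z t))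
    (hv : ∀ t ≤ T, v t ∈ S)
    (hG : ∀ t ≤ T, ellNorm (ENNReal.conjExponent p) (gradVec ψ (z t)) ≤ Gψ) :
    ∑ t ∈ Finset.range (T + 1), g t ⬝ᵥ (z t - v t) ≤
      (oscConst ψ X + bregman ψ (v 0) (z 0) + Gψ * pathVariation p T v) / η +
      η / (2 * lam) * ∑ t ∈ Finset.range (T + 1),
        ellNorm (ENNReal.conjExponent p) (g t) ^ 2 := by
  have htel : ∀ n ≤ T, ∑ t ∈ Finset.range (n + 1), (bregman ψ (v t) (z t) -
      bregman ψ (v t) (z (t + 1))) ≤ bregman ψ (v 0) (z 0) + (ψ (v n) - ψ (v 0)) +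
        Gψ * pathVariation p n v - bregman ψ (v n) (z (n + 1)) := by
    intro n
    induction n with
    | zero => intro _; simp [pathVariation]
    | succ n ih =>
      intro hn
      have h1 := ih (by omega)
      have h2 := bregman_sub_bregman_le (hG (n + 1) hn) (v n) (v (n + 1))
      rw [Finset.sum_range_succ]
      have e : pathVariation p (n + 1) v = pathVariation p n v + ellNorm p (v (n + 1) - v n) :=
        Finset.sum_range_succ _ _
      rw [e]
      linarith
  have h1 := htel T le_rfl
  have h2 := bregman_nonneg isOpen_interior hd hlam hψ (hSX (hv T le_rfl)) (hSX (hz (T + 1)))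
  have h3 := sub_le_oscConst ha hb (hSX (hv T le_rfl)) (hSX (hv 0 (Nat.zero_le _)))
  calc ∑ t ∈ Finset.range (T + 1), g t ⬝ᵥ (z t - v t)
      ≤ ∑ t ∈ Finset.range (T + 1), ((bregman ψ (v t) (z t) - bregman ψ (v t) (z (t + 1))) / η +
          η / (2 * lam) * ellNorm (ENNReal.conjExponent p) (g t) ^ 2) := by
        refine Finset.sum_le_sum fun t ht => ?_
        rw [hstep]
        exact mirror_step_le hlam hd hψ hS hSX hcv hη (g t) (hSX (hz t))
          (hv t (by have := Finset.mem_range.1 ht; omega))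
    _ = (∑ t ∈ Finset.range (T + 1), (bregman ψ (v t) (z t) - bregman ψ (v t) (z (t + 1)))) / η +
          η / (2 * lam) * ∑ t ∈ Finset.range (T + 1),
            ellNorm (ENNReal.conjExponent p) (g t) ^ 2 := by
        rw [Finset.sum_add_distrib, Finset.sum_div, Finset.mul_sum]
    _ ≤ _ := by
        gcongr
        linarith

end Mirror

/-! ### Pathwise regret of parameter-free bandit mirror descent -/

namespace PBMD

section Pathwise

variable {d N : ℕ} {p : ℝ≥0∞} [Fact (1 ≤ p)]

theorem init_w_pos (hN : 0 < N) (I : Input d N) (k : Fin N) : 0 < (init I).w k := by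
  have : (0 : ℝ) < N := Nat.cast_pos.2 hN
  simp only [init]; positivity

theorem init_w_sum (hN : 0 < N) (I : Input d N) : ∑ k, (init I).w k = 1 := by
  have hN' : (0 : ℝ) < N := Nat.cast_pos.2 hN
  have h : ∀ n : ℕ, ∑ k ∈ Finset.range n, (1 / (((k : ℝ) + 1) * ((k : ℝ) + 2))) = n / (n + 1) := by
    intro n
    induction n with
    | zero => simp
    | succ n ih => rw [Finset.sum_range_succ, ih]; push_cast; field_simp; ring
  simp only [init]
  rw [← Finset.mul_sum, Fin.sum_univ_eq_sum_range
    (fun k => 1 / (((k : ℝ) + 1) * ((k : ℝ) + 2))) N, h]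
  field_simp

/-- The weights are positive and sum to one. -/
theorem state_w (hN : 0 < N) (I : Input d N) (f : ℕ → (Fin d → ℝ) → ℝ) (s : ℕ → Fin d → ℝ)
    (t : ℕ) : (∀ k, 0 < (state I f s t).w k) ∧ ∑ k, (state I f s t).w k = 1 :=
  expWeights_pos_and_sum_eq_one (w := fun t => (state I f s t).w)
    (φ := fun t k => estimator I.μ (f t) (state I f s t).combined (s t) ⬝ᵥ
      ((state I f s t).y k - (state I f s t).combined))
    hN (fun _ _ => rfl) (init_w_pos hN I) (init_w_sum hN I) t

theorem state_y_mem {I : Input d N} (hη : ∀ k, 0 < I.η k) (hS : IsCompact (shrunk I.X I.α))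
    (hc : ContinuousOn I.ψ (shrunk I.X I.α)) (hy : I.y₁ ∈ shrunk I.X I.α)
    (f : ℕ → (Fin d → ℝ) → ℝ) (s : ℕ → Fin d → ℝ) (t : ℕ) (k : Fin N) :
    (state I f s t).y k ∈ shrunk I.X I.α := by
  cases t with
  | zero => exact hy
  | succ t =>
    simp only [state, step]
    rw [argminOn_step_eq (hη k)]
    exact (linArgmin_spec hS ⟨_, hy⟩ hc _).1

theorem combined_mem (hN : 0 < N) {I : Input d N} (hη : ∀ k, 0 < I.η k)
    (hS : IsCompact (shrunk I.X I.α)) (hcv : Convex ℝ (shrunk I.X I.α))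
    (hc : ContinuousOn I.ψ (shrunk I.X I.α)) (hy : I.y₁ ∈ shrunk I.X I.α)
    (f : ℕ → (Fin d → ℝ) → ℝ) (s : ℕ → Fin d → ℝ) (t : ℕ) :
    (state I f s t).combined ∈ shrunk I.X I.α :=
  hcv.sum_mem (fun k _ => ((state_w hN I f s t).1 k).le) (state_w hN I f s t).2
    fun k _ => state_y_mem hη hS hc hy f s t k

/-- The regret of the estimated linear losses against moving comparators, for each base learner: the
regret of the weights against the learner plus the dynamic regret of the learner. -/
theorem linear_regret_le (hN : 0 < N) {I : Input d N} {lam R Gψ : ℝ} (hlam : 0 < lam)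
    (hd : DifferentiableOn ℝ I.ψ (interior I.X)) (hψ : StronglyConvexLp p (interior I.X) lam I.ψ)
    (ha : BddAbove (I.ψ '' interior I.X)) (hb : BddBelow (I.ψ '' interior I.X))
    (hS : IsCompact (shrunk I.X I.α)) (hSX : shrunk I.X I.α ⊆ interior I.X)
    (hcv : Convex ℝ (shrunk I.X I.α)) (hR : ∀ x ∈ shrunk I.X I.α, ellNorm p x ≤ R)
    (hη : ∀ k, 0 < I.η k) (hγ : 0 < I.γ) (hy : I.y₁ ∈ shrunk I.X I.α)
    (f : ℕ → (Fin d → ℝ) → ℝ) (s : ℕ → Fin d → ℝ) (T : ℕ) {v : ℕ → Fin d → ℝ}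
    (hv : ∀ t ≤ T, v t ∈ shrunk I.X I.α) (k : Fin N)
    (hG : ∀ t ≤ T, ellNorm (ENNReal.conjExponent p) (gradVec I.ψ ((state I f s t).y k)) ≤ Gψ) :
    ∑ t ∈ Finset.range (T + 1), estimator I.μ (f t) (state I f s t).combined (s t) ⬝ᵥ
        ((state I f s t).combined - v t) ≤
      Real.log (1 / (init I).w k) / I.γ +
      (oscConst I.ψ I.X + bregman I.ψ (v 0) I.y₁ + Gψ * pathVariation p T v) / I.η k +
      (4 * I.γ * R ^ 2 + I.η k / (2 * lam)) * ∑ t ∈ Finset.range (T + 1),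
        ellNorm (ENNReal.conjExponent p)
          (estimator I.μ (f t) (state I f s t).combined (s t)) ^ 2 := by
  have hq := fact_one_le_conjExponent (p := p)
  have hc : ContinuousOn I.ψ (shrunk I.X I.α) := hd.continuousOn.mono hSX
  set g : ℕ → Fin d → ℝ := fun t => estimator I.μ (f t) (state I f s t).combined (s t)
  have h1 := mirror_dynamic_regret_le (S := shrunk I.X I.α) (g := g)
    (z := fun t => (state I f s t).y k) (v := v) hlam hd hψ ha hb hS hSX hcv
    (hη k) T (fun t => state_y_mem hη hS hc hy f s t k) (fun _ => rfl) hv hG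
  have h2 := expWeights_regret_le (w := fun t => (state I f s t).w)
    (φ := fun t k => g t ⬝ᵥ ((state I f s t).y k - (state I f s t).combined))
    (b := fun t => 2 * R * ellNorm (ENNReal.conjExponent p) (g t))
    hN hγ (fun _ _ => rfl) (init_w_pos hN I) (init_w_sum hN I) (fun t => ?_) (fun t j => ?_)
    (T + 1) k
  · have e : ∑ t ∈ Finset.range (T + 1), g t ⬝ᵥ ((state I f s t).combined - v t) =
        ∑ t ∈ Finset.range (T + 1), -(g t ⬝ᵥ ((state I f s t).y k - (state I f s t).combined)) +
          ∑ t ∈ Finset.range (T + 1), g t ⬝ᵥ ((state I f s t).y k - v t) := by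
      rw [← Finset.sum_add_distrib]
      refine Finset.sum_congr rfl fun t _ => ?_
      simp only [dotProduct_sub]; ring
    have e2 : ∑ t ∈ Finset.range (T + 1), (2 * R * ellNorm (ENNReal.conjExponent p) (g t)) ^ 2 =
        4 * R ^ 2 * ∑ t ∈ Finset.range (T + 1), ellNorm (ENNReal.conjExponent p) (g t) ^ 2 := by
      rw [Finset.mul_sum]
      exact Finset.sum_congr rfl fun t _ => by ring
    beta_reduce at h2
    rw [e2] at h2
    change _ ≤ (oscConst I.ψ I.X + bregman I.ψ (v 0) I.y₁ + Gψ * pathVariation p T v) / I.η k + _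
      at h1
    change _ ≤ Real.log (1 / (init I).w k) / I.γ + _ at h2
    refine e.trans_le ?_
    rw [add_mul]
    linarith
  · have := (state_w hN I f s t).2
    calc ∑ k, (state I f s t).w k * (g t ⬝ᵥ ((state I f s t).y k - (state I f s t).combined))
        = g t ⬝ᵥ ∑ k, (state I f s t).w k • (state I f s t).y k -
          (∑ k, (state I f s t).w k) * (g t ⬝ᵥ (state I f s t).combined) := by
          rw [dotProduct_sum, Finset.sum_mul, ← Finset.sum_sub_distrib]
          refine Finset.sum_congr rfl fun k _ => ?_
          rw [dotProduct_sub, dotProduct_smul, smul_eq_mul]; ring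
      _ = 0 := by rw [this, one_mul]; exact sub_self _
  · refine (abs_dotProduct_le (p := p) _ _).trans ?_
    have h1 := hR _ (state_y_mem hη hS hc hy f s t j)
    have h2 := hR _ (combined_mem hN hη hS hcv hc hy f s t)
    have h3 := ellNorm_sub_le (p := p) ((state I f s t).y j) (state I f s t).combined
    rw [mul_comm]
    exact mul_le_mul_of_nonneg_right (by linarith) (ellNorm_nonneg _)

end Pathwise

end PBMD

/-! ### Measurability of the algorithm and independence of the samples -/

/-- Freezing an independent variable: a bound on all the means over the second variable carries over
to the mean over both. -/
theorem integrable_and_integral_le_of_indepFun {Ω E F : Type*} [MeasurableSpace Ω]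
    [MeasurableSpace E] [MeasurableSpace F] {P : Measure Ω} [IsProbabilityMeasure P]
    {Y : Ω → E} {Z : Ω → F} {ν : Measure F} [IsProbabilityMeasure ν] (hY : AEMeasurable Y P)
    (hZ : HasLaw Z ν P) (hind : IndepFun Y Z P) {S : Set E} (hYS : ∀ ω, Y ω ∈ S)
    {A : Set F} (hA : ∀ᵐ z ∂ν, z ∈ A) {φ : E × F → ℝ} (hφ : Measurable φ) {C c : ℝ}
    (hC : ∀ y ∈ S, ∀ z ∈ A, |φ (y, z)| ≤ C) (hc : ∀ y ∈ S, ∫ z, φ (y, z) ∂ν ≤ c) :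
    Integrable (fun ω => φ (Y ω, Z ω)) P ∧ ∫ ω, φ (Y ω, Z ω) ∂P ≤ c := by
  have hYZ : AEMeasurable (fun ω => (Y ω, Z ω)) P := hY.prodMk hZ.aemeasurable
  have hmap : P.map (fun ω => (Y ω, Z ω)) = (P.map Y).prod ν := by
    rw [(indepFun_iff_map_prod_eq_prod_map_map hY hZ.aemeasurable).1 hind, hZ.map_eq]
  have hpY : IsProbabilityMeasure (P.map Y) := Measure.isProbabilityMeasure_map hY
  have hZA : ∀ᵐ ω ∂P, Z ω ∈ A := by
    have : ∀ᵐ z ∂(P.map Z), z ∈ A := by rwa [hZ.map_eq]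
    exact ae_of_ae_map hZ.aemeasurable this
  have hint : Integrable (fun ω => φ (Y ω, Z ω)) P := by
    refine Integrable.of_bound (hφ.comp_aemeasurable hYZ).aestronglyMeasurable C ?_
    filter_upwards [hZA] with ω hω
    exact hC _ (hYS ω) _ hω
  have hint2 : Integrable φ ((P.map Y).prod ν) := by
    rw [← hmap]
    exact (integrable_map_measure hφ.aestronglyMeasurable hYZ).2 hint
  refine ⟨hint, ?_⟩
  rw [← integral_map (f := φ) hYZ hφ.aestronglyMeasurable, hmap, integral_prod _ hint2,
    integral_map hY (hφ.stronglyMeasurable.integral_prod_right').aestronglyMeasurable]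
  have hi : Integrable (fun ω => ∫ z, φ (Y ω, z) ∂ν) P :=
    (integrable_map_measure (hφ.stronglyMeasurable.integral_prod_right').aestronglyMeasurable hY).1
      hint2.integral_prod_left
  calc ∫ ω, ∫ z, φ (Y ω, z) ∂ν ∂P ≤ ∫ _, c ∂P :=
        integral_mono hi (integrable_const c) fun ω => hc _ (hYS ω)
    _ = c := by simp

namespace PBMD

section Measurability

variable {d N : ℕ}

theorem measurable_estimator {μ : ℝ} {f : (Fin d → ℝ) → ℝ} (hf : Continuous f) :
    Measurable fun z : (Fin d → ℝ) × (Fin d → ℝ) => estimator μ f z.1 z.2 := by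
  unfold estimator
  have h1 : Continuous fun z : (Fin d → ℝ) × (Fin d → ℝ) => f (z.1 + μ • z.2) - f (z.1 - μ • z.2) := by
    fun_prop
  exact (h1.measurable.const_mul _).smul (measurable_signVec.comp measurable_snd)

/-- The state at the beginning of round `t` depends only on the samples of the earlier rounds. -/
theorem state_congr (I : Input d N) (f : ℕ → (Fin d → ℝ) → ℝ) {s s' : ℕ → Fin d → ℝ} {t : ℕ}
    (h : ∀ i < t, s i = s' i) : state I f s t = state I f s' t := by
  induction t with
  | zero => rfl
  | succ t ih =>
    rw [state, state, ih fun i hi => h i (by omega), h t (by omega)]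

theorem measurable_combined {Ω : Type*} [MeasurableSpace Ω] {S : Ω → State d N}
    (hw : ∀ k, Measurable fun ω => (S ω).w k) (hy : ∀ k, Measurable fun ω => (S ω).y k) :
    Measurable fun ω => (S ω).combined := by
  unfold State.combined
  exact Finset.measurable_sum _ fun k _ => (hw k).smul (hy k)

theorem measurable_dotProduct {Ω : Type*} [MeasurableSpace Ω] {a b : Ω → Fin d → ℝ}
    (ha : Measurable a) (hb : Measurable b) : Measurable fun ω => a ω ⬝ᵥ b ω := by
  simp only [dotProduct]
  exact Finset.measurable_sum _ fun i _ =>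
    ((measurable_pi_apply i).comp ha).mul ((measurable_pi_apply i).comp hb)

theorem measurable_state {I : Input d N} (hη : ∀ k, 0 < I.η k)
    (hA : Measurable (linArgmin (shrunk I.X I.α) I.ψ)) {f : ℕ → (Fin d → ℝ) → ℝ}
    {Ω : Type*} [MeasurableSpace Ω] {x : ℕ → Ω → Fin d → ℝ} (hx : ∀ i, Measurable (x i)) {t : ℕ}
    (hf : ∀ i < t, Continuous (f i)) :
    (∀ k, Measurable fun ω => (state I f (fun i => x i ω) t).w k) ∧
      ∀ k, Measurable fun ω => (state I f (fun i => x i ω) t).y k := by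
  induction t with
  | zero => exact ⟨fun _ => measurable_const, fun _ => measurable_const⟩
  | succ t ih =>
    obtain ⟨hw, hy⟩ := ih fun i hi => hf i (by omega)
    have hcomb := measurable_combined hw hy
    have hg : Measurable fun ω =>
        estimator I.μ (f t) (state I f (fun i => x i ω) t).combined (x t ω) :=
      (measurable_estimator (hf t (by omega))).comp (hcomb.prodMk (hx t))
    have hφ : ∀ k, Measurable fun ω => (state I f (fun i => x i ω) t).w k * Real.exp (-I.γ *
        (estimator I.μ (f t) (state I f (fun i => x i ω) t).combined (x t ω) ⬝ᵥ
          ((state I f (fun i => x i ω) t).y k - (state I f (fun i => x i ω) t).combined))) :=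
      fun k => (hw k).mul (Real.measurable_exp.comp
        ((measurable_dotProduct hg ((hy k).sub hcomb)).const_mul _))
    refine ⟨fun k => ?_, fun k => ?_⟩
    · simp only [state, step]
      exact (hφ k).div (Finset.measurable_sum _ fun j _ => hφ j)
    · simp only [state, step, argminOn_step_eq (hη k)]
      exact hA.comp ((hg.const_smul (I.η k)).sub ((measurable_gradVec I.ψ).comp (hy k)))

/-- The combined decision of a round depends only on the samples of the earlier rounds, hence it is
independent of the current sample. -/
theorem aemeasurable_combined_and_indepFun {I : Input d N} (hη : ∀ k, 0 < I.η k)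
    (hA : Measurable (linArgmin (shrunk I.X I.α) I.ψ)) {f : ℕ → (Fin d → ℝ) → ℝ}
    {Ω : Type*} [MeasurableSpace Ω] {P : Measure Ω} {s : ℕ → Ω → Fin d → ℝ} {T : ℕ}
    (hs : ∀ t < T, AEMeasurable (s t) P) (hind : iIndepFun (fun t : Fin T => s t) P)
    {t : ℕ} (ht : t < T) (hf : ∀ i < t, Continuous (f i)) :
    AEMeasurable (fun ω => (state I f (fun i => s i ω) t).combined) P ∧
      IndepFun (fun ω => (state I f (fun i => s i ω) t).combined) (s t) P := by
  set A : Finset (Fin T) := Finset.univ.filter fun i => (i : ℕ) < t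
  have hAmem : ∀ i (hi : i < t), (⟨i, hi.trans ht⟩ : Fin T) ∈ A := fun i hi => by simp [A, hi]
  have hi := hind.indepFun_finset₀ A {⟨t, ht⟩} (by simp [A]) fun i => hs i i.2
  -- the samples of the earlier rounds, extended by zero
  let ext : ℕ → (A → Fin d → ℝ) → Fin d → ℝ := fun i x =>
    if h : i < t then x ⟨⟨i, h.trans ht⟩, hAmem i h⟩ else 0
  have hext : ∀ i, Measurable (ext i) := by
    intro i
    by_cases h : i < t
    · simp only [ext, h, dite_true]
      exact measurable_pi_apply _
    · simp only [ext, h, dite_false]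
      exact measurable_const
  obtain ⟨hw, hy⟩ := measurable_state hη hA hext hf
  have hcomb := measurable_combined hw hy
  have e : (fun ω => (state I f (fun i => s i ω) t).combined) =
      (fun x => (state I f (fun i => ext i x) t).combined) ∘ fun ω (i : A) => s i ω := by
    funext ω
    simp only [Function.comp]
    rw [state_congr I f (s := fun i => s i ω) fun i hi => ?_]
    simp only [ext, hi, dite_true]
  rw [e]
  refine ⟨hcomb.comp_aemeasurable (aemeasurable_pi_lambda _ fun i => hs i i.1.2), ?_⟩
  exact hi.comp hcomb (measurable_pi_apply (⟨⟨t, ht⟩, Finset.mem_singleton_self _⟩ :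
    ({⟨t, ht⟩} : Finset (Fin T))))

end Measurability

end PBMD

/-! ### Expected regret of parameter-free bandit mirror descent -/

namespace PBMD

section Expectation

variable {d N : ℕ} {p q : ℝ≥0∞} [Fact (1 ≤ p)] [Fact (1 ≤ q)]

/-- The radius of the exploration is small enough for the shrunk set to keep the queries feasible. -/
theorem add_smul_mem (hd : 0 < d) {X : Set (Fin d → ℝ)} {r α μ : ℝ} (hX : IsClosed X)
    (hcv : Convex ℝ X) (hr : 0 < r) (hsub : ellBall d p r ⊆ X) (hα : 0 < α) (hα1 : α < 1)
    (hμ0 : 0 < μ) (hμ : μ * (d : ℝ) ^ (1 - recip p) = α * r) {y : Fin d → ℝ} (hy : y ∈ shrunk X α)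
    {b : Fin d → ℝ} (hb : ellNorm 1 b ≤ 1) : y + μ • b ∈ X := by
  refine add_mem_of_mem_shrunk hX hcv hsub hr hα hα1 hy ?_
  have h1 : (1 : ℝ) ≤ (d : ℝ) ^ (1 - recip p) :=
    Real.one_le_rpow (by exact_mod_cast hd) (sub_nonneg.2 recip_le_one)
  calc ellNorm p (μ • b) = μ * ellNorm p b := by rw [ellNorm_smul, abs_of_pos hμ0]
    _ ≤ μ * 1 := by
        gcongr
        exact (ellNorm_anti (p := 1) Fact.out b).trans hb
    _ ≤ μ * (d : ℝ) ^ (1 - recip p) := by gcongr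
    _ = α * r := hμ

/-- The expected regret in terms of any one of the base learners. The comparators are shrunk by
`1 - α`, and `e` bounds the cost of this. -/
theorem expected_regret_le {T : ℕ} (hd : 3 ≤ d) {r R G lam Gψ e : ℝ} {I : Input d N}
    {f : ℕ → (Fin d → ℝ) → ℝ} {u : ℕ → Fin d → ℝ} {Ω : Type*} [MeasurableSpace Ω]
    {P : Measure Ω} [IsProbabilityMeasure P] {s : ℕ → Ω → Fin d → ℝ} (hN : 0 < N)
    (hX : IsCompact I.X) (hcv : Convex ℝ I.X) (hr : 0 < r) (hsub : ellBall d p r ⊆ I.X)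
    (hRsub : I.X ⊆ ellBall d p R) (hG : 0 < G) (hfc : ∀ t ≤ T, ConvexOn ℝ Set.univ (f t))
    (hf : ∀ t ≤ T, ∀ x ∈ I.X, ∀ y ∈ I.X, |f t x - f t y| ≤ G * ellNorm q (x - y))
    (hlam : 0 < lam) (hdiff : DifferentiableOn ℝ I.ψ (interior I.X))
    (hψ : StronglyConvexLp p (interior I.X) lam I.ψ) (ha : BddAbove (I.ψ '' interior I.X))
    (hu : ∀ t ≤ T, u t ∈ I.X) (hs : ∀ t ≤ T, HasLaw (s t) (unifL1Sphere d) P)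
    (hind : iIndepFun (fun t : Fin (T + 1) => s t) P) (hα : 0 < I.α) (hα1 : I.α < 1)
    (hμ : I.μ * (d : ℝ) ^ (1 - recip p) = I.α * r) (hy : I.y₁ ∈ shrunk I.X I.α)
    (hγ : 0 < I.γ) (hη : ∀ k, 0 < I.η k) (hGψ0 : 0 ≤ Gψ) (k : Fin N)
    (hGψ : ∀ᵐ ω ∂P, ∀ t ≤ T, ellNorm (ENNReal.conjExponent p)
      (gradVec I.ψ ((state I f (fun i => s i ω) t).y k)) ≤ Gψ)
    (he : ∀ t ≤ T, I.α * ellNorm q (u t) ≤ e) :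
    Integrable (fun ω => regret I f u (fun i => s i ω) (T + 1)) P ∧
    ∫ ω, regret I f u (fun i => s i ω) (T + 1) ∂P ≤ Real.log (1 / (init I).w k) / I.γ +
      (oscConst I.ψ I.X + bregman I.ψ ((1 - I.α) • u 0) I.y₁ + Gψ * pathVariation p T u) / I.η k +
      (4 * I.γ * R ^ 2 + I.η k / (2 * lam)) * ((T + 1) * (224 * G ^ 2 * xiConst p q d)) +
      (T + 1) * (3 * G * I.μ + G * e) := by
  have hd0 : 0 < d := by omega
  have hd' : (0 : ℝ) < d := by exact_mod_cast hd0
  have hpd : 0 < (d : ℝ) ^ (1 - recip p) := Real.rpow_pos_of_pos hd' _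
  have hq := fact_one_le_conjExponent (p := p)
  have hprob := isProbabilityMeasure_unifL1Sphere hd0
  have hμ0 : 0 < I.μ := by
    refine pos_of_mul_pos_left (b := (d : ℝ) ^ (1 - recip p)) ?_ hpd.le
    rw [hμ]; positivity
  have h0 := zero_mem_of_ellBall_subset hr hsub
  have hSX := shrunk_subset_interior (p := p) hX.isClosed hcv hsub hr hα hα1
  have hS : IsCompact (shrunk I.X I.α) := isCompact_shrunk hX
  have hScv : Convex ℝ (shrunk I.X I.α) := convex_shrunk hcv
  have hR : ∀ x ∈ I.X, ellNorm p x ≤ R := fun x hx => le_of_lt (hRsub hx)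
  have hRS : ∀ x ∈ shrunk I.X I.α, ellNorm p x ≤ R := fun x hx => hR x (interior_subset (hSX hx))
  have hc : ContinuousOn I.ψ (shrunk I.X I.α) := hdiff.continuousOn.mono hSX
  have h0i : (0 : Fin d → ℝ) ∈ interior I.X := hSX ⟨0, h0, smul_zero _⟩
  have hb : BddBelow (I.ψ '' interior I.X) :=
    bddBelow_image isOpen_interior hdiff hlam hψ h0i fun x hx => hR x (interior_subset hx)
  have hA : Measurable (linArgmin (shrunk I.X I.α) I.ψ) := by
    refine (continuous_linArgmin (p := p) hlam hS ⟨_, hy⟩ hScv hc fun x hx y hy => ?_).measurable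
    have := hψ.le (hSX hx) (hSX hy) (a := 1 / 2) (b := 1 / 2) (by norm_num) (by norm_num)
      (by norm_num)
    linarith
  have hfcont : ∀ t ≤ T, Continuous (f t) := fun t ht => by
    have := (hfc t ht).continuousOn_interior
    rwa [interior_univ, continuousOn_univ] at this
  have hball : ∀ y ∈ shrunk I.X I.α, ∀ b, ellNorm 1 b ≤ 1 → y + I.μ • b ∈ I.X := fun y hy b hb =>
    add_smul_mem (p := p) hd0 hX.isClosed hcv hr hsub hα hα1 hμ0 hμ hy hb
  have hball' : ∀ y ∈ shrunk I.X I.α, ∀ b, ellNorm 1 b ≤ 1 → y - I.μ • b ∈ I.X := fun y hy b hb => by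
    rw [sub_eq_add_neg, ← smul_neg]
    exact hball y hy _ (by rwa [ellNorm_neg])
  have hymem : ∀ t ω, (state I f (fun i => s i ω) t).combined ∈ shrunk I.X I.α := fun t ω =>
    combined_mem hN hη hS hScv hc hy f _ t
  have hvmem : ∀ t ≤ T, (1 - I.α) • u t ∈ shrunk I.X I.α := fun t ht => smul_mem_shrunk (hu t ht)
  have hae : ∀ᵐ b ∂(unifL1Sphere d), b ∈ {b : Fin d → ℝ | ellNorm 1 b = 1} :=
    ae_ellNorm_unifL1Sphere hd0
  have hYs : ∀ t ≤ T, AEMeasurable (fun ω => (state I f (fun i => s i ω) t).combined) P ∧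
      IndepFun (fun ω => (state I f (fun i => s i ω) t).combined) (s t) P := fun t ht =>
    aemeasurable_combined_and_indepFun hη hA (fun i hi => (hs i (by omega)).aemeasurable) hind
      (by omega) fun i hi => hfcont i (by omega)
  have hM : ∀ t ≤ T, ∃ M, ∀ x ∈ I.X, |f t x| ≤ M := fun t ht =>
    hX.exists_bound_of_continuousOn (hfcont t ht).continuousOn
  have hdiffM : ∀ t M, (∀ x ∈ I.X, |f t x| ≤ M) → ∀ x ∈ I.X, ∀ y ∈ I.X, |f t x - f t y| ≤ 2 * M :=
    fun t M hM x hx y hy => by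
      have h1 := hM x hx
      have h2 := hM y hy
      have h3 := abs_sub (f t x) (f t y)
      linarith
  have hest : ∀ t M, (∀ x ∈ I.X, |f t x| ≤ M) → ∀ y ∈ shrunk I.X I.α, ∀ b : Fin d → ℝ,
      ellNorm 1 b = 1 → ellNorm (ENNReal.conjExponent p) (estimator I.μ (f t) y b) ≤
        d / (2 * I.μ) * (2 * M) * (d : ℝ) ^ (1 - recip p) := fun t M hM y hy b hb => by
    rw [ellNorm_estimator hd0 hμ0]
    have := hdiffM t M hM _ (hball y hy b hb.le) _ (hball' y hy b hb.le)
    gcongr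
  have hestm : ∀ t ≤ T, Measurable fun z : (Fin d → ℝ) × (Fin d → ℝ) =>
      estimator I.μ (f t) z.1 z.2 := fun t ht => measurable_estimator (hfcont t ht)
  have hsq : ∀ t ≤ T, Integrable (fun ω => ellNorm (ENNReal.conjExponent p)
        (estimator I.μ (f t) (state I f (fun i => s i ω) t).combined (s t ω)) ^ 2) P ∧
      ∫ ω, ellNorm (ENNReal.conjExponent p)
        (estimator I.μ (f t) (state I f (fun i => s i ω) t).combined (s t ω)) ^ 2 ∂P ≤
        224 * G ^ 2 * xiConst p q d := fun t ht => by
    obtain ⟨M, hM⟩ := hM t ht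
    refine integrable_and_integral_le_of_indepFun (S := shrunk I.X I.α)
      (φ := fun z => ellNorm (ENNReal.conjExponent p) (estimator I.μ (f t) z.1 z.2) ^ 2)
      (C := (d / (2 * I.μ) * (2 * M) * (d : ℝ) ^ (1 - recip p)) ^ 2)
      (hYs t ht).1 (hs t ht) (hYs t ht).2 (hymem t) hae
      ((measurable_ellNorm.comp (hestm t ht)).pow_const 2) (fun y hy b hb => ?_) fun y hy =>
      integral_ellNorm_estimator_sq_le hd hG (hf t ht) hμ0 (hball y hy)
    rw [abs_of_nonneg (sq_nonneg _)]
    exact pow_le_pow_left₀ (ellNorm_nonneg _) (hest t M hM y hy b hb) 2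
  -- the estimator is almost a subgradient in expectation
  have hlin : ∀ t ≤ T, Integrable (fun ω =>
        estimator I.μ (f t) (state I f (fun i => s i ω) t).combined (s t ω) ⬝ᵥ
          ((1 - I.α) • u t - (state I f (fun i => s i ω) t).combined) +
        (f t (state I f (fun i => s i ω) t).combined - f t ((1 - I.α) • u t))) P ∧
      ∫ ω, (estimator I.μ (f t) (state I f (fun i => s i ω) t).combined (s t ω) ⬝ᵥ
          ((1 - I.α) • u t - (state I f (fun i => s i ω) t).combined) +
        (f t (state I f (fun i => s i ω) t).combined - f t ((1 - I.α) • u t))) ∂P ≤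
        2 * G * I.μ := fun t ht => by
    obtain ⟨M, hM⟩ := hM t ht
    have hbd : ∀ y ∈ shrunk I.X I.α, ∀ b : Fin d → ℝ, ellNorm 1 b = 1 →
        |estimator I.μ (f t) y b ⬝ᵥ ((1 - I.α) • u t - y)| ≤
          d / (2 * I.μ) * (2 * M) * (d : ℝ) ^ (1 - recip p) * (2 * R) := fun y hy b hb => by
      refine (abs_dotProduct_le (p := p) _ _).trans ?_
      have h1 := hRS _ (hvmem t ht)
      have h2 := hRS y hy
      have h3 := ellNorm_sub_le (p := p) ((1 - I.α) • u t) y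
      exact mul_le_mul (hest t M hM y hy b hb) (by linarith) (ellNorm_nonneg _)
        ((ellNorm_nonneg _).trans (hest t M hM y hy b hb))
    have hdot : Measurable fun z : (Fin d → ℝ) × (Fin d → ℝ) =>
        estimator I.μ (f t) z.1 z.2 ⬝ᵥ ((1 - I.α) • u t - z.1) :=
      measurable_dotProduct (hestm t ht) (measurable_const.sub measurable_fst)
    refine integrable_and_integral_le_of_indepFun (S := shrunk I.X I.α)
      (φ := fun z => estimator I.μ (f t) z.1 z.2 ⬝ᵥ ((1 - I.α) • u t - z.1) +
        (f t z.1 - f t ((1 - I.α) • u t)))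
      (C := d / (2 * I.μ) * (2 * M) * (d : ℝ) ^ (1 - recip p) * (2 * R) + 2 * M)
      (hYs t ht).1 (hs t ht) (hYs t ht).2 (hymem t) hae
      (hdot.add (((hfcont t ht).measurable.comp measurable_fst).sub_const _))
      (fun y hy b hb => ?_) fun y hy => ?_
    · exact (abs_add_le _ _).trans (add_le_add (hbd y hy b hb)
        (hdiffM t M hM _ (interior_subset (hSX hy)) _ (interior_subset (hSX (hvmem t ht)))))
    · have hi : Integrable (fun b => estimator I.μ (f t) y b ⬝ᵥ ((1 - I.α) • u t - y))
          (unifL1Sphere d) := by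
        refine Integrable.of_bound (hdot.comp measurable_prodMk_left).aestronglyMeasurable
          (d / (2 * I.μ) * (2 * M) * (d : ℝ) ^ (1 - recip p) * (2 * R)) ?_
        filter_upwards [hae] with b hb
        exact hbd y hy b hb
      have := integral_estimator_dotProduct_le hd0 hG (hfc t ht) (hf t ht) hμ0 (hball y hy)
        (hball _ (hvmem t ht))
      dsimp only
      rw [integral_add hi (integrable_const _), integral_const, probReal_univ, one_smul]
      linarith
  have hint : Integrable (fun ω => regret I f u (fun i => s i ω) (T + 1)) P := by
    refine integrable_finsetSum _ fun t ht => ?_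
    have ht : t ≤ T := by have := Finset.mem_range.1 ht; omega
    obtain ⟨M, hM⟩ := hM t ht
    refine (integrable_and_integral_le_of_indepFun (S := shrunk I.X I.α)
      (φ := fun z => (f t (z.1 + I.μ • z.2) + f t (z.1 - I.μ • z.2)) / 2 - f t (u t))
      (C := 2 * M) (c := 2 * M)
      (hYs t ht).1 (hs t ht) (hYs t ht).2 (hymem t) hae ?_ (fun y hy b hb => ?_) fun y hy => ?_).1
    · have hcont := hfcont t ht
      refine Continuous.measurable ?_
      fun_prop
    · have h1 := hdiffM t M hM _ (hball y hy b hb.le) _ (hu t ht)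
      have h2 := hdiffM t M hM _ (hball' y hy b hb.le) _ (hu t ht)
      rw [abs_le] at h1 h2 ⊢
      constructor <;> linarith [h1.1, h1.2, h2.1, h2.2]
    · have := norm_integral_le_of_norm_le_const (μ := unifL1Sphere d) (C := 2 * M)
        (f := fun b => (f t (y + I.μ • b) + f t (y - I.μ • b)) / 2 - f t (u t)) ?_
      · rw [probReal_univ, mul_one] at this
        exact (le_abs_self _).trans this
      filter_upwards [hae] with b hb
      have h1 := hdiffM t M hM _ (hball y hy b hb.le) _ (hu t ht)
      have h2 := hdiffM t M hM _ (hball' y hy b hb.le) _ (hu t ht)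
      rw [Real.norm_eq_abs]
      rw [abs_le] at h1 h2 ⊢
      constructor <;> linarith [h1.1, h1.2, h2.1, h2.2]
  refine ⟨hint, ?_⟩
  have hsball : ∀ᵐ ω ∂P, ∀ t ≤ T, ellNorm 1 (s t ω) = 1 := by
    refine ae_all_iff.2 fun t => ?_
    by_cases ht : t ≤ T
    · have : ∀ᵐ z ∂(P.map (s t)), ellNorm 1 z = 1 := by rw [(hs t ht).map_eq]; exact hae
      filter_upwards [ae_of_ae_map (hs t ht).aemeasurable this] with ω hω _
      exact hω
    · exact Filter.Eventually.of_forall fun ω h => absurd h ht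
  have hpath : pathVariation p T (fun t => (1 - I.α) • u t) ≤ pathVariation p T u := by
    refine Finset.sum_le_sum fun t _ => ?_
    rw [← smul_sub, ellNorm_smul, abs_of_pos (by linarith)]
    have := ellNorm_nonneg (p := p) (u (t + 1) - u t)
    nlinarith
  set A := Real.log (1 / (init I).w k) / I.γ +
    (oscConst I.ψ I.X + bregman I.ψ ((1 - I.α) • u 0) I.y₁ + Gψ * pathVariation p T u) / I.η k
  set B := 4 * I.γ * R ^ 2 + I.η k / (2 * lam)
  have hB : 0 ≤ B := by have := hη k; positivity
  set g : ℕ → Ω → ℝ := fun t ω => ellNorm (ENNReal.conjExponent p)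
    (estimator I.μ (f t) (state I f (fun i => s i ω) t).combined (s t ω)) ^ 2
  set l : ℕ → Ω → ℝ := fun t ω =>
    estimator I.μ (f t) (state I f (fun i => s i ω) t).combined (s t ω) ⬝ᵥ
      ((1 - I.α) • u t - (state I f (fun i => s i ω) t).combined) +
    (f t (state I f (fun i => s i ω) t).combined - f t ((1 - I.α) • u t))
  -- the pathwise bound, with `l` the deviation of the estimator from a subgradient
  have hle : ∀ᵐ ω ∂P, regret I f u (fun i => s i ω) (T + 1) ≤
      A + ∑ t ∈ Finset.range (T + 1), (l t ω + B * g t ω + (G * I.μ + G * e)) := by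
    filter_upwards [hsball, hGψ] with ω hω hGω
    have hreg := linear_regret_le (p := p) hN hlam hdiff hψ ha hb hS hSX hScv hRS hη hγ hy f
      (fun i => s i ω) T (v := fun t => (1 - I.α) • u t) hvmem k hGω
    have hA' : Real.log (1 / (init I).w k) / I.γ + (oscConst I.ψ I.X +
        bregman I.ψ ((1 - I.α) • u 0) I.y₁ + Gψ * pathVariation p T fun t => (1 - I.α) • u t) /
          I.η k ≤ A := by
      have := hη k
      simp only [A]
      gcongr
    have hround : ∀ t ∈ Finset.range (T + 1),
        (f t ((state I f (fun i => s i ω) t).combined + I.μ • s t ω) +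
          f t ((state I f (fun i => s i ω) t).combined - I.μ • s t ω)) / 2 - f t (u t) ≤
        l t ω + estimator I.μ (f t) (state I f (fun i => s i ω) t).combined (s t ω) ⬝ᵥ
          ((state I f (fun i => s i ω) t).combined - (1 - I.α) • u t) + (G * I.μ + G * e) := by
      intro t ht
      have ht : t ≤ T := by have := Finset.mem_range.1 ht; omega
      set y := (state I f (fun i => s i ω) t).combined
      have hyS : y ∈ shrunk I.X I.α := hymem t ω
      have hyX := interior_subset (hSX hyS)
      have hs1 := hω t ht
      have hnorm : ellNorm q (I.μ • s t ω) ≤ I.μ := by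
        rw [ellNorm_smul, abs_of_pos hμ0]
        have := (ellNorm_anti (p := 1) (q := q) Fact.out (s t ω)).trans hs1.le
        nlinarith
      have h1 := (abs_le.1 (hf t ht _ (hball y hyS _ hs1.le) y hyX)).2
      have h2 := (abs_le.1 (hf t ht _ (hball' y hyS _ hs1.le) y hyX)).2
      have h3 := (abs_le.1 (hf t ht _ (interior_subset (hSX (hvmem t ht))) _ (hu t ht))).2
      rw [add_sub_cancel_left] at h1
      rw [sub_sub_cancel_left, ellNorm_neg] at h2
      have e1 : (1 - I.α) • u t - u t = -(I.α • u t) := by rw [sub_smul, one_smul]; abel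
      rw [e1, ellNorm_neg, ellNorm_smul, abs_of_pos hα] at h3
      have h4 := mul_le_mul_of_nonneg_left hnorm hG.le
      have h5 := mul_le_mul_of_nonneg_left (he t ht) hG.le
      have e2 : l t ω = estimator I.μ (f t) y (s t ω) ⬝ᵥ ((1 - I.α) • u t - y) +
        (f t y - f t ((1 - I.α) • u t)) := rfl
      rw [e2, dotProduct_sub, dotProduct_sub]
      linarith
    refine (Finset.sum_le_sum hround).trans ?_
    simp only [Finset.sum_add_distrib, ← Finset.mul_sum] at hreg ⊢
    linarith
  have hgi : ∀ t ∈ Finset.range (T + 1), Integrable (g t) P ∧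
      ∫ ω, g t ω ∂P ≤ 224 * G ^ 2 * xiConst p q d := fun t ht =>
    hsq t (by have := Finset.mem_range.1 ht; omega)
  have hli : ∀ t ∈ Finset.range (T + 1), Integrable (l t) P ∧ ∫ ω, l t ω ∂P ≤ 2 * G * I.μ :=
    fun t ht => hlin t (by have := Finset.mem_range.1 ht; omega)
  have hti : ∀ t ∈ Finset.range (T + 1),
      Integrable (fun ω => l t ω + B * g t ω + (G * I.μ + G * e)) P := fun t ht =>
    (((hli t ht).1.add ((hgi t ht).1.const_mul B)).add (integrable_const _))
  calc ∫ ω, regret I f u (fun i => s i ω) (T + 1) ∂P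
      ≤ ∫ ω, (A + ∑ t ∈ Finset.range (T + 1), (l t ω + B * g t ω + (G * I.μ + G * e))) ∂P :=
        integral_mono_ae hint ((integrable_const A).add (integrable_finsetSum _ hti)) hle
    _ = A + ∑ t ∈ Finset.range (T + 1), (∫ ω, l t ω ∂P + B * ∫ ω, g t ω ∂P + (G * I.μ + G * e)) := by
        rw [integral_add (integrable_const A) (integrable_finsetSum _ hti), integral_const,
          probReal_univ, one_smul, integral_finsetSum _ hti]
        congr 1
        refine Finset.sum_congr rfl fun t ht => ?_
        have hlg : Integrable (fun ω => l t ω + B * g t ω) P :=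
          (hli t ht).1.add ((hgi t ht).1.const_mul B)
        rw [integral_add hlg (integrable_const _),
          integral_add (hli t ht).1 ((hgi t ht).1.const_mul B), integral_const_mul, integral_const,
          probReal_univ, one_smul]
    _ ≤ A + ∑ t ∈ Finset.range (T + 1),
          (2 * G * I.μ + B * (224 * G ^ 2 * xiConst p q d) + (G * I.μ + G * e)) := by
        gcongr with t ht
        · exact (hli t ht).2
        · exact (hgi t ht).2
    _ = _ := by
        rw [Finset.sum_const, Finset.card_range, nsmul_eq_mul]
        push_cast
        ring

end Expectation

end PBMD

/-! ### Choice of the base learner and of the parameters -/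

section Tuning

open Real

/-- The powers of two contain one within a factor two of `√x`. -/
theorem two_pow_floor_logb_le {x : ℝ} (hx : 1 ≤ x) : (2 : ℝ) ^ ⌊1 / 2 * logb 2 x⌋₊ ≤ √x ∧
    √x ≤ 2 ^ (⌊1 / 2 * logb 2 x⌋₊ + 1) := by
  have h0 : 0 ≤ 1 / 2 * logb 2 x := by
    have := logb_nonneg (b := 2) (by norm_num) hx
    positivity
  have e : (2 : ℝ) ^ (1 / 2 * logb 2 x) = √x := by
    rw [mul_comm, rpow_mul (by norm_num), rpow_logb (by norm_num) (by norm_num) (by linarith),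
      sqrt_eq_rpow]
  rw [← e]
  constructor
  · rw [← rpow_natCast]
    exact rpow_le_rpow_of_exponent_le (by norm_num) (Nat.floor_le h0)
  · rw [← rpow_natCast]
    refine rpow_le_rpow_of_exponent_le (by norm_num) ?_
    push_cast
    exact (Nat.lt_floor_add_one _).le

/-- The prior weight of learner `k` decays so slowly that its logarithm is dominated by `2 ^ k`. -/
theorem PBMD.log_one_div_init_w_le {d N : ℕ} (I : PBMD.Input d N) (k : Fin N) :
    log (1 / (PBMD.init I).w k) ≤ 2 * 2 ^ (k : ℕ) := by
  have hN : 0 < N := k.pos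
  have hN' : (0 : ℝ) < N := Nat.cast_pos.2 hN
  have hpos := PBMD.init_w_pos hN I k
  have h1 : 1 / (PBMD.init I).w k ≤ ((k : ℝ) + 2) ^ 2 := by
    rw [div_le_iff₀ hpos]
    have h2 : 1 / (((k : ℝ) + 1) * ((k : ℝ) + 2)) ≤ (PBMD.init I).w k := by
      refine le_mul_of_one_le_left (by positivity) ?_
      rw [le_div_iff₀ hN']; linarith
    calc (1 : ℝ) ≤ ((k : ℝ) + 2) ^ 2 * (1 / (((k : ℝ) + 1) * ((k : ℝ) + 2))) := by
          rw [mul_one_div, le_div_iff₀ (by positivity)]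
          have : (0 : ℝ) ≤ (k : ℕ) := Nat.cast_nonneg _
          nlinarith
      _ ≤ _ := by gcongr
  have h3 : ((k : ℕ) : ℝ) + 1 ≤ 2 ^ (k : ℕ) := by exact_mod_cast Nat.lt_two_pow_self
  have h4 := log_le_sub_one_of_pos (x := ((k : ℕ) : ℝ) + 2) (by positivity)
  calc log (1 / (PBMD.init I).w k) ≤ log (((k : ℝ) + 2) ^ 2) := log_le_log (by positivity) h1
    _ = 2 * log ((k : ℝ) + 2) := by rw [log_pow]; norm_num
    _ ≤ _ := by linarith

/-- The regret bound for a base learner whose step size is optimal up to a factor two. Here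
`V = G √(ξ T / λ)`, `W = G √(ξ T)`, `b = 2 ^ k` for the base learner `k`, and `L` stands for
the logarithm of its inverse prior weight. -/
theorem tuned_regret_le {c₁ c₂ κ D H V lam R γ η W b L : ℝ} (hc₁ : 0 < c₁) (hc₂ : 0 < c₂)
    (hκ : 0 < κ) (hD : 0 < D) (hDH : D ≤ H) (hV : 0 < V) (hlam : 0 < lam) (hR : 0 < R)
    (hRκ : R * √lam ≤ 6 * κ * √D) (hW : 0 < W) (hWV : W = V * √lam)
    (hγ₁ : c₁ / (R * W) ≤ γ) (hγ₂ : γ ≤ c₂ / (R * W))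
    (hb1 : b * √D ≤ √H) (hb2 : √H ≤ 2 * (b * √D)) (hb : 0 < b) (hL : L ≤ 2 * b)
    (hη : η = b * (√D / (√6 * (1 + √2) * V))) :
    L / γ + H / η + (4 * γ * R ^ 2 + η / (2 * lam)) * (224 * W ^ 2) ≤
      (12 * κ / c₁ + 35 + 5376 * c₂ * κ) * (V * √H) := by
  have hH : 0 < H := hD.trans_le hDH
  have hsD : 0 < √D := sqrt_pos.2 hD
  have hsH : 0 < √H := sqrt_pos.2 hH
  have hsl : 0 < √lam := sqrt_pos.2 hlam
  have hγ : 0 < γ := lt_of_lt_of_le (by positivity) hγ₁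
  have hlamsq : √lam ^ 2 = lam := sq_sqrt hlam.le
  have hHsq : √H ^ 2 = H := sq_sqrt hH.le
  have h2l : 1.4 ≤ √2 := by rw [le_sqrt (by norm_num) (by norm_num)]; norm_num
  have h2u : √2 ≤ 1.42 := by rw [sqrt_le_left (by norm_num)]; norm_num
  have h6l : 2.4 ≤ √6 := by rw [le_sqrt (by norm_num) (by norm_num)]; norm_num
  have h6u : √6 ≤ 2.45 := by rw [sqrt_le_left (by norm_num)]; norm_num
  set a := √6 * (1 + √2)
  have hal : 5 ≤ a := by simp only [a]; nlinarith
  have hau : a ≤ 6 := by simp only [a]; nlinarith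
  have ha : 0 < a := by linarith
  have hηpos : 0 < η := by rw [hη]; positivity
  -- the regret of the weights
  have t1 : L / γ ≤ 12 * κ / c₁ * (V * √H) := by
    rw [div_le_iff₀ hγ]
    have e1 : R * W ≤ 6 * κ * √D * V := by
      rw [hWV]; nlinarith
    calc L ≤ 2 * b := hL
      _ = 2 * b * √D * (c₁⁻¹ * c₁) * (R * W) / (√D * (R * W)) := by field_simp
      _ = (2 / c₁) * (b * √D) * (R * W) / √D * (c₁ / (R * W)) := by field_simp
      _ ≤ (2 / c₁) * √H * (6 * κ * √D * V) / √D * γ := by gcongr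
      _ = _ := by field_simp; ring
  -- the initial divergence of the base learner
  have t2 : H / η ≤ 12 * (V * √H) := by
    rw [div_le_iff₀ hηpos]
    calc H = √H * √H := by rw [← sq, hHsq]
      _ ≤ √H * (2 * (b * √D)) := by gcongr
      _ = 2 * a * (V * √H) * η := by rw [hη]; field_simp
      _ ≤ 2 * 6 * (V * √H) * η := by gcongr
      _ = _ := by ring
  -- the second moments in the regret of the base learner
  have t3 : η / (2 * lam) * (224 * W ^ 2) ≤ 23 * (V * √H) := by
    have e : η / (2 * lam) * (224 * W ^ 2) = 112 / a * ((b * √D) * V) := by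
      rw [hη, hWV, mul_pow, hlamsq]; field_simp; ring
    rw [e]
    calc 112 / a * ((b * √D) * V) ≤ 112 / 5 * (√H * V) := by gcongr
      _ ≤ _ := by nlinarith [mul_pos hV hsH]
  -- the second moments in the regret of the weights
  have t4 : 4 * γ * R ^ 2 * (224 * W ^ 2) ≤ 5376 * c₂ * κ * (V * √H) := by
    calc 4 * γ * R ^ 2 * (224 * W ^ 2) ≤ 4 * (c₂ / (R * W)) * R ^ 2 * (224 * W ^ 2) := by gcongr
      _ = 896 * c₂ * V * (R * √lam) := by rw [hWV]; field_simp; ring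
      _ ≤ 896 * c₂ * V * (6 * κ * √H) := by
          have : R * √lam ≤ 6 * κ * √H := hRκ.trans (by gcongr)
          gcongr
      _ = _ := by ring
  rw [add_mul, add_mul, add_mul]
  linarith

/-- The cost of exploring and of shrinking the comparators over `n` rounds. -/
theorem exploration_cost_le {n G μ υ ζ r R ξ lam D H c₃ : ℝ} (hn : 0 < n) (hG : 0 < G) (hμ : 0 < μ)
    (hυ : 0 < υ) (hζ : 0 ≤ ζ) (hr : 0 < r) (hrR : r ≤ R) (hξ : 0 < ξ) (hlam : 0 < lam)
    (hD : 0 < D) (hDH : D ≤ H) (hc₃ : 0 < c₃)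
    (hμle : μ ≤ c₃ * (√(D * ξ) / (√(lam * n) * ((1 + υ + ζ) * R / r)))) :
    n * (3 * G * μ + G * (μ * υ * (R / r))) ≤ 3 * c₃ * (G * √(ξ * n / lam) * √H) := by
  have hRr : 1 ≤ R / r := by rwa [one_le_div hr]
  set Q := (1 + υ + ζ) * R / r with hQ
  have e : Q = (1 + υ + ζ) * (R / r) := by rw [hQ, mul_div_assoc]
  have hQpos : 0 < Q := by rw [e]; positivity
  have hQle : 3 + υ * (R / r) ≤ 3 * Q := by
    have h1 := mul_nonneg hζ (zero_le_one.trans hRr)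
    have h2 := mul_nonneg hυ.le (zero_le_one.trans hRr)
    rw [e]
    linarith
  have hln : 0 < √(lam * n) := sqrt_pos.2 (by positivity)
  have hμQ : μ * Q ≤ c₃ * (√(D * ξ) / √(lam * n)) := by
    calc μ * Q ≤ c₃ * (√(D * ξ) / (√(lam * n) * Q)) * Q := by gcongr
      _ = _ := by field_simp
  have hsn : √n ^ 2 = n := sq_sqrt hn.le
  have hsn0 : 0 < √n := sqrt_pos.2 hn
  have hsl : 0 < √lam := sqrt_pos.2 hlam
  calc n * (3 * G * μ + G * (μ * υ * (R / r))) = n * G * (μ * (3 + υ * (R / r))) := by ring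
    _ ≤ n * G * (μ * (3 * Q)) := by gcongr
    _ = 3 * n * G * (μ * Q) := by ring
    _ ≤ 3 * n * G * (c₃ * (√(D * ξ) / √(lam * n))) := by gcongr
    _ = 3 * (√n ^ 2) * G * (c₃ * (√D * √ξ / (√lam * √n))) := by
        rw [hsn, sqrt_mul hD.le, sqrt_mul hlam.le]
    _ = 3 * c₃ * (G * (√ξ * √n / √lam) * √D) := by field_simp
    _ = 3 * c₃ * (G * √(ξ * n / lam) * √D) := by rw [sqrt_div (by positivity), sqrt_mul hξ.le]
    _ ≤ 3 * c₃ * (G * √(ξ * n / lam) * √H) := by gcongr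

end Tuning

section Constants

theorem zetaConst_nonneg (q : ℝ≥0∞) (d : ℕ) : 0 ≤ zetaConst q d := by
  have : 0 ≤ Real.log d := Real.log_natCast_nonneg d
  unfold zetaConst
  split_ifs <;> positivity

variable {d : ℕ} {p q : ℝ≥0∞} [Fact (1 ≤ p)] [Fact (1 ≤ q)]

/-- Shrinking the comparators costs a multiple of the exploration radius. -/
theorem shrink_mul_ellNorm_le (hd : 0 < d) {r R α μ : ℝ} (hr : 0 < r) (hα : 0 < α)
    (hμ : μ * (d : ℝ) ^ (1 - recip p) = α * r) {x : Fin d → ℝ} (hx : ellNorm p x ≤ R) :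
    α * ellNorm q x ≤ μ * upsilonConst p q d * (R / r) := by
  have hd' : (0 : ℝ) < d := Nat.cast_pos.2 hd
  have e : upsilonConst p q d = (d : ℝ) ^ (1 - recip p) * (d : ℝ) ^ (recip (min q p) - recip p) := by
    rw [upsilonConst, ← Real.rpow_add hd']
    congr 1
    rcases le_total q p with h | h
    · rw [min_eq_left h, max_eq_right h]; ring
    · rw [min_eq_right h, max_eq_left h]; ring
  calc α * ellNorm q x ≤ α * ((d : ℝ) ^ (recip (min q p) - recip p) * R) := by
        gcongr
        refine (ellNorm_le_rpow_min_mul (p := p) hd x).trans ?_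
        gcongr
    _ = (α * r) * (d : ℝ) ^ (recip (min q p) - recip p) * (R / r) := by field_simp
    _ = _ := by rw [← hμ, e]; ring

theorem pathVariation_nonneg (T : ℕ) (u : ℕ → Fin d → ℝ) : 0 ≤ pathVariation p T u :=
  Finset.sum_nonneg fun _ _ => ellNorm_nonneg _

theorem pathVariation_le {R : ℝ} {T : ℕ} {u : ℕ → Fin d → ℝ} (hu : ∀ t ≤ T, ellNorm p (u t) ≤ R) :
    pathVariation p T u ≤ 2 * R * T := by
  calc pathVariation p T u ≤ ∑ t ∈ Finset.range T, 2 * R := by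
        refine Finset.sum_le_sum fun t ht => ?_
        have ht := Finset.mem_range.1 ht
        have h1 := ellNorm_sub_le (p := p) (u (t + 1)) (u t)
        have h2 := hu (t + 1) ht
        have h3 := hu t ht.le
        linarith
    _ = 2 * R * T := by rw [Finset.sum_const, Finset.card_range, nsmul_eq_mul]; ring

/-- The oscillation of the mirror map controls the radius of the feasible set. -/
theorem radius_sq_le_oscConst {X : Set (Fin d → ℝ)} {ψ : (Fin d → ℝ) → ℝ} {r R κ lam : ℝ}
    (hX : IsClosed X) (hcv : Convex ℝ X) (hr : 0 < r) (hsub : ellBall d p r ⊆ X) (hR : 0 < R)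
    (hκ : 0 < κ) {x : Fin d → ℝ} (hx : x ∈ X) (hxR : R ≤ κ * ellNorm p x) (hlam : 0 < lam)
    (hψ : StronglyConvexLp p (interior X) lam ψ) (ha : BddAbove (ψ '' interior X))
    (hb : BddBelow (ψ '' interior X)) : lam / 32 * (R / κ) ^ 2 ≤ oscConst ψ X := by
  have hsh := shrunk_subset_interior (p := p) (α := 1 / 2) hX hcv hsub hr (by norm_num)
    (by norm_num)
  have h0 : (0 : Fin d → ℝ) ∈ interior X :=
    hsh ⟨0, zero_mem_of_ellBall_subset hr hsub, smul_zero _⟩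
  have h := sq_le_oscConst hψ ha hb (hsh (smul_mem_shrunk hx)) h0
  rw [sub_zero, ellNorm_smul, abs_of_pos (by norm_num)] at h
  refine le_trans ?_ h
  have : R / κ ≤ ellNorm p x := by rwa [div_le_iff₀' hκ]
  calc lam / 32 * (R / κ) ^ 2 ≤ lam / 32 * ellNorm p x ^ 2 := by gcongr
    _ = _ := by ring

end Constants

/-! ### The regret bound -/

theorem mainTheorem1 :
    -- the constant `C` depends only on `κ` and on the constants in the choice of `γ` and `μ`
    ∀ κ c₁ c₂ c₃ : ℝ, 0 < κ → 0 < c₁ → 0 < c₂ → 0 < c₃ →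
    ∃ C : ℝ, 0 < C ∧
    ∀ (d T : ℕ) (p q : ℝ≥0∞) [Fact (1 ≤ p)] [Fact (1 ≤ q)] (r R G lam Gψ μ α γ : ℝ)
      (X : Set (Fin d → ℝ)) (ψ : (Fin d → ℝ) → ℝ) (f : ℕ → (Fin d → ℝ) → ℝ)
      (u : ℕ → Fin d → ℝ) (y₁ : Fin d → ℝ)
      (Ω : Type*) [MeasurableSpace Ω] (P : Measure Ω) [IsProbabilityMeasure P]
      (s : ℕ → Ω → Fin d → ℝ),
    3 ≤ d → 1 ≤ T →
    -- the feasible set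
    IsCompact X → Convex ℝ X → 0 < r → ellBall d p r ⊆ X → X ⊆ ellBall d p R →
    (∃ x ∈ X, R ≤ κ * ellNorm p x) →
    -- the losses
    0 < G → (∀ t < T, ConvexOn ℝ Set.univ (f t)) →
    (∀ t < T, ∀ x ∈ X, ∀ y ∈ X, |f t x - f t y| ≤ G * ellNorm q (x - y)) →
    -- the mirror map
    0 < lam → DifferentiableOn ℝ ψ (interior X) → StronglyConvexLp p (interior X) lam ψ →
    BddAbove (ψ '' interior X) →
    -- the comparators
    (∀ t ≤ T, u t ∈ X) →
    -- the samples are independent and uniform on the unit `ℓ_1`-sphere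
    (∀ t < T, HasLaw (s t) (unifL1Sphere d) P) → iIndepFun (fun t : Fin T => s t) P →
    -- the parameters
    0 < α → α < 1 → μ * (d : ℝ) ^ (1 - recip p) = α * r → y₁ ∈ shrunk X α →
    let ξ := xiConst p q d
    let D := oscConst ψ X + bregman ψ ((1 - α) • u 0) y₁
    let N := numLearners D R Gψ T
    let I : PBMD.Input d N :=
      { X := X, ψ := ψ, μ := μ, α := α, γ := γ,
        η := fun k => 2 ^ (k : ℕ) * etaBase D G ξ lam T, y₁ := y₁ }
    c₁ / (R * G * Real.sqrt (ξ * T)) ≤ γ → γ ≤ c₂ / (R * G * Real.sqrt (ξ * T)) →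
    μ ≤ c₃ * (Real.sqrt (D * ξ) /
      (Real.sqrt (lam * T) * ((1 + upsilonConst p q d + zetaConst q d) * R / r))) →
    -- `Gψ` bounds the gradients of the mirror map along the iterates of the base learners
    (∀ᵐ ω ∂P, ∀ t < T, ∀ k : Fin N,
      ellNorm (ENNReal.conjExponent p)
        (gradVec ψ ((PBMD.state I f (fun i => s i ω) t).y k)) ≤ Gψ) →
    Integrable (fun ω => PBMD.regret I f u (fun i => s i ω) T) P ∧
    ∫ ω, PBMD.regret I f u (fun i => s i ω) T ∂P ≤
      C * (G * Real.sqrt ((D + Gψ * pathVariation p T u) * ξ * T / lam)) := by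
  intro κ c₁ c₂ c₃ hκ hc₁ hc₂ hc₃
  refine ⟨12 * κ / c₁ + 35 + 5376 * c₂ * κ + 3 * c₃, by positivity, ?_⟩
  intro d T p q _ _ r R G lam Gψ μ α γ X ψ f u y₁ Ω _ P _ s hd hT hX hcv hr hsub hRsub hκR hG hfc hf
    hlam hdiff hψ ha hu hs hind hα hα1 hμ hy ξ D N I hγ₁ hγ₂ hμle hGψ
  obtain ⟨x, hx, hxR⟩ := hκR
  obtain ⟨T, rfl⟩ : ∃ T', T = T' + 1 := ⟨T - 1, by omega⟩
  have hd0 : 0 < d := by omega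
  have hd' : (0 : ℝ) < d := Nat.cast_pos.2 hd0
  have hrR : r ≤ R := radius_le_of_ellBall_subset hd0 hr (hsub.trans hRsub)
  have hR : 0 < R := hr.trans_le hrR
  have hRX : ∀ x ∈ X, ellNorm p x ≤ R := fun x hx => le_of_lt (hRsub hx)
  have hn : (0 : ℝ) < ((T + 1 : ℕ) : ℝ) := Nat.cast_pos.2 T.succ_pos
  have hξ : 0 < ξ := Real.rpow_pos_of_pos hd' _
  have hSX := shrunk_subset_interior (p := p) hX.isClosed hcv hsub hr hα hα1
  have h0i : (0 : Fin d → ℝ) ∈ interior X :=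
    hSX ⟨0, zero_mem_of_ellBall_subset hr hsub, smul_zero _⟩
  have hb : BddBelow (ψ '' interior X) :=
    bddBelow_image isOpen_interior hdiff hlam hψ h0i fun x hx => hRX x (interior_subset hx)
  have hosc := radius_sq_le_oscConst hX.isClosed hcv hr hsub hR hκ hx hxR hlam hψ ha hb
  have hD1 : lam / 32 * (R / κ) ^ 2 ≤ D := by
    have := bregman_nonneg isOpen_interior hdiff hlam hψ
      (hSX (smul_mem_shrunk (hu 0 (Nat.zero_le _)))) (hSX hy)
    simp only [D]
    linarith
  have hD : 0 < D := lt_of_lt_of_le (by positivity) hD1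
  have hRκ : R * √lam ≤ 6 * κ * √D := by
    refine le_of_sq_le_sq ?_ (by positivity)
    rw [mul_pow, mul_pow, Real.sq_sqrt hlam.le, Real.sq_sqrt hD.le]
    calc R ^ 2 * lam = 32 * κ ^ 2 * (lam / 32 * (R / κ) ^ 2) := by field_simp
      _ ≤ 32 * κ ^ 2 * D := by gcongr
      _ ≤ (6 * κ) ^ 2 * D := by nlinarith [mul_pos (pow_pos hκ 2) hD]
  have hN : 0 < N := Nat.succ_pos _
  have hGψ0 : 0 ≤ Gψ := by
    obtain ⟨ω, hω⟩ := hGψ.exists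
    have := fact_one_le_conjExponent (p := p)
    exact (ellNorm_nonneg _).trans (hω 0 T.succ_pos ⟨0, hN⟩)
  -- the base learner whose step size matches the path variation of the comparators
  set H := D + Gψ * pathVariation p (T + 1) u with hHdef
  have hPV := pathVariation_nonneg (p := p) (T + 1) u
  have hDH : D ≤ H := by
    have : 0 ≤ Gψ * pathVariation p (T + 1) u := mul_nonneg hGψ0 hPV
    linarith
  have hH : 0 < H := hD.trans_le hDH
  have hHD : 1 ≤ H / D := by rwa [one_le_div hD]
  obtain ⟨hk1, hk2⟩ := two_pow_floor_logb_le hHD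
  set k₀ := ⌊1 / 2 * Real.logb 2 (H / D)⌋₊
  have hk : k₀ < N := by
    refine Nat.lt_succ_of_le ((Nat.cast_le (α := ℝ)).1 ?_)
    refine le_trans (Nat.floor_le ?_) (le_trans ?_ (Nat.le_ceil _))
    · have := Real.logb_nonneg (b := 2) (by norm_num) hHD
      positivity
    · have hle : H / D ≤ 1 + 2 * R * Gψ * ((T + 1 : ℕ) : ℝ) / D := by
        have h1 := pathVariation_le (p := p) (T := T + 1) (u := u) fun t ht => hRX _ (hu t ht)
        have h2 := mul_le_mul_of_nonneg_left h1 hGψ0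
        rw [div_le_iff₀ hD, add_mul, div_mul_cancel₀ _ hD.ne']
        linarith
      have := Real.logb_le_logb_of_le (b := 2) (by norm_num) (by linarith) hle
      linarith
  set W := G * √(ξ * ((T + 1 : ℕ) : ℝ)) with hWdef
  set V := G * √(ξ * ((T + 1 : ℕ) : ℝ) / lam) with hVdef
  have hW : 0 < W := by positivity
  have hV : 0 < V := by positivity
  have hsl : 0 < √lam := Real.sqrt_pos.2 hlam
  have hsD : 0 < √D := Real.sqrt_pos.2 hD
  have hWV : W = V * √lam := by
    rw [hWdef, hVdef, Real.sqrt_div (by positivity)]; field_simp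
  have hWsq : W ^ 2 = G ^ 2 * (ξ * ((T + 1 : ℕ) : ℝ)) := by
    rw [hWdef, mul_pow, Real.sq_sqrt (by positivity)]
  have heta : etaBase D G ξ lam (T + 1) = √D / (√6 * (1 + √2) * V) := by
    have e : 6 * (1 + √2) ^ 2 * G ^ 2 * ξ * ((T + 1 : ℕ) : ℝ) / lam =
        (√6 * (1 + √2) * V) ^ 2 := by
      rw [hVdef, mul_pow, mul_pow, mul_pow, Real.sq_sqrt (by norm_num), Real.sq_sqrt (by positivity)]
      ring
    rw [etaBase, e, Real.sqrt_div hD.le, Real.sqrt_sq (by positivity)]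
  have hη : ∀ k, 0 < I.η k := fun k => by
    simp only [I, heta]; positivity
  have hγ : 0 < γ := lt_of_lt_of_le (by positivity) hγ₁
  have hμ0 : 0 < μ := by
    refine pos_of_mul_pos_left (b := (d : ℝ) ^ (1 - recip p)) ?_ (by positivity)
    rw [hμ]; positivity
  have hυ : 0 < upsilonConst p q d := Real.rpow_pos_of_pos hd' _
  have hζ := zetaConst_nonneg q d
  obtain ⟨hint, hle⟩ := PBMD.expected_regret_le (p := p) (q := q) (I := I) (f := f) (u := u) (s := s)
    (T := T) (e := μ * upsilonConst p q d * (R / r)) hd hN hX hcv hr hsub hRsub hG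
    (fun t ht => hfc t (by omega)) (fun t ht => hf t (by omega)) hlam hdiff hψ ha
    (fun t ht => hu t (by omega)) (fun t ht => hs t (by omega)) hind hα hα1 hμ hy hγ hη hGψ0 ⟨k₀, hk⟩
    (by filter_upwards [hGψ] with ω hω t ht; exact hω t (by omega) ⟨k₀, hk⟩)
    (fun t ht => shrink_mul_ellNorm_le hd0 hr hα hμ (hRX _ (hu t (by omega))))
  refine ⟨hint, hle.trans ?_⟩
  have hη0 := hη ⟨k₀, hk⟩
  have htuned := tuned_regret_le (γ := γ) (W := W) (L := Real.log (1 / (PBMD.init I).w ⟨k₀, hk⟩))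
    (η := I.η ⟨k₀, hk⟩) (b := 2 ^ k₀) hc₁ hc₂ hκ hD hDH hV hlam hR hRκ hW hWV
    (by rwa [hWdef, ← mul_assoc]) (by rwa [hWdef, ← mul_assoc])
    (by rwa [Real.sqrt_div hH.le, le_div_iff₀ hsD] at hk1)
    (by rw [Real.sqrt_div hH.le, div_le_iff₀ hsD, pow_succ] at hk2; linarith) (by positivity)
    (PBMD.log_one_div_init_w_le I ⟨k₀, hk⟩) (by simp only [I, heta])
  have hHle : oscConst ψ X + bregman ψ ((1 - α) • u 0) y₁ + Gψ * pathVariation p T u ≤ H := by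
    have : pathVariation p T u ≤ pathVariation p (T + 1) u := by
      rw [pathVariation, pathVariation, Finset.sum_range_succ]
      exact le_add_of_nonneg_right (ellNorm_nonneg _)
    have := mul_le_mul_of_nonneg_left this hGψ0
    rw [hHdef]
    simp only [D]
    linarith
  have herr := exploration_cost_le hn hG hμ0 hυ hζ hr hrR hξ hlam hD hDH hc₃ hμle
  have hVH : G * √(H * ξ * ((T + 1 : ℕ) : ℝ) / lam) = V * √H := by
    rw [hVdef, mul_assoc, mul_assoc, mul_div_assoc, Real.sqrt_mul hH.le]
    ring
  have hHη := div_le_div_of_nonneg_right hHle hη0.le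
  have e : ((T : ℝ) + 1) * (224 * G ^ 2 * xiConst p q d) = 224 * W ^ 2 := by
    rw [hWsq]; push_cast; ring
  rw [← hVdef, Nat.cast_succ] at herr
  rw [hVH, e, add_mul _ (3 * c₃)]
  exact add_le_add ((add_le_add (add_le_add le_rfl hHη) le_rfl).trans htuned) herr
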